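/- Let $(R,\mathfrak m)$ be a Cohen–Macaulay local ring of dimension one, and let $I\subsetneq R$ be a canonical ideal of $R$, i.e. an ideal which, as an $R$-module, is a canonical module of $R$. Suppose that $I$ contains a parameter ideal $Q=(a)$ of $R$ which is a reduction of $I$ (that is, $I^{n+1}=QI^n$ for some $n\ge 0$). In the total ring of fractions $\mathrm Q(R)$ put $$K=\tfrac{I}{a}=\{\tfrac{x}{a}\mid x\in I\},\qquad S=R[K],\qquad B=\mathfrak m:\mathfrak m=\{x\in \mathrm Q(R)\mid x\mathfrak m\subseteq\mathfrak m\}.$$ Let $\mathcal T=R[Qt]$ and $\mathcal R=R[It]$ be the Rees algebras of $Q$ and $I$, let $\mathcal S_Q(I)=I\mathcal R/I\mathcal T$ be the Sally module of $I$ with respect to $Q$, and let $\mathfrak p=\mathfrak m\mathcal T$, a prime ideal of $\mathcal T$. We say that $R$ is a $2$-AGL ring if $\ell_{\mathcal T_{\mathfrak p}}\big(\mathcal S_Q(I)_{\mathfrak p}\big)=2$. A Cohen–Macaulay local ring $(A,\mathfrak a)$ of dimension one is called an AGL (almost Gorenstein local) ring if it possesses a canonical module $\mathrm K_A$ and there is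 an exact sequence $0\to A\to \mathrm K_A\to C\to 0$ of $A$-modules with $\mathfrak a C=(0)$. Assume that $\mathfrak m^2=\alpha\mathfrak m$ for some $\alpha\in\mathfrak m$ and that $B$ is a local ring with maximal ideal $\mathfrak n$. Then the following conditions are equivalent. (1) $R$ is a $2$-AGL ring. (2) $B$ is an AGL ring which is not a Gorenstein ring, and $R/\mathfrak m\cong B/\mathfrak n$ as $R$-algebras (that is, the canonical map $R/\mathfrak m\to B/\mathfrak n$ is an isomorphism). When this is the case, $S$ is a Gorenstein ring, provided $\mathrm v(B)=\mathrm e(B)$, where $\mathrm v(B)$ denotes the embedding dimension of $B$ and $\mathrm e(B)$ its multiplicity with respect to $\mathfrak n$. -/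

import Mathlib

open CategoryTheory IsLocalRing Polynomial

universe u

/-- A Cohen-Macaulay local ring: a Noetherian local ring whose depth (the length of some regular
sequence, which then lies in the maximal ideal) equals its Krull dimension. -/
def IsCohenMacaulayLocal (A : Type u) [CommRing A] [IsLocalRing A] : Prop :=
  IsNoetherianRing A ∧
    ∃ rs : List A, RingTheory.Sequence.IsRegular A rs ∧ ringKrullDim A = rs.length

/-- The module `M` has finite injective dimension. -/
def HasFiniteInjectiveDimension (A : Type u) [CommRing A] (M : Type u) [AddCommGroup M]
    [Module A M] : Prop :=
  ∃ n : ℕ, HasInjectiveDimensionLE (ModuleCat.of A M) n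

/-- `Ext^i_A(k, M)`, where `k` is the residue field of the local ring `A`. -/
noncomputable abbrev ResidueExt (A : Type u) [CommRing A] [IsLocalRing A] (M : Type u)
    [AddCommGroup M] [Module A M] (i : ℕ) : Type u :=
  Abelian.Ext (ModuleCat.of A (ResidueField A)) (ModuleCat.of A M) i

/-- `M` is a canonical module of the Cohen-Macaulay local ring `A` of dimension `d`: a finitely
generated maximal Cohen-Macaulay module (`Ext^i(k, M) = 0` for `i < d`) of type one
(`Ext^d(k, M)` has length one) and of finite injective dimension. -/
def IsCanonicalModule (A : Type u) [CommRing A] [IsLocalRing A] (M : Type u)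
    [AddCommGroup M] [Module A M] : Prop :=
  Module.Finite A M ∧ HasFiniteInjectiveDimension A M ∧
    ∃ d : ℕ, ringKrullDim A = d ∧ (∀ i < d, Subsingleton (ResidueExt A M i)) ∧
      Module.length A (ResidueExt A M d) = 1

/-- Gorenstein local rings: Noetherian local of finite injective dimension over itself. -/
def IsGorensteinLocal (A : Type u) [CommRing A] [IsLocalRing A] : Prop :=
  IsNoetherianRing A ∧ HasFiniteInjectiveDimension A A

/-- Gorenstein rings: Noetherian rings all of whose localizations at primes are Gorenstein. -/
def IsGorenstein (A : Type u) [CommRing A] : Prop :=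
  IsNoetherianRing A ∧
    ∀ (p : Ideal A) [p.IsPrime], IsGorensteinLocal (Localization.AtPrime p)

/-- Almost Gorenstein local rings (in dimension one): a Cohen-Macaulay local ring `A` possessing
a canonical module `M` and an exact sequence `0 → A → M → C → 0` with `𝔪 C = 0`. -/
def IsAGL (A : Type u) [CommRing A] [IsLocalRing A] : Prop :=
  IsCohenMacaulayLocal A ∧
    ∃ (M : Type u) (_ : AddCommGroup M) (_ : Module A M), IsCanonicalModule A M ∧
      ∃ f : A →ₗ[A] M, Function.Injective f ∧
        ∀ r ∈ maximalIdeal A, ∀ c : M ⧸ LinearMap.range f, r • c = 0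

/-- `(a)` is a parameter ideal of a one-dimensional local ring: it is primary to the maximal
ideal. -/
def IsParameter {A : Type u} [CommRing A] [IsLocalRing A] (a : A) : Prop :=
  (Ideal.span {a}).radical = maximalIdeal A

/-- `J` is a reduction of `I`. -/
def IsReductionOf {A : Type u} [CommRing A] (J I : Ideal A) : Prop :=
  J ≤ I ∧ ∃ n : ℕ, I ^ (n + 1) = J * I ^ n

section Sally

variable {A : Type u} [CommRing A]

/-- For ideals `Q ≤ J` and an ideal `I`, the subset `I A[Jt]` of `A[t]`, regarded as a module
over the Rees algebra `A[Qt]`. -/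
noncomputable def idealMulRees (Q I J : Ideal A) : Submodule (reesAlgebra Q) A[X] :=
  Submodule.span (reesAlgebra Q) {f | ∃ x ∈ I, ∃ g ∈ reesAlgebra J, f = C x * g}

/-- The Sally module `I A[It] / I A[Qt]` of `I` with respect to `Q ≤ I`, a module over `A[Qt]`:
the image of `I A[It]` in the quotient of `A[t]` by its submodule `I A[Qt]`. -/
noncomputable def SallyModule (I Q : Ideal A) :
    Submodule (reesAlgebra Q) (A[X] ⧸ idealMulRees Q I Q) :=
  (idealMulRees Q I I).map (idealMulRees Q I Q).mkQ

/-- The extension `𝔪 A[Qt]` of the maximal ideal to the Rees algebra of `Q`. -/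
noncomputable def maximalIdealRees [IsLocalRing A] (Q : Ideal A) : Ideal (reesAlgebra Q) :=
  (maximalIdeal A).map (algebraMap A (reesAlgebra Q))

/-- The rank of the Sally module: the length of its localization at the prime `𝔪 A[Qt]`. -/
noncomputable def sallyRank [IsLocalRing A] (I Q : Ideal A) [(maximalIdealRees Q).IsPrime] : ℕ∞ :=
  Module.length (Localization.AtPrime (maximalIdealRees Q))
    (LocalizedModule (maximalIdealRees Q).primeCompl (SallyModule I Q))

/-- The `2`-almost Gorenstein property, tested on a canonical ideal `I` and a parameter ideal `Q`
that is a reduction of `I`: the Sally module of `I` with respect to `Q` has rank two. (The ideal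
`𝔪 A[Qt]` is always prime when `Q` is generated by a non-zerodivisor.) -/
def Is2AGL [IsLocalRing A] (I Q : Ideal A) : Prop :=
  ∃ _ : (maximalIdealRees Q).IsPrime, sallyRank I Q = 2

end Sally

/-- The submodule `I / a = {x / a | x ∈ I}` of the total ring of fractions, for a
non-zerodivisor `a`. -/
noncomputable def idealDiv {A : Type u} [CommRing A] (I : Ideal A) (a : A) :
    Submodule A (FractionRing A) :=
  (IsLocalization.coeSubmodule (FractionRing A) I).comap
    (LinearMap.mulLeft A (algebraMap A (FractionRing A) a))

/-- The subring `A[I / a]` of the total ring of fractions. -/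
noncomputable def adjoinIdealDiv {A : Type u} [CommRing A] (I : Ideal A) (a : A) :
    Subalgebra A (FractionRing A) :=
  Algebra.adjoin A (idealDiv I a : Set (FractionRing A))

/-- The subring `J : J = {x | x J ⊆ J}` of the total ring of fractions. -/
noncomputable def colonSelf {A : Type u} [CommRing A] (J : Ideal A) :
    Subalgebra A (FractionRing A) where
  carrier := {x | ∀ y ∈ IsLocalization.coeSubmodule (FractionRing A) J,
    x * y ∈ IsLocalization.coeSubmodule (FractionRing A) J}
  mul_mem' := fun {x z} hx hz y hy => by
    rw [mul_assoc]
    exact hx _ (hz y hy)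
  add_mem' := fun {x z} hx hz y hy => by
    rw [add_mul]
    exact add_mem (hx y hy) (hz y hy)
  algebraMap_mem' := fun r y hy => by
    rw [← Algebra.smul_def]
    exact Submodule.smul_mem _ r hy

/-- The embedding dimension `dim_k 𝔪 / 𝔪²` of a Noetherian local ring. -/
noncomputable def embDim (A : Type u) [CommRing A] [IsLocalRing A] : ℕ :=
  Module.finrank (ResidueField A) (CotangentSpace A)

/-- `e` is the multiplicity of the one-dimensional Noetherian local ring `A` with respect to its
maximal ideal: `ℓ(A / 𝔪ⁿ⁺¹) = e (n + 1) - e₁` for all large `n`, with a constant `e₁`. -/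
def IsMultiplicity (A : Type u) [CommRing A] [IsLocalRing A] (e : ℕ) : Prop :=
  ∃ e₁ : ℤ, ∃ N : ℕ, ∀ n ≥ N, ∃ l : ℕ,
    Module.length A (A ⧸ maximalIdeal A ^ (n + 1)) = l ∧ (l : ℤ) = e * (n + 1) - e₁

/-! Everything is reduced to lengths and colons of fractional ideals. As `I ^ (N + 1) = a I ^ N`,
the module K = I/a contains 1 and satisfies K^(N+1) = K^N, so S = R[K] = K^N. The Rees algebra 𝒯 of
Q is a polynomial ring over R in the variable `a t`. Up to a power of `a t`, the Sally module is the
base change to 𝒯 of I^(N+1)/a^N I ≅ S/K, so its rank at 𝔪𝒯 is ℓ_R(S/K) (`sallyRank_eq_length`,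
`length_quotient_idealDiv`). Thus R is 2-AGL exactly when ℓ_R(S/K) = 2.

K has finite injective dimension, and this makes it dualizing: K : (K : X) = X for every regular
fractional ideal X (`isReflexiveDualizing_of_hasInjectiveDimensionLE`). Duality turns the cover 𝔪 ⋖
R into K ⋖ L, where L = K : 𝔪. The hypothesis 𝔪² = α𝔪 means 𝔪 = αB, so L = α⁻¹K : B is a canonical
ideal of B. Either B is Gorenstein and S = K, or B ⊆ L ⊆ S (`gorenstein_or_div_le_pow`). In the
second case ℓ_R(S/K) = 1 + ℓ_B(S/L) · [B/𝔫 : R/𝔪], which is 2 iff the residue fields agree and L ⋖ S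
over B.

It remains to see that L ⋖ S iff B is AGL and not Gorenstein. If L ⋖ S, then S = L : 𝔫, hence L : S
= 𝔫 and 𝔫L ⊆ 𝔫 (`isAGL_of_covBy`). Conversely, the canonical ideal M ⊇ B given by the AGL property
is uL for a unit u (uniqueness of dualizing ideals), and 𝔫M ⊆ 𝔫 passes to all powers of M, which
squeezes S between L and L : 𝔫 (`covBy_of_isAGL`).

For the last claim, v(B) = e(B) is used as 𝔫² : 𝔫 = 𝔫. Duality then gives 𝔫(S : 𝔫) = S, so 𝔫 = L :
S, a canonical ideal of S, is invertible and S is Gorenstein. The colon identity comes from ℓ(A/𝔪J)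
≤ ℓ(A/J) + e (`length_quotient_maximalIdeal_mul_le`), proved over any residue field by passing to
A[X] localized at 𝔪A[X], where a generic combination of generators of 𝔪 gives a reduction of 𝔪. -/

/-! ### Vanishing of Ext along short exact sequences -/

section ExtSequences

open Abelian

variable {A : Type u} [CommRing A] {X Y Z : Type u} [AddCommGroup X] [Module A X]
  [AddCommGroup Y] [Module A Y] [AddCommGroup Z] [Module A Z]

/-- The short exact sequence in `ModuleCat` given by an exact pair of linear maps. -/
theorem shortExact_ofHom {f : X →ₗ[A] Y} {g : Y →ₗ[A] Z} (hf : Function.Injective f)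
    (hg : Function.Surjective g) (h : Function.Exact f g) :
    (ShortComplex.mk (ModuleCat.ofHom f) (ModuleCat.ofHom g)
      (by ext x; exact h.apply_apply_eq_zero x)).ShortExact where
  exact := (ShortComplex.ShortExact.moduleCat_exact_iff_function_exact _).mpr h
  mono_f := (ModuleCat.mono_iff_injective _).mpr hf
  epi_g := (ModuleCat.epi_iff_surjective _).mpr hg

variable {f : X →ₗ[A] Y} {g : Y →ₗ[A] Z} (hf : Function.Injective f)
    (hg : Function.Surjective g) (h : Function.Exact f g) (N : ModuleCat.{u} A)

include hf hg h

theorem subsingleton_ext_middle {i : ℕ} (h₁ : Subsingleton (Ext (ModuleCat.of A X) N i))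
    (h₃ : Subsingleton (Ext (ModuleCat.of A Z) N i)) :
    Subsingleton (Ext (ModuleCat.of A Y) N i) := by
  refine subsingleton_of_forall_eq 0 fun e => ?_
  obtain ⟨y, rfl⟩ := Ext.contravariant_sequence_exact₂ (shortExact_ofHom hf hg h) N e
    (Subsingleton.elim (α := Ext (ModuleCat.of A X) N i) _ _)
  rw [Subsingleton.elim (α := Ext (ModuleCat.of A Z) N i) y 0, Ext.comp_zero]

theorem subsingleton_ext_left {i j : ℕ} (hij : 1 + i = j)
    (h₂ : Subsingleton (Ext (ModuleCat.of A Y) N i))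
    (h₃ : Subsingleton (Ext (ModuleCat.of A Z) N j)) :
    Subsingleton (Ext (ModuleCat.of A X) N i) := by
  refine subsingleton_of_forall_eq 0 fun e => ?_
  obtain ⟨y, rfl⟩ := Ext.contravariant_sequence_exact₁ (shortExact_ofHom hf hg h) N e hij
    (Subsingleton.elim (α := Ext (ModuleCat.of A Z) N j) _ _)
  rw [Subsingleton.elim (α := Ext (ModuleCat.of A Y) N i) y 0, Ext.comp_zero]

theorem subsingleton_ext_right {i j : ℕ} (hij : 1 + i = j)
    (h₁ : Subsingleton (Ext (ModuleCat.of A X) N i))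
    (h₂ : Subsingleton (Ext (ModuleCat.of A Y) N j)) :
    Subsingleton (Ext (ModuleCat.of A Z) N j) := by
  refine subsingleton_of_forall_eq 0 fun e => ?_
  obtain ⟨y, rfl⟩ := Ext.contravariant_sequence_exact₃ (shortExact_ofHom hf hg h) N e
    (Subsingleton.elim (α := Ext (ModuleCat.of A Y) N j) _ _) hij
  rw [Subsingleton.elim (α := Ext (ModuleCat.of A X) N i) y 0, Ext.comp_zero]

/-- The connecting map Hom(X, N) → Ext¹(Z, N) kills every map that extends to Y, and it is onto
because Ext¹(Y, N) = 0. -/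
theorem subsingleton_ext_one_of_extension
    (hext : ∀ φ : X →ₗ[A] N, ∃ ψ : Y →ₗ[A] N, ψ ∘ₗ f = φ)
    (h₂ : Subsingleton (Ext (ModuleCat.of A Y) N 1)) :
    Subsingleton (Ext (ModuleCat.of A Z) N 1) := by
  refine subsingleton_of_forall_eq 0 fun e => ?_
  have hS := shortExact_ofHom hf hg h
  obtain ⟨y, rfl⟩ := Ext.contravariant_sequence_exact₃ hS N e
    (Subsingleton.elim (α := Ext (ModuleCat.of A Y) N 1) _ _) (add_zero 1)
  obtain ⟨φ, rfl⟩ := Ext.homEquiv₀.symm.surjective y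
  obtain ⟨ψ, hψ⟩ := hext φ.hom
  have : φ = ModuleCat.ofHom f ≫ ModuleCat.ofHom ψ := by
    ext x
    exact (LinearMap.congr_fun hψ x).symm
  simp only [Ext.homEquiv₀_symm_apply]
  rw [this, ← Ext.mk₀_comp_mk₀]
  exact hS.extClass_comp_assoc _

theorem extension_of_subsingleton_ext_one
    (h₃ : Subsingleton (Ext (ModuleCat.of A Z) N 1)) (φ : X →ₗ[A] N) :
    ∃ ψ : Y →ₗ[A] N, ψ ∘ₗ f = φ := by
  obtain ⟨y, hy⟩ := Ext.contravariant_sequence_exact₁ (shortExact_ofHom hf hg h) N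
    (Ext.mk₀ (ModuleCat.ofHom φ)) (add_zero 1)
    (Subsingleton.elim (α := Ext (ModuleCat.of A Z) N 1) _ _)
  obtain ⟨ψ, rfl⟩ := Ext.homEquiv₀.symm.surjective y
  refine ⟨ψ.hom, ?_⟩
  simp only [Ext.homEquiv₀_symm_apply] at hy
  rw [Ext.mk₀_comp_mk₀] at hy
  have := Ext.homEquiv₀.symm.injective (a₁ := ModuleCat.ofHom f ≫ ψ) (a₂ := ModuleCat.ofHom φ)
    (by simpa using hy)
  exact congrArg ModuleCat.Hom.hom this

end ExtSequences

/-! ### Ext from finite length modules into modules of finite injective dimension -/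

section ExtFiniteLength

open Abelian

variable {A : Type u} [CommRing A]

theorem exact_subtype_mkQ {M : Type u} [AddCommGroup M] [Module A M] (P : Submodule A M) :
    Function.Exact P.subtype P.mkQ :=
  LinearMap.exact_iff.mpr (by simp)

theorem subsingleton_ext_congr {X Y : Type u} [AddCommGroup X] [Module A X]
    [AddCommGroup Y] [Module A Y] (e : X ≃ₗ[A] Y) (N : ModuleCat.{u} A) {i : ℕ}
    (h : Subsingleton (Ext (ModuleCat.of A X) N i)) :
    Subsingleton (Ext (ModuleCat.of A Y) N i) := by
  refine subsingleton_of_forall_eq 0 fun y => ?_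
  have : y = (Ext.mk₀ (e.toModuleIso.inv)).comp
      ((Ext.mk₀ (e.toModuleIso.hom)).comp y (zero_add i)) (zero_add i) := by
    rw [Ext.mk₀_comp_mk₀_assoc, Iso.inv_hom_id, Ext.mk₀_id_comp]
  rw [this, Subsingleton.elim (α := Ext (ModuleCat.of A X) N i) (Ext.comp _ _ _) 0, Ext.comp_zero]

theorem subsingleton_ext_of_isLocal_simple [IsLocalRing A] (X Y : Type u) [AddCommGroup X]
    [Module A X] [AddCommGroup Y] [Module A Y] [IsSimpleModule A X] [IsSimpleModule A Y]
    (N : ModuleCat.{u} A) {i : ℕ} (h : Subsingleton (Ext (ModuleCat.of A X) N i)) :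
    Subsingleton (Ext (ModuleCat.of A Y) N i) := by
  obtain ⟨m, hm, ⟨e⟩⟩ := isSimpleModule_iff_quot_maximal.mp ‹IsSimpleModule A X›
  obtain ⟨m', hm', ⟨e'⟩⟩ := isSimpleModule_iff_quot_maximal.mp ‹IsSimpleModule A Y›
  obtain rfl := eq_maximalIdeal hm
  obtain rfl := eq_maximalIdeal hm'
  exact subsingleton_ext_congr (e.trans e'.symm) N h

theorem subsingleton_ext_self (N : ModuleCat.{u} A) {i : ℕ} (hi : 1 ≤ i) :
    Subsingleton (Ext (ModuleCat.of A A) N i) := by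
  obtain ⟨i, rfl⟩ := Nat.exists_eq_add_of_le' hi
  exact subsingleton_of_forall_eq 0 fun e => e.eq_zero_of_projective

variable [IsLocalRing A] [IsNoetherianRing A] [Ring.KrullDimLE 1 A] {x : A}

/-- Over a one-dimensional Cohen-Macaulay local ring, `Ext^i(C, N)` vanishes for `i ≥ 2`, `C` of
finite length and `N` of finite injective dimension. -/
theorem subsingleton_ext_of_isFiniteLength (hx : x ∈ maximalIdeal A) (hx0 : x ∈ nonZeroDivisors A)
    (N : ModuleCat.{u} A) (n : ℕ) [hN : HasInjectiveDimensionLE N n] {i : ℕ} (hi : 2 ≤ i)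
    {C : Type u} [AddCommGroup C] [Module A C] (hC : IsFiniteLength A C) :
    Subsingleton (Ext (ModuleCat.of A C) N i) := by
  -- Descending induction on the degree: `d` bounds how far `i` lies below `n + 1`, from where on
  -- the injective dimension alone forces vanishing.
  suffices H : ∀ d i, 2 ≤ i → n + 1 ≤ i + d → ∀ (C : Type u) [AddCommGroup C] [Module A C],
      IsFiniteLength A C → Subsingleton (Ext (ModuleCat.of A C) N i) from
    H (n + 1) i hi (by omega) C hC
  intro d
  induction d with
  | zero =>
    intro i _ hid C _ _ _
    exact HasInjectiveDimensionLT.subsingleton N (n + 1) i (by omega) _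
  | succ d ih =>
    intro i hi hid
    have hfin := isFiniteLength_quotient_span_singleton A hx0
    have hart := (isFiniteLength_iff_isNoetherian_isArtinian.mp hfin).2
    have hnt : Nontrivial (A ⧸ Ideal.span {x}) := by
      rw [Ideal.Quotient.nontrivial_iff]
      exact ((Ideal.span_singleton_le_iff_mem _).mpr hx).trans_lt
        (maximalIdeal.isMaximal A).ne_top.lt_top |>.ne
    -- P is a copy of the residue field inside A/x. Ext^i(A/x, N) vanishes by the resolution of
    -- length one, and Ext^(i+1) of the quotient by P vanishes by induction, so Ext^i(P, N) = 0.
    obtain ⟨P, hP⟩ := IsAtomic.exists_atom (Submodule A (A ⧸ Ideal.span {x}))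
    have hPs : IsSimpleModule A P := isSimpleModule_iff_isAtom.mpr hP
    have hAx : Subsingleton (Ext (ModuleCat.of A (A ⧸ Ideal.span {x})) N i) := by
      refine subsingleton_ext_right (f := LinearMap.mulLeft A x) (g := (Ideal.span {x}).mkQ)
        (i := i - 1) ?_ (Submodule.mkQ_surjective _) ?_ N (by omega)
        (subsingleton_ext_self N (by omega)) (subsingleton_ext_self N (by omega))
      · intro a b hab
        exact (mul_cancel_left_mem_nonZeroDivisors hx0).mp hab
      · rw [LinearMap.exact_iff, Submodule.ker_mkQ]
        ext y
        simp [Ideal.mem_span_singleton', mul_comm]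
    have hPe : Subsingleton (Ext (ModuleCat.of A P) N i) := by
      refine subsingleton_ext_left P.injective_subtype P.mkQ_surjective (exact_subtype_mkQ P) N
        (j := i + 1) (by omega) hAx (ih (i + 1) (by omega) (by omega) _ ?_)
      exact hfin.of_surjective P.mkQ_surjective
    intro C _ _ hC
    induction hC with
    | of_subsingleton =>
      exact subsingleton_of_forall_eq 0 fun e => by
        rw [← Ext.mk₀_id_comp e, (ModuleCat.isZero_of_subsingleton _).eq_of_src (𝟙 _) 0,
          Ext.mk₀_zero, Ext.zero_comp]
    | @of_simple_quotient M _ _ Q hs hQ ihQ =>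
      exact subsingleton_ext_middle Q.injective_subtype Q.mkQ_surjective (exact_subtype_mkQ Q) N
        ihQ (subsingleton_ext_of_isLocal_simple P (M ⧸ Q) N hPe)

/-- Dimension shift along 0 → J → A → A/J: vanishing from degree 2 on for A/J becomes vanishing from
degree 1 on for J. -/
theorem subsingleton_ext_ideal (hx : x ∈ maximalIdeal A) (hx0 : x ∈ nonZeroDivisors A)
    (N : ModuleCat.{u} A) (n : ℕ) [hN : HasInjectiveDimensionLE N n] {i : ℕ} (hi : 1 ≤ i)
    {J : Ideal A} (hJ : IsFiniteLength A (A ⧸ J)) :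
    Subsingleton (Ext (ModuleCat.of A J) N i) :=
  subsingleton_ext_left J.injective_subtype J.mkQ_surjective (exact_subtype_mkQ J) N
    (j := i + 1) (by omega) (subsingleton_ext_self N hi)
    (subsingleton_ext_of_isFiniteLength hx hx0 N n (by omega) hJ)

end ExtFiniteLength

/-! ### Regular fractional ideals and their colons -/

section Fractional

variable {A : Type*} [CommRing A] {Q : Type*} [CommRing Q] [Algebra A Q]

/-- Finitely generated submodules of the total ring of fractions containing a unit. -/
def IsRegularFractional (X : Submodule A Q) : Prop :=
  X.FG ∧ ∃ u ∈ X, IsUnit u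

/-- Double duality with respect to `N` on regular fractional ideals. -/
def IsReflexiveDualizing (N : Submodule A Q) : Prop :=
  IsRegularFractional N ∧ ∀ X : Submodule A Q, IsRegularFractional X → N / (N / X) = X

theorem Submodule.div_le_div_left' (N : Submodule A Q) {X Y : Submodule A Q} (h : X ≤ Y) :
    N / Y ≤ N / X := fun _ hq _ hy => hq _ (h hy)

theorem Submodule.le_div_div (N X : Submodule A Q) : X ≤ N / (N / X) := fun x hx q hq => by
  rw [mul_comm]; exact hq _ hx

theorem Submodule.div_div_eq (N X Y : Submodule A Q) : N / X / Y = N / (X * Y) := by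
  apply le_antisymm
  · rw [Submodule.le_div_iff_mul_le, mul_comm X, ← mul_assoc]
    refine Submodule.mul_le.mpr fun a ha b hb => ?_
    refine Submodule.mul_induction_on ha (fun q hq y hy => hq y hy b hb) fun p q hp hq => ?_
    rw [add_mul]
    exact add_mem hp hq
  · intro q hq y hy x hx
    rw [mul_assoc, mul_comm y]
    exact hq _ (Submodule.mul_mem_mul hx hy)

@[simp]
theorem Submodule.div_one' (N : Submodule A Q) : N / 1 = N := by
  ext q
  refine ⟨fun h => by simpa using h 1 (Submodule.one_le.mp le_rfl), fun h y hy => ?_⟩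
  obtain ⟨r, rfl⟩ := Submodule.mem_one.mp hy
  rw [mul_comm, ← Algebra.smul_def]
  exact N.smul_mem r h

theorem Submodule.mem_span_singleton_mul_of_mul_eq_one {u v q : Q} (huv : u * v = 1)
    {X : Submodule A Q} : q ∈ Submodule.span A {u} * X ↔ v * q ∈ X := by
  rw [Submodule.mem_span_singleton_mul]
  constructor
  · rintro ⟨z, hz, rfl⟩
    rwa [← mul_assoc, mul_comm v, huv, one_mul]
  · intro h
    exact ⟨_, h, by rw [← mul_assoc, huv, one_mul]⟩

theorem Submodule.div_span_singleton_mul {u v : Q} (huv : u * v = 1) (N X : Submodule A Q) :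
    N / (Submodule.span A {u} * X) = Submodule.span A {v} * (N / X) := by
  ext q
  rw [Submodule.mem_span_singleton_mul_of_mul_eq_one ((mul_comm v u).trans huv)]
  constructor
  · intro h y hy
    have := h (u * y) (Submodule.mul_mem_mul (Submodule.mem_span_singleton_self u) hy)
    rwa [← mul_assoc, mul_comm q] at this
  · intro h y hy
    rw [Submodule.mem_span_singleton_mul_of_mul_eq_one huv] at hy
    have := h _ hy
    rwa [show u * q * (v * y) = (u * v) * (q * y) by ring, huv, one_mul] at this

/-- Multiplication by a unit, as an isomorphism of submodules. -/
noncomputable def Submodule.equivSpanSingletonMul {u v : Q} (huv : u * v = 1)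
    (X : Submodule A Q) : X ≃ₗ[A] (Submodule.span A {u} * X : Submodule A Q) :=
  LinearEquiv.ofLinearMap
    ((LinearMap.mulLeft A u).restrict fun x hx =>
      Submodule.mul_mem_mul (Submodule.mem_span_singleton_self u) hx)
    ((LinearMap.mulLeft A v).restrict fun x hx =>
      (Submodule.mem_span_singleton_mul_of_mul_eq_one huv).mp hx)
    (by
      ext x
      change u * (v * (x : Q)) = x
      rw [← mul_assoc, huv, one_mul])
    (by
      ext x
      change v * (u * (x : Q)) = x
      rw [← mul_assoc, mul_comm v, huv, one_mul])

theorem span_singleton_mul_cancel {u v : Q} (huv : u * v = 1) (X : Submodule A Q) :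
    Submodule.span A {u} * (Submodule.span A {v} * X) = X := by
  rw [← mul_assoc, Submodule.span_mul_span, Set.singleton_mul_singleton, huv,
    ← Submodule.one_eq_span, one_mul]

namespace IsRegularFractional

theorem one : IsRegularFractional (1 : Submodule A Q) :=
  ⟨by rw [Submodule.one_eq_span]; exact Submodule.fg_span_singleton 1, 1, (Submodule.one_le.mp le_rfl),
    isUnit_one⟩

theorem mul {X Y : Submodule A Q} (hX : IsRegularFractional X) (hY : IsRegularFractional Y) :
    IsRegularFractional (X * Y) := by
  obtain ⟨hX, u, hu, hu'⟩ := hX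
  obtain ⟨hY, v, hv, hv'⟩ := hY
  exact ⟨hX.mul hY, u * v, Submodule.mul_mem_mul hu hv, hu'.mul hv'⟩

theorem of_le_of_le [IsNoetherianRing A] {X Y Z : Submodule A Q} (hX : IsRegularFractional X)
    (hZ : IsRegularFractional Z) (hXY : X ≤ Y) (hYZ : Y ≤ Z) : IsRegularFractional Y := by
  obtain ⟨u, hu, hu'⟩ := hX.2
  have : IsNoetherian A Z := isNoetherian_of_fg_of_noetherian Z hZ.1
  exact ⟨Submodule.FG.of_le hZ.1 hYZ, u, hXY hu, hu'⟩

variable [IsFractionRing A Q]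

theorem exists_denominator {X : Submodule A Q} (hX : X.FG) :
    ∃ d ∈ nonZeroDivisors A, ∀ y ∈ X, ∃ b : A, algebraMap A Q b = algebraMap A Q d * y := by
  obtain ⟨d, hd, h⟩ := FractionalIdeal.isFractional_of_fg (S := nonZeroDivisors A) hX
  refine ⟨d, hd, fun y hy => ?_⟩
  obtain ⟨b, hb⟩ := h y hy
  exact ⟨b, by rw [hb, Algebra.smul_def]⟩

omit [IsFractionRing A Q] in
theorem isUnit_algebraMap (Q : Type*) [CommRing Q] [Algebra A Q] [IsFractionRing A Q] {d : A}
    (hd : d ∈ nonZeroDivisors A) : IsUnit (algebraMap A Q d) :=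
  IsLocalization.map_units Q ⟨d, hd⟩

/-- A regular multiple of one finitely generated submodule lies in another regular one. -/
theorem exists_smul_mem {X Y : Submodule A Q} (hX : IsRegularFractional X) (hY : Y.FG) :
    ∃ d ∈ nonZeroDivisors A, ∀ y ∈ Y, d • y ∈ X := by
  obtain ⟨u, hu, hu'⟩ := hX.2
  obtain ⟨v, hv⟩ := hu'.exists_right_inv
  obtain ⟨d, hd, h⟩ := exists_denominator (A := A) (X := Submodule.span A {v} * Y)
    ((Submodule.fg_span_singleton v).mul hY)
  refine ⟨d, hd, fun y hy => ?_⟩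
  obtain ⟨b, hb⟩ := h (v * y) (Submodule.mul_mem_mul (Submodule.mem_span_singleton_self v) hy)
  have : d • y = b • u := by
    rw [Algebra.smul_def, Algebra.smul_def, hb]
    linear_combination (-algebraMap A Q d * y) * hv
  rw [this]
  exact X.smul_mem _ hu

theorem div [IsNoetherianRing A] {X Y : Submodule A Q} (hX : IsRegularFractional X)
    (hY : IsRegularFractional Y) : IsRegularFractional (X / Y) := by
  obtain ⟨d, hd, h⟩ := exists_smul_mem hX hY.1
  obtain ⟨u, hu, hu'⟩ := hY.2
  obtain ⟨v, hv⟩ := hu'.exists_right_inv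
  have hfg : (Submodule.span A {v} * X).FG := (Submodule.fg_span_singleton v).mul hX.1
  have : IsNoetherian A (Submodule.span A {v} * X : Submodule A Q) :=
    isNoetherian_of_fg_of_noetherian _ hfg
  refine ⟨Submodule.FG.of_le hfg fun q hq => ?_, algebraMap A Q d, ?_, isUnit_algebraMap Q hd⟩
  · rw [Submodule.mem_span_singleton_mul_of_mul_eq_one ((mul_comm v u).trans hv), mul_comm]
    exact hq u hu
  · intro y hy
    rw [← Algebra.smul_def]
    exact h y hy

theorem coeSubmodule [IsNoetherianRing A] {J : Ideal A} {x : A} (hx : x ∈ J)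
    (hx0 : x ∈ nonZeroDivisors A) : IsRegularFractional (IsLocalization.coeSubmodule Q J) :=
  ⟨(IsNoetherian.noetherian J).map _, algebraMap A Q x, ⟨x, hx, rfl⟩,
    isUnit_algebraMap Q hx0⟩

/-- A regular fractional ideal is isomorphic to an ideal containing a non-zerodivisor. -/
theorem exists_ideal_equiv {X : Submodule A Q} (hX : IsRegularFractional X) :
    ∃ J : Ideal A, (∃ x ∈ J, x ∈ nonZeroDivisors A) ∧ Nonempty (J ≃ₗ[A] X) := by
  obtain ⟨d, hd, h⟩ := exists_denominator hX.1
  obtain ⟨e, hde⟩ := (isUnit_algebraMap Q hd).exists_right_inv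
  set Y : Submodule A Q := Submodule.span A {algebraMap A Q d} * X
  have hY : Y ≤ LinearMap.range (Algebra.linearMap A Q) := by
    intro q hq
    obtain ⟨z, hz, rfl⟩ := Submodule.mem_span_singleton_mul.mp hq
    exact h z hz
  have hmap := Submodule.map_comap_eq_of_le hY
  obtain ⟨u, hu, hu'⟩ := hX.2
  refine ⟨Y.comap (Algebra.linearMap A Q), ?_, ⟨?_⟩⟩
  · obtain ⟨b, hb⟩ := h u hu
    refine ⟨b, ?_, ?_⟩
    · change algebraMap A Q b ∈ Y
      rw [hb]
      exact Submodule.mul_mem_mul (Submodule.mem_span_singleton_self _) hu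
    · refine mem_nonZeroDivisors_iff_right.mpr fun z hz => ?_
      have hbu : IsUnit (algebraMap A Q b) := hb ▸ (isUnit_algebraMap Q hd).mul hu'
      apply IsFractionRing.injective A Q
      have := congrArg (algebraMap A Q) hz
      rw [map_mul, map_zero] at this
      rw [map_zero]
      exact hbu.mul_left_eq_zero.mp this
  · exact ((Submodule.equivMapOfInjective (Algebra.linearMap A Q)
      (IsFractionRing.injective A Q) _).trans (LinearEquiv.ofEq _ _ hmap)).trans
      (Submodule.equivSpanSingletonMul hde X).symm

/-- Linear maps between fractional ideals are multiplications. -/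
theorem exists_eq_mul {X : Submodule A Q} (hX : IsRegularFractional X) (φ : X →ₗ[A] Q) :
    ∃ q : Q, ∀ y : X, φ y = q * y := by
  obtain ⟨u, hu, hu'⟩ := hX.2
  obtain ⟨v, hv⟩ := hu'.exists_right_inv
  refine ⟨φ ⟨u, hu⟩ * v, fun y => ?_⟩
  -- Clearing the denominator of y/u makes `d • y` an A-multiple of u, so A-linearity determines φ y
  -- from φ u.
  obtain ⟨⟨b, d⟩, hbd⟩ := IsLocalization.surj (nonZeroDivisors A) (v * y)
  simp only at hbd
  have h1 : (d : A) • y = b • (⟨u, hu⟩ : X) := by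
    ext
    simp only [Submodule.coe_smul, Algebra.smul_def]
    linear_combination u * hbd - (algebraMap A Q d * (y : Q)) * hv
  have h2 := congrArg φ h1
  rw [map_smul, map_smul, Algebra.smul_def, Algebra.smul_def, ← hbd] at h2
  apply (IsLocalization.map_units Q d).mul_left_cancel
  rw [h2]
  ring

end IsRegularFractional

end Fractional

/-! ### Finite injective dimension implies double duality -/

section Duality

variable {A : Type u} [CommRing A] [IsLocalRing A] [IsNoetherianRing A] [Ring.KrullDimLE 1 A]
  {Q : Type u} [CommRing Q] [Algebra A Q] [IsFractionRing A Q]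

omit [IsLocalRing A] [Ring.KrullDimLE 1 A] in
theorem exists_maximalIdeal_pow_le_span [IsLocalRing A] [Ring.KrullDimLE 1 A] {d : A}
    (hd : d ∈ nonZeroDivisors A) : ∃ k, maximalIdeal A ^ k ≤ Ideal.span {d} := by
  by_cases hu : IsUnit d
  · exact ⟨0, by rw [Ideal.span_singleton_eq_top.mpr hu]; exact le_top⟩
  · have hart := (isFiniteLength_iff_isNoetherian_isArtinian.mp
      (isFiniteLength_quotient_span_singleton A hd)).2
    have : IsArtinianRing (A ⧸ Ideal.span {d}) :=
      isArtinian_of_tower A hart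
    exact exists_maximalIdeal_pow_le_of_isArtinianRing_quotient _

theorem exists_maximalIdeal_pow_smul_mem {X Y : Submodule A Q} (hX : IsRegularFractional X)
    (hY : Y.FG) : ∃ k, ∀ r ∈ maximalIdeal A ^ k, ∀ y ∈ Y, r • y ∈ X := by
  obtain ⟨d, hd, h⟩ := IsRegularFractional.exists_smul_mem hX hY
  obtain ⟨k, hk⟩ := exists_maximalIdeal_pow_le_span hd
  refine ⟨k, fun r hr y hy => ?_⟩
  obtain ⟨s, rfl⟩ := Ideal.mem_span_singleton'.mp (hk hr)
  rw [mul_smul]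
  exact X.smul_mem s (h y hy)

/-- The quotient of two regular fractional ideals has a nonzero socle. -/
theorem exists_socle_element {X Y : Submodule A Q} (hX : IsRegularFractional X)
    (hY : Y.FG) (h : ¬ Y ≤ X) : ∃ z ∈ Y, z ∉ X ∧ ∀ r ∈ maximalIdeal A, r • z ∈ X := by
  classical
  -- Take the least power of 𝔪 carrying Y into X; an element outside X obtained with the preceding
  -- power is sent into X by 𝔪.
  have hex := exists_maximalIdeal_pow_smul_mem hX hY
  obtain ⟨k, hk⟩ : ∃ k, Nat.find hex = k + 1 := by
    refine Nat.exists_eq_succ_of_ne_zero fun h0 => h fun y hy => ?_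
    have := Nat.find_spec hex
    rw [h0] at this
    simpa using this 1 (by simp) y hy
  have hlt := Nat.find_min hex (show k < Nat.find hex by omega)
  have hsp := Nat.find_spec hex
  rw [hk] at hsp
  push Not at hlt
  obtain ⟨r, hr, y, hy, hry⟩ := hlt
  refine ⟨r • y, Y.smul_mem r hy, hry, fun s hs => ?_⟩
  rw [← mul_smul]
  exact hsp _ (by rw [pow_succ']; exact Ideal.mul_mem_mul hs hr) y hy

omit [IsNoetherianRing A] [Ring.KrullDimLE 1 A] [IsFractionRing A Q] in
-- The quotient is generated by one nonzero element killed by 𝔪, so it is a copy of the residue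
-- field.
theorem covBy_sup_span {X : Submodule A Q} {z : Q} (hz : z ∉ X)
    (h : ∀ r ∈ maximalIdeal A, r • z ∈ X) : X ⋖ X ⊔ Submodule.span A {z} := by
  refine ⟨lt_of_le_of_ne le_sup_left fun he => hz ?_, fun W hXW hWZ => ?_⟩
  · rw [he]
    exact Submodule.mem_sup_right (Submodule.mem_span_singleton_self z)
  · obtain ⟨w, hw, hwX⟩ := SetLike.exists_of_lt hXW
    obtain ⟨y, hy, t, ht, rfl⟩ := Submodule.mem_sup.mp (hWZ.le hw)
    obtain ⟨r, rfl⟩ := Submodule.mem_span_singleton.mp ht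
    have hr : IsUnit r := by
      by_contra hr
      exact hwX (add_mem hy (h r ((mem_maximalIdeal r).mpr hr)))
    apply hWZ.not_ge
    refine sup_le hXW.le ((Submodule.span_singleton_le_iff_mem z W).mpr ?_)
    have : r • z ∈ W := (Submodule.add_mem_iff_right W (hXW.le hy)).mp hw
    obtain ⟨u, rfl⟩ := hr
    simpa [← mul_smul] using W.smul_mem (↑u⁻¹ : A) this

omit [IsLocalRing A] [IsNoetherianRing A] [Ring.KrullDimLE 1 A] [IsFractionRing A Q] in
theorem mem_div_coeSubmodule {N : Submodule A Q} {J : Ideal A} {q : Q} :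
    q ∈ N / IsLocalization.coeSubmodule Q J ↔ ∀ r ∈ J, r • q ∈ N := by
  constructor
  · intro h r hr
    rw [Algebra.smul_def, mul_comm]
    exact h _ ⟨r, hr, rfl⟩
  · rintro h _ ⟨r, hr, rfl⟩
    have := h r hr
    rwa [Algebra.smul_def, mul_comm] at this

variable {x : A} (hx : x ∈ maximalIdeal A) (hx0 : x ∈ nonZeroDivisors A)

include hx hx0

/-- By Nakayama x⁻¹N is not contained in N, and a socle element of the excess lies in N : 𝔪 but not
in N. -/
theorem not_div_maximalIdeal_le {N : Submodule A Q} (hN : IsRegularFractional N) :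
    ¬ N / IsLocalization.coeSubmodule Q (maximalIdeal A) ≤ N := by
  obtain ⟨v, hv⟩ := (IsRegularFractional.isUnit_algebraMap Q hx0).exists_right_inv
  obtain ⟨u, hu, hu'⟩ := hN.2
  obtain ⟨z, hz, hzN, hzm⟩ := exists_socle_element (X := N) (Y := Submodule.span A {v} * N) hN
    ((Submodule.fg_span_singleton v).mul hN.1) (by
      intro hle
      have hle' : N ≤ maximalIdeal A • N := by
        intro y hy
        have := hle (Submodule.mul_mem_mul (Submodule.mem_span_singleton_self v) hy)
        have h2 := Submodule.smul_mem_smul hx this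
        rwa [show x • (v * y) = y by rw [Algebra.smul_def, ← mul_assoc, hv, one_mul]] at h2
      have hbot := Submodule.eq_bot_of_le_smul_of_le_jacobson_bot _ N hN.1 hle'
        (maximalIdeal_le_jacobson _)
      rw [hbot, Submodule.mem_bot] at hu
      rw [hu, isUnit_zero_iff] at hu'
      have := (IsFractionRing.injective A Q).nontrivial
      exact zero_ne_one hu')
  exact fun hle => hzN (hle (mem_div_coeSubmodule.mpr hzm))

omit hx hx0 [IsLocalRing A] in
/-- An ideal containing a non-zerodivisor has a quotient of finite length. -/
theorem isFiniteLength_quotient_of_mem {J : Ideal A} {y : A} (hy : y ∈ J)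
    (hy0 : y ∈ nonZeroDivisors A) : IsFiniteLength A (A ⧸ J) :=
  (isFiniteLength_quotient_span_singleton A hy0).of_surjective
    (Submodule.factor_surjective ((Ideal.span_singleton_le_iff_mem J).mpr hy))

theorem IsRegularFractional.subsingleton_ext {X : Submodule A Q} (hX : IsRegularFractional X)
    (N : ModuleCat.{u} A) (n : ℕ) [HasInjectiveDimensionLE N n] {i : ℕ} (hi : 1 ≤ i) :
    Subsingleton (Abelian.Ext (ModuleCat.of A X) N i) := by
  obtain ⟨J, ⟨y, hy, hy0⟩, ⟨e⟩⟩ := hX.exists_ideal_equiv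
  exact subsingleton_ext_congr e N (subsingleton_ext_ideal hx hx0 N n hi
    (isFiniteLength_quotient_of_mem hy hy0))

/-- A regular fractional ideal of finite injective dimension over a one-dimensional
Cohen-Macaulay local ring is dualizing. -/
theorem isReflexiveDualizing_of_hasInjectiveDimensionLE {N : Submodule A Q}
    (hN : IsRegularFractional N) (n : ℕ) [HasInjectiveDimensionLE (ModuleCat.of A N) n] :
    IsReflexiveDualizing N := by
  refine ⟨hN, fun X hX => le_antisymm ?_ (Submodule.le_div_div N X)⟩
  by_contra hle
  obtain ⟨z, hz, hzX, hzm⟩ := exists_socle_element hX (hN.div (hN.div hX)).1 hle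
  set Z := X ⊔ Submodule.span A {z}
  have hXZ : X ⋖ Z := covBy_sup_span hzX hzm
  have hZX : Z ≤ N / (N / X) :=
    sup_le (Submodule.le_div_div N X) ((Submodule.span_singleton_le_iff_mem _ _).mpr hz)
  have hZ : IsRegularFractional Z := hX.of_le_of_le (hN.div (hN.div hX)) hXZ.le hZX
  have hsimple := (covBy_iff_quot_is_simple hXZ.le).mp hXZ
  have hX' : Function.Injective (Submodule.inclusion hXZ.le) := Submodule.inclusion_injective _
  -- Every map X → N is multiplication by some q in N : X; since Z ⊆ N : (N : X), the same q maps Z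
  -- into N. All maps extend, hence Ext¹(Z/X, N) = 0, and Z/X is the residue field.
  have hext : Subsingleton (Abelian.Ext (ModuleCat.of A (Z ⧸ X.comap Z.subtype))
      (ModuleCat.of A N) 1) := by
    refine subsingleton_ext_one_of_extension (f := Submodule.inclusion hXZ.le)
      (g := (X.comap Z.subtype).mkQ) hX' (Submodule.mkQ_surjective _) ?_ _ ?_
      (hZ.subsingleton_ext hx hx0 _ n le_rfl)
    · rw [LinearMap.exact_iff, Submodule.ker_mkQ, Submodule.range_inclusion]
    · intro φ
      obtain ⟨q, hq⟩ := hX.exists_eq_mul (N.subtype ∘ₗ φ)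
      have hqN : q ∈ N / X := fun y hy => by
        rw [← hq ⟨y, hy⟩]
        exact (φ ⟨y, hy⟩).2
      refine ⟨(LinearMap.mulLeft A q).restrict (p := Z) (q := N) fun w hw => ?_, ?_⟩
      · have := hZX hw q hqN
        rwa [mul_comm] at this
      · ext y
        exact (hq y).symm
  have hk : Subsingleton (Abelian.Ext (ModuleCat.of A (A ⧸ maximalIdeal A))
      (ModuleCat.of A N) 1) := by
    have : IsSimpleModule A (A ⧸ maximalIdeal A) :=
      isSimpleModule_iff_quot_maximal.mpr ⟨_, maximalIdeal.isMaximal A, ⟨LinearEquiv.refl _ _⟩⟩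
    exact subsingleton_ext_of_isLocal_simple (Z ⧸ X.comap Z.subtype) _ _ hext
  -- The vanishing of Ext¹(A/𝔪, N) extends every map 𝔪 → N to A, which says N : 𝔪 ⊆ N.
  apply not_div_maximalIdeal_le hx hx0 hN
  intro q hq
  rw [mem_div_coeSubmodule] at hq
  obtain ⟨ψ, hψ⟩ := extension_of_subsingleton_ext_one (Submodule.injective_subtype _)
    (Submodule.mkQ_surjective _) (exact_subtype_mkQ (maximalIdeal A)) _ hk
    ((LinearMap.toSpanSingleton A Q q).restrict (p := maximalIdeal A) (q := N) hq)
  have h1 : x • (ψ 1 : Q) = x • q := by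
    have := congrArg Subtype.val (LinearMap.congr_fun hψ ⟨x, hx⟩)
    rw [← Submodule.coe_smul, ← map_smul, smul_eq_mul, mul_one]
    exact this
  rw [Algebra.smul_def, Algebra.smul_def] at h1
  rw [← (IsRegularFractional.isUnit_algebraMap Q hx0).mul_left_cancel h1]
  exact (ψ 1).2

end Duality

/-! ### Dualizing fractional ideals: covers and uniqueness -/

section Dualizing

variable {A : Type u} [CommRing A] {Q : Type u} [CommRing Q] [Algebra A Q]

theorem covBy_one_coeSubmodule_maximalIdeal [IsLocalRing A] [IsFractionRing A Q] :
    IsLocalization.coeSubmodule Q (maximalIdeal A) ⋖ 1 := by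
  have hinj := IsLocalization.coeSubmodule_strictMono (R := A) (S := Q) (M := nonZeroDivisors A)
    le_rfl
  rw [← IsLocalization.coeSubmodule_top]
  refine ⟨hinj (maximalIdeal.isMaximal A).ne_top.lt_top, fun W h1 h2 => ?_⟩
  have hW : (W.comap (Algebra.linearMap A Q)).map (Algebra.linearMap A Q) = W := by
    apply Submodule.map_comap_eq_of_le
    rw [LinearMap.range_eq_map]
    exact h2.le
  change IsLocalization.coeSubmodule Q (W.comap (Algebra.linearMap A Q)) = W at hW
  rw [← hW] at h1 h2
  have hle := fun I J => IsLocalization.coeSubmodule_le_coeSubmodule (R := A) (S := Q)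
    (M := nonZeroDivisors A) le_rfl (I := I) (J := J)
  rw [lt_iff_le_not_ge, hle, hle, ← lt_iff_le_not_ge] at h1 h2
  exact h2.ne ((Ideal.isMaximal_def.mp (maximalIdeal.isMaximal A)).2 _ h1)

theorem Submodule.le_div_comm {N X Y : Submodule A Q} (h : X ≤ N / Y) : Y ≤ N / X :=
  (Submodule.le_div_div N Y).trans (Submodule.div_le_div_left' N h)

/-- A regular fractional ideal with a unique maximal quotient by `𝔪` is principal. -/
theorem IsRegularFractional.exists_eq_span_singleton [IsLocalRing A]
    {X : Submodule A Q} (hX : IsRegularFractional X)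
    (h : IsLocalization.coeSubmodule Q (maximalIdeal A) * X ⋖ X) :
    ∃ u v : Q, u * v = 1 ∧ X = Submodule.span A {u} := by
  obtain ⟨k, hk, hkm⟩ := SetLike.exists_of_lt h.lt
  have hle : Submodule.span A {k} ≤ X := (Submodule.span_singleton_le_iff_mem _ _).mpr hk
  have hsup : Submodule.span A {k} ⊔ IsLocalization.coeSubmodule Q (maximalIdeal A) * X = X := by
    refine (h.eq_or_eq le_sup_right (sup_le hle h.le)).resolve_left fun he => hkm ?_
    rw [← he]
    exact Submodule.mem_sup_left (Submodule.mem_span_singleton_self k)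
  have hXk : X ≤ Submodule.span A {k} := by
    refine Submodule.le_of_le_smul_of_le_jacobson_bot (I := maximalIdeal A) hX.1
      (maximalIdeal_le_jacobson _) ?_
    refine hsup.ge.trans (sup_le_sup_left (Submodule.mul_le.mpr ?_) _)
    rintro _ ⟨r, hr, rfl⟩ y hy
    rw [Algebra.linearMap_apply, ← Algebra.smul_def]
    exact Submodule.smul_mem_smul hr hy
  have hXe := le_antisymm hXk hle
  obtain ⟨w, hw, hw'⟩ := hX.2
  rw [hXe] at hw
  obtain ⟨r, rfl⟩ := Submodule.mem_span_singleton.mp hw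
  rw [Algebra.smul_def] at hw'
  obtain ⟨v, hv⟩ := (isUnit_of_mul_isUnit_right hw').exists_right_inv
  exact ⟨k, v, hv, hXe⟩

namespace IsReflexiveDualizing

variable {N : Submodule A Q} (hN : IsReflexiveDualizing N)

include hN

theorem div_self : N / N = 1 := by
  simpa using hN.2 1 IsRegularFractional.one

theorem div_le_div_iff {X Y : Submodule A Q} (hX : IsRegularFractional X)
    (hY : IsRegularFractional Y) : N / X ≤ N / Y ↔ Y ≤ X := by
  refine ⟨fun h => ?_, Submodule.div_le_div_left' N⟩
  rw [← hN.2 X hX, ← hN.2 Y hY]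
  exact Submodule.div_le_div_left' N h

variable [IsNoetherianRing A] [IsFractionRing A Q]

/-- Duality is an order-reversing involution on regular fractional ideals, and anything between two
regular fractional ideals is again one. -/
theorem covBy_div {X Y : Submodule A Q} (hX : IsRegularFractional X)
    (hY : IsRegularFractional Y) (h : X ⋖ Y) : N / Y ⋖ N / X := by
  refine ⟨lt_of_le_not_ge (Submodule.div_le_div_left' N h.le) fun hle => ?_, fun W h1 h2 => ?_⟩
  · exact h.lt.not_ge ((hN.div_le_div_iff hX hY).mp hle)
  · have hW : IsRegularFractional W := (hN.1.div hY).of_le_of_le (hN.1.div hX) h1.le h2.le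
    have h3 : X ≤ N / W := Submodule.le_div_comm h2.le
    have h4 : N / W ≤ Y := by
      rw [← hN.2 Y hY]
      exact Submodule.div_le_div_left' N h1.le
    rcases h.eq_or_eq h3 h4 with he | he
    · exact h2.ne (by rw [← hN.2 W hW, he])
    · exact h1.ne (by rw [← hN.2 W hW, he])

variable [IsLocalRing A] {x : A} (hx : x ∈ maximalIdeal A) (hx0 : x ∈ nonZeroDivisors A)

include hx hx0

theorem covBy_div_maximalIdeal :
    N ⋖ N / IsLocalization.coeSubmodule Q (maximalIdeal A) := by
  simpa using hN.covBy_div (IsRegularFractional.coeSubmodule hx hx0) IsRegularFractional.one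
    covBy_one_coeSubmodule_maximalIdeal

omit hx hx0 [IsNoetherianRing A] in
-- N : X is a proper ideal of A, hence inside 𝔪; dualizing back reverses the inclusion.
theorem div_maximalIdeal_le {X : Submodule A Q} (hX : IsRegularFractional X) (h : N < X) :
    N / IsLocalization.coeSubmodule Q (maximalIdeal A) ≤ X := by
  rw [← hN.2 X hX]
  apply Submodule.div_le_div_left'
  have h1 : N / X ≤ 1 := by
    rw [← hN.div_self]
    exact Submodule.div_le_div_left' N h.le
  have h2 : N / X ≠ 1 := fun he => h.ne (by rw [← hN.2 X hX, he, Submodule.div_one'])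
  have hm := covBy_one_coeSubmodule_maximalIdeal (A := A) (Q := Q)
  rw [← IsLocalization.coeSubmodule_top] at h1 h2
  have hW : ((N / X).comap (Algebra.linearMap A Q)).map (Algebra.linearMap A Q) = N / X := by
    apply Submodule.map_comap_eq_of_le
    rw [LinearMap.range_eq_map]
    exact h1
  change IsLocalization.coeSubmodule Q ((N / X).comap (Algebra.linearMap A Q)) = N / X at hW
  rw [← hW]
  refine IsLocalization.coeSubmodule_mono _ (le_maximalIdeal fun ht => h2 ?_)
  rw [← hW, ht]

/-- Dualizing fractional ideals are unique up to multiplication by a unit. -/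
theorem exists_eq_span_singleton_mul {M : Submodule A Q} (hM : IsReflexiveDualizing M) :
    ∃ u v : Q, u * v = 1 ∧ M = Submodule.span A {u} * N := by
  have hX : IsRegularFractional (M / N) := hM.1.div hN.1
  have hm := IsRegularFractional.coeSubmodule (Q := Q) hx hx0
  have h1 := hN.covBy_div_maximalIdeal hx hx0
  -- With X = M : N one has N : 𝔪 = (M : X) : 𝔪 = M : 𝔪X, so applying M : – to N ⋖ N : 𝔪 yields 𝔪X ⋖
  -- X. By Nakayama X is then principal.
  have h2 : N / IsLocalization.coeSubmodule Q (maximalIdeal A) =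
      M / (IsLocalization.coeSubmodule Q (maximalIdeal A) * (M / N)) := by
    rw [mul_comm, ← Submodule.div_div_eq, hM.2 N hN.1]
  have h3 := hM.covBy_div hN.1 (hN.1.div hm) h1
  rw [h2, hM.2 _ (hm.mul hX)] at h3
  obtain ⟨u, v, huv, hu⟩ := hX.exists_eq_span_singleton h3
  refine ⟨u, v, huv, ?_⟩
  have h4 : N = Submodule.span A {v} * M := by
    conv_lhs => rw [← hM.2 N hN.1, hu, ← mul_one (Submodule.span A {u}),
      Submodule.div_span_singleton_mul huv, Submodule.div_one']
  rw [h4, span_singleton_mul_cancel huv]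

end IsReflexiveDualizing

end Dualizing

/-! ### Injective dimension under coextension of scalars -/

section Coextension

open Abelian ModuleCat

variable {R S : Type u} [CommRing R] [CommRing S] (f : R →+* S)

/-- Coextension of scalars preserves finite injective dimension of modules `N` such that
`Ext^i_R(S, N) = 0` for `i > 0`. -/
theorem hasInjectiveDimensionLE_coextendScalars (n : ℕ) (N : ModuleCat.{u} R)
    (hN : HasInjectiveDimensionLE N n)
    (hS : ∀ i, 1 ≤ i → Subsingleton (Ext ((restrictScalars f).obj (of S S)) N i)) :
    HasInjectiveDimensionLE ((coextendScalars f).obj N) n := by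
  induction n generalizing N with
  | zero =>
    have hN' : HasInjectiveDimensionLT N 1 := hN
    rw [← injective_iff_hasInjectiveDimensionLT_one] at hN'
    have := Injective.injective_of_adjoint (restrictCoextendScalarsAdj.{u} f) N
    change HasInjectiveDimensionLT _ 1
    rwa [← injective_iff_hasInjectiveDimensionLT_one]
  | succ n ih =>
    obtain ⟨E, inj, g, mono⟩ := (EnoughInjectives.presentation N).some
    let T := ShortComplex.mk g (Limits.cokernel.π g) (Limits.cokernel.condition g)
    have hT : T.ShortExact := { exact := ShortComplex.exact_cokernel g }
    have hT' : Function.Exact T.f.hom T.g.hom :=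
      (ShortComplex.ShortExact.moduleCat_exact_iff_function_exact _).mp hT.exact
    have hinj : Function.Injective T.f.hom := (ModuleCat.mono_iff_injective _).mp hT.mono_f
    have h3 : HasInjectiveDimensionLE T.X₃ n := (hT.hasInjectiveDimensionLT_X₃_iff n inj).mpr hN
    -- Dimension shift along 0 → N → E → E/N: the Ext hypothesis passes to the cokernel, whose
    -- injective dimension bound drops by one.
    have hS3 : ∀ i, 1 ≤ i → Subsingleton (Ext ((restrictScalars f).obj (of S S)) T.X₃ i) := by
      intro i hi
      refine subsingleton_of_forall_eq 0 fun e => ?_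
      have := hS (i + 1) (by omega)
      obtain ⟨y, rfl⟩ := Ext.covariant_sequence_exact₃ _ hT e rfl (Subsingleton.elim _ _)
      obtain ⟨i, rfl⟩ := Nat.exists_eq_add_of_le' hi
      have hy : y = 0 := Ext.eq_zero_of_injective y
      rw [hy, Ext.zero_comp]
    have hE : Injective ((coextendScalars f).obj T.X₂) :=
      Injective.injective_of_adjoint (restrictCoextendScalarsAdj.{u} f) E
    have hex : Function.Exact ((coextendScalars f).map T.f).hom
        ((coextendScalars f).map T.g).hom := by
      intro φ
      constructor
      · intro hφ
        have hφ' : ∀ s, T.g.hom (CoextendScalars.equiv f _ φ s) = 0 := fun s =>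
          LinearMap.congr_fun (congrArg (CoextendScalars.equiv f _) hφ) s
        have hr : ∀ s, CoextendScalars.equiv f _ φ s ∈ LinearMap.range T.f.hom := fun s =>
          (hT' _).mp (hφ' s)
        refine ⟨(CoextendScalars.equiv f _).symm
          ((LinearEquiv.ofInjective T.f.hom hinj).symm.toLinearMap ∘ₗ
            (CoextendScalars.equiv f _ φ).codRestrict _ hr), ?_⟩
        apply CoextendScalars.ext
        ext s
        change T.f.hom ((LinearEquiv.ofInjective T.f.hom hinj).symm
          ⟨CoextendScalars.equiv f _ φ s, hr s⟩) = _
        have h2 := congrArg Subtype.val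
          ((LinearEquiv.ofInjective T.f.hom hinj).apply_symm_apply ⟨_, hr s⟩)
        rwa [LinearEquiv.ofInjective_apply] at h2
      · rintro ⟨ψ, rfl⟩
        apply CoextendScalars.ext
        ext s
        exact hT'.apply_apply_eq_zero _
    have hFi : Function.Injective ((coextendScalars f).map T.f).hom := by
      intro φ ψ h
      apply CoextendScalars.ext
      ext s
      exact hinj (LinearMap.congr_fun (congrArg (CoextendScalars.equiv f _) h) s)
    -- Right exactness is where Ext¹(S, N) = 0 is needed: it lifts maps S → E/N to E.
    have hFs : Function.Surjective ((coextendScalars f).map T.g).hom := by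
      intro φ
      have := hS 1 le_rfl
      obtain ⟨y, hy⟩ := Ext.covariant_sequence_exact₃ _ hT
        (Ext.mk₀ (ModuleCat.ofHom (CoextendScalars.equiv f _ φ))) (zero_add 1)
        (Subsingleton.elim _ _)
      obtain ⟨ψ, rfl⟩ := Ext.homEquiv₀.symm.surjective y
      simp only [Ext.homEquiv₀_symm_apply] at hy
      rw [Ext.mk₀_comp_mk₀] at hy
      have h0 := Ext.homEquiv₀.symm.injective (a₁ := ψ ≫ T.g)
        (a₂ := ModuleCat.ofHom (CoextendScalars.equiv f _ φ)) (by simpa using hy)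
      refine ⟨(CoextendScalars.equiv f _).symm ψ.hom, ?_⟩
      apply CoextendScalars.ext
      ext s
      exact LinearMap.congr_fun (congrArg ModuleCat.Hom.hom h0) s
    have hTS := shortExact_ofHom hFi hFs hex
    exact (hTS.hasInjectiveDimensionLT_X₃_iff n hE).mp (ih T.X₃ h3 hS3)

end Coextension

/-! ### Canonical ideals of finite birational extensions -/

section Colon

open Abelian

variable {A : Type u} [CommRing A] [IsLocalRing A] [IsNoetherianRing A] [Ring.KrullDimLE 1 A]
  {Q : Type u} [CommRing Q] [Algebra A Q] [IsFractionRing A Q]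
  {x : A} (hx : x ∈ maximalIdeal A) (hx0 : x ∈ nonZeroDivisors A)

include hx hx0

/-- For a finite extension `S` of `A` in the total ring of fractions, `N : S` has finite injective
dimension over `S` if `N` has so over `A`. -/
theorem hasFiniteInjectiveDimension_div_subalgebra {N : Submodule A Q}
    (hN : HasFiniteInjectiveDimension A N)
    (S : Subalgebra A Q) (hS : IsRegularFractional (Subalgebra.toSubmodule S))
    (N' : Submodule S Q) (h : ∀ q, q ∈ N' ↔ q ∈ N / Subalgebra.toSubmodule S) :
    HasFiniteInjectiveDimension S N' := by
  obtain ⟨n, hn⟩ := hN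
  refine ⟨n, ?_⟩
  let f := algebraMap A S
  let val : (ModuleCat.restrictScalars f).obj (ModuleCat.of S S) → S := fun s => s
  let e : Subalgebra.toSubmodule S ≃ₗ[A] (ModuleCat.restrictScalars f).obj (ModuleCat.of S S) :=
    { toFun := fun s => (⟨s.1, s.2⟩ : S)
      invFun := fun s => ⟨(val s).1, (val s).2⟩
      map_add' := fun _ _ => rfl
      map_smul' := fun r s => by
        change (⟨r • s.1, _⟩ : S) = algebraMap A S r * ⟨s.1, s.2⟩
        exact Subtype.ext (Algebra.smul_def r s.1)
      left_inv := fun _ => rfl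
      right_inv := fun _ => rfl }
  have hS1 : ∀ i, 1 ≤ i →
      Subsingleton (Ext ((ModuleCat.restrictScalars f).obj (ModuleCat.of S S))
        (ModuleCat.of A N) i) := fun i hi =>
    subsingleton_ext_congr e _ (hS.subsingleton_ext hx hx0 (ModuleCat.of A N) n hi)
  have h1 := hasInjectiveDimensionLE_coextendScalars f n (ModuleCat.of A N) hn hS1
  -- The coextended module is Hom_A(S, N), and every such map is multiplication by an element of N :
  -- S, so `ev` is an isomorphism.
  let mulq : N' → (Subalgebra.toSubmodule S →ₗ[A] N) := fun q =>
    (LinearMap.mulLeft A (q : Q)).restrict fun y hy => (h q).mp q.2 y hy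
  let ev : N' →ₗ[S] (ModuleCat.coextendScalars f).obj (ModuleCat.of A N) :=
    { toFun := fun q => (ModuleCat.CoextendScalars.equiv f _).symm (mulq q ∘ₗ e.symm.toLinearMap)
      map_add' := fun p q => by
        apply ModuleCat.CoextendScalars.ext
        ext s
        exact add_mul (p : Q) (q : Q) (val s : Q)
      map_smul' := fun t q => by
        apply ModuleCat.CoextendScalars.ext
        ext s
        change ((t : Q) * (q : Q)) * (val s : Q) = (q : Q) * ((val s : Q) * (t : Q))
        ring }
  have hev : Function.Bijective ev := by
    constructor
    · intro p q hpq
      have h1 := LinearMap.congr_fun (congrArg (ModuleCat.CoextendScalars.equiv f _) hpq) (1 : S)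
      have h2 : mulq p ⟨1, S.one_mem⟩ = mulq q ⟨1, S.one_mem⟩ := h1
      have h3 : (p : Q) * (1 : Q) = (q : Q) * (1 : Q) := congrArg Subtype.val h2
      exact Subtype.ext (by simpa using h3)
    · intro φ
      obtain ⟨q, hq⟩ := hS.exists_eq_mul
        (N.subtype ∘ₗ ModuleCat.CoextendScalars.equiv f _ φ ∘ₗ e.toLinearMap)
      refine ⟨⟨q, (h q).mpr fun y hy => ?_⟩, ?_⟩
      · rw [← hq ⟨y, hy⟩]
        exact Subtype.prop _
      · apply ModuleCat.CoextendScalars.ext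
        ext s
        have h2 := hq (e.symm s)
        refine Eq.trans h2.symm ?_
        change ((ModuleCat.CoextendScalars.equiv f _ φ (e (e.symm s)) : N) : Q) = _
        rw [e.apply_symm_apply]
  exact (ModuleCat.hasInjectiveDimensionLE_iff_of_linearEquiv
    (M := ModuleCat.of S N') (LinearEquiv.ofBijective ev hev) n).mpr h1

end Colon

/-! ### Canonical modules versus dualizing fractional ideals -/

section Canonical

open Abelian

variable {A : Type u} [CommRing A] [IsLocalRing A]

theorem exact_subtype_residueField :
    Function.Exact (maximalIdeal A).subtype (Algebra.linearMap A (ResidueField A)) := by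
  intro y
  rw [Algebra.linearMap_apply]
  change residue A y = 0 ↔ _
  rw [residue_eq_zero_iff]
  simp

/-- Canonical modules over a ring of positive dimension have no socle. -/
theorem IsCanonicalModule.eq_zero_of_forall_smul_eq_zero {M : Type u} [AddCommGroup M]
    [Module A M] (hM : IsCanonicalModule A M) (hdim : ringKrullDim A = 1) {z : M}
    (hz : ∀ r ∈ maximalIdeal A, r • z = 0) : z = 0 := by
  obtain ⟨-, -, d, hd, h0, -⟩ := hM
  have hd1 : d = 1 := by
    rw [hdim] at hd
    exact_mod_cast hd.symm
  have := h0 0 (by omega)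
  let φ : ResidueField A →ₗ[A] M :=
    Submodule.liftQ (maximalIdeal A) (LinearMap.toSpanSingleton A M z) hz
  have h1 := Subsingleton.elim (Ext.mk₀ (ModuleCat.ofHom φ) : ResidueExt A M 0)
    (Ext.mk₀ (ModuleCat.ofHom 0))
  have h2 := Ext.homEquiv₀.symm.injective (a₁ := ModuleCat.ofHom φ) (a₂ := ModuleCat.ofHom 0)
    (by simpa using h1)
  have h3 : φ (residue A 1) = 0 := LinearMap.congr_fun (congrArg ModuleCat.Hom.hom h2) _
  have h4 : φ (residue A 1) = (1 : A) • z := rfl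
  rw [← one_smul A z, ← h4, h3]

variable [IsNoetherianRing A] [Ring.KrullDimLE 1 A]
  {Q : Type u} [CommRing Q] [Algebra A Q] [IsFractionRing A Q]
  {x : A} (hx : x ∈ maximalIdeal A) (hx0 : x ∈ nonZeroDivisors A)

/-- Multiplication by elements of `N : 𝔪`, as homomorphisms `𝔪 → N`. -/
noncomputable def divToHom (N : Submodule A Q) :
    (N / IsLocalization.coeSubmodule Q (maximalIdeal A) : Submodule A Q) →ₗ[A]
      (maximalIdeal A →ₗ[A] N) where
  toFun q := (LinearMap.toSpanSingleton A Q (q : Q)).restrict (p := maximalIdeal A) (q := N)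
    (mem_div_coeSubmodule.mp q.2)
  map_add' p q := by
    ext y
    exact smul_add (y : A) (p : Q) (q : Q)
  map_smul' r q := by
    ext y
    exact smul_comm (y : A) r (q : Q)

include hx hx0

omit [IsNoetherianRing A] [Ring.KrullDimLE 1 A] in
theorem divToHom_surjective (N : Submodule A Q) : Function.Surjective (divToHom N) := by
  intro φ
  obtain ⟨v, hv⟩ := (IsRegularFractional.isUnit_algebraMap Q hx0).exists_right_inv
  have key : ∀ y : maximalIdeal A, (φ y : Q) = (y : A) • (v * (φ ⟨x, hx⟩ : Q)) := by
    intro y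
    have h1 : x • y = (y : A) • (⟨x, hx⟩ : maximalIdeal A) := Subtype.ext (mul_comm x (y : A))
    have h2 := congrArg (fun w : N => (w : Q)) (congrArg φ h1)
    simp only [map_smul, Submodule.coe_smul, Algebra.smul_def] at h2
    rw [Algebra.smul_def]
    linear_combination v * h2 - (φ y : Q) * hv
  refine ⟨⟨v * φ ⟨x, hx⟩, mem_div_coeSubmodule.mpr fun r hr => ?_⟩, ?_⟩
  · rw [← key ⟨r, hr⟩]
    exact (φ _).2
  · ext y
    exact (key y).symm

/-- A dualizing regular fractional ideal of finite injective dimension is a canonical module. -/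
theorem isCanonicalModule_of_hasFiniteInjectiveDimension (hdim : ringKrullDim A = 1)
    {N : Submodule A Q} (hN : IsRegularFractional N) (hid : HasFiniteInjectiveDimension A N) :
    IsCanonicalModule A N := by
  obtain ⟨n, hn⟩ := id hid
  have hdual := isReflexiveDualizing_of_hasInjectiveDimensionLE hx hx0 hN n
  refine ⟨Module.Finite.iff_fg.mpr hN.1, hid, 1, hdim, fun i hi => ?_, ?_⟩
  · obtain rfl : i = 0 := by omega
    refine subsingleton_of_forall_eq 0 fun e => ?_
    obtain ⟨φ, rfl⟩ := Ext.homEquiv₀.symm.surjective e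
    have h0 : φ = 0 := by
      ext y
      obtain ⟨r, rfl⟩ := residue_surjective y
      have h1 : x • residue A r = 0 := by
        rw [Algebra.smul_def]
        change residue A x * _ = 0
        rw [(residue_eq_zero_iff x).mpr hx, zero_mul]
      have h2 := congrArg (fun w : N => (w : Q)) (congrArg φ.hom h1)
      simp only [map_zero, ZeroMemClass.coe_zero] at h2
      rw [map_smul, Submodule.coe_smul, Algebra.smul_def] at h2
      exact (IsRegularFractional.isUnit_algebraMap Q hx0).mul_right_eq_zero.mp h2
    rw [h0]
    simp
  · have hS := shortExact_ofHom (maximalIdeal A).injective_subtype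
      (g := Algebra.linearMap A (ResidueField A)) residue_surjective exact_subtype_residueField
    -- The connecting map of 0 → 𝔪 → A → k → 0. It is onto since A is projective, and its kernel is
    -- N, so Ext¹(k, N) ≅ (N : 𝔪)/N, which is simple by duality.
    let δ : (N / IsLocalization.coeSubmodule Q (maximalIdeal A) : Submodule A Q) →ₗ[A]
        ResidueExt A N 1 :=
      (hS.extClass.precompOfLinear A (ModuleCat.of A N) (add_zero 1)) ∘ₗ
        (Ext.linearEquiv₀ (R := A)).symm.toLinearMap ∘ₗ
        (ModuleCat.homLinearEquiv (S := A)).symm.toLinearMap ∘ₗ divToHom N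
    have hδ : ∀ q, δ q = hS.extClass.comp (Ext.mk₀ (ModuleCat.ofHom (divToHom N q)))
      (add_zero 1) := fun q => rfl
    have hsurj : Function.Surjective δ := by
      intro e
      have := subsingleton_ext_self (ModuleCat.of A N) (i := 1) le_rfl
      obtain ⟨y, rfl⟩ := Ext.contravariant_sequence_exact₃ hS _ e
        (Subsingleton.elim (α := Ext (ModuleCat.of A A) _ 1) _ _) (add_zero 1)
      obtain ⟨φ, rfl⟩ := Ext.homEquiv₀.symm.surjective y
      obtain ⟨q, hq⟩ := divToHom_surjective hx hx0 N φ.hom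
      exact ⟨q, by rw [hδ, hq]; rfl⟩
    have hker : LinearMap.ker δ = N.comap
        (N / IsLocalization.coeSubmodule Q (maximalIdeal A)).subtype := by
      ext q
      rw [LinearMap.mem_ker, hδ]
      constructor
      · intro h
        obtain ⟨y, hy⟩ := Ext.contravariant_sequence_exact₁ hS _ _ (add_zero 1) h
        obtain ⟨ψ, rfl⟩ := Ext.homEquiv₀.symm.surjective y
        simp only [Ext.homEquiv₀_symm_apply] at hy
        rw [Ext.mk₀_comp_mk₀] at hy
        have h2 := Ext.homEquiv₀.symm.injective
          (a₁ := ModuleCat.ofHom (maximalIdeal A).subtype ≫ ψ)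
          (a₂ := ModuleCat.ofHom (divToHom N q)) (by simpa using hy)
        have h3 : ψ.hom x = divToHom N q ⟨x, hx⟩ :=
          LinearMap.congr_fun (congrArg ModuleCat.Hom.hom h2) ⟨x, hx⟩
        have h4 : x • (ψ.hom (1 : A) : Q) = x • (q : Q) := by
          have h5 : (ψ.hom x : Q) = x • (q : Q) := congrArg Subtype.val h3
          rw [← h5, ← Submodule.coe_smul, ← map_smul, smul_eq_mul, mul_one]
        rw [Algebra.smul_def, Algebra.smul_def] at h4
        change (q : Q) ∈ N
        rw [← (IsRegularFractional.isUnit_algebraMap Q hx0).mul_left_cancel h4]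
        exact (ψ.hom (1 : A)).2
      · intro h
        have h1 : ModuleCat.ofHom (divToHom N q) = ModuleCat.ofHom (maximalIdeal A).subtype ≫
            ModuleCat.ofHom (LinearMap.toSpanSingleton A N ⟨(q : Q), h⟩) := by
          ext y
          rfl
        rw [h1, ← Ext.mk₀_comp_mk₀]
        exact hS.extClass_comp_assoc _
    rw [Module.length_eq_one_iff]
    have hcov := hdual.covBy_div_maximalIdeal hx hx0
    have := (covBy_iff_quot_is_simple hcov.le).mp hcov
    rw [← hker] at this
    exact IsSimpleModule.congr (LinearMap.quotKerEquivOfSurjective δ hsurj).symm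

end Canonical

/-! ### Coefficients of a polynomial zero divisor act nilpotently -/

section PolynomialAnnihilator

variable {R : Type*} [CommRing R]

/-- In degree i + m of f w, terms with a lower index in f vanish by hypothesis and terms with a
lower index in w die after multiplying by `f.coeff i ^ m`; only the (i, m) term survives. -/
theorem pow_coeff_mul_eq_zero_of_low {f w : R[X]} (h : f * w = 0) {i : ℕ}
    (hlow : ∀ j < i, C (f.coeff j) * w = 0) (m : ℕ) : f.coeff i ^ (m + 1) * w.coeff m = 0 := by
  induction m using Nat.strong_induction_on with
  | _ m ih =>
    have h1 : (f * w).coeff (i + m) = 0 := by rw [h, coeff_zero]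
    rw [coeff_mul, ← Finset.add_sum_erase _ _
      (show (i, m) ∈ Finset.HasAntidiagonal.antidiagonal (i + m) by simp)] at h1
    have h2 : ∑ p ∈ (Finset.HasAntidiagonal.antidiagonal (i + m)).erase (i, m),
        f.coeff i ^ m * (f.coeff p.1 * w.coeff p.2) = 0 := by
      refine Finset.sum_eq_zero fun p hp => ?_
      obtain ⟨hne, hp⟩ := Finset.mem_erase.mp hp
      rw [Finset.HasAntidiagonal.mem_antidiagonal] at hp
      rcases lt_trichotomy p.1 i with hlt | heq | hgt
      · have := congrArg (fun q => coeff q p.2) (hlow p.1 hlt)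
        simp only [coeff_C_mul, coeff_zero] at this
        rw [this, mul_zero]
      · exact absurd (Prod.ext heq (by simp; omega)) hne
      · have h3 := ih p.2 (by omega)
        obtain ⟨k, hk⟩ := Nat.exists_eq_add_of_lt (show p.2 < m by omega)
        rw [hk, show p.2 + k + 1 = (p.2 + 1) + k by ring, pow_add]
        linear_combination (f.coeff i ^ k * f.coeff p.1) * h3
    have h4 := congrArg (f.coeff i ^ m * ·) h1
    simp only [mul_add, Finset.mul_sum, h2, add_zero, mul_zero] at h4
    rw [pow_succ]
    linear_combination h4

/-- If `f * w = 0`, then every coefficient of `f` acts nilpotently on `w`. -/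
theorem exists_pow_coeff_mul_eq_zero (f : R[X]) (i : ℕ) (w : R[X]) (h : f * w = 0) :
    ∃ s, C (f.coeff i ^ s) * w = 0 := by
  induction i using Nat.strong_induction_on generalizing w with
  | _ i ih =>
    -- `d` counts the indices just below i whose coefficients need not yet kill w. The lowest of
    -- them is nilpotent on w by the outer induction and is removed by induction on its exponent.
    suffices H : ∀ d ≤ i, ∀ w : R[X], f * w = 0 → (∀ j < i - d, C (f.coeff j) * w = 0) →
        ∃ s, C (f.coeff i ^ s) * w = 0 from H i le_rfl w h fun j hj => by omega
    intro d
    induction d with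
    | zero =>
      intro _ w h hlow
      refine ⟨w.natDegree + 1, ?_⟩
      ext m
      rw [coeff_C_mul, coeff_zero]
      rcases le_or_gt m w.natDegree with hm | hm
      · obtain ⟨k, hk⟩ := Nat.exists_eq_add_of_le hm
        rw [hk, show m + k + 1 = (m + 1) + k by ring, pow_add, mul_right_comm,
          pow_coeff_mul_eq_zero_of_low h (by simpa using hlow), zero_mul]
      · rw [coeff_eq_zero_of_natDegree_lt hm, mul_zero]
    | succ d ihd =>
      intro hd w h hlow
      obtain ⟨s, hs⟩ := ih (i - (d + 1)) (by omega) w h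
      induction s generalizing w with
      | zero => exact ⟨0, by simpa using hs⟩
      | succ s ihs =>
        obtain ⟨t, ht⟩ := ihs (C (f.coeff (i - (d + 1))) * w)
          (by rw [mul_left_comm, h, mul_zero])
          (fun j hj => by rw [mul_left_comm, hlow j hj, mul_zero])
          (by rw [← mul_assoc, ← C_mul, ← pow_succ, hs])
        obtain ⟨t', ht'⟩ := ihd (by omega) (C (f.coeff i ^ t) * w)
          (by rw [mul_left_comm, h, mul_zero])
          (fun j hj => by
            rcases lt_or_eq_of_le (show j ≤ i - (d + 1) by omega) with hj | rfl
            · rw [mul_left_comm, hlow j hj, mul_zero]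
            · rw [mul_left_comm, ht])
        exact ⟨t' + t, by rw [pow_add, C_mul, mul_assoc, ht']⟩

theorem exists_pow_coeff_mul_mem (J : Ideal R) (f w : R[X]) (h : ∀ k, (f * w).coeff k ∈ J)
    (i : ℕ) : ∃ s, ∀ j, f.coeff i ^ s * w.coeff j ∈ J := by
  obtain ⟨s, hs⟩ := exists_pow_coeff_mul_eq_zero (f.map (Ideal.Quotient.mk J)) i
    (w.map (Ideal.Quotient.mk J)) (by
      rw [← Polynomial.map_mul]
      ext k
      rw [coeff_map, coeff_zero]
      exact Ideal.Quotient.eq_zero_iff_mem.mpr (h k))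
  refine ⟨s, fun j => ?_⟩
  have := congrArg (fun q => coeff q j) hs
  simp only [coeff_C_mul, coeff_map, coeff_zero, ← map_pow, ← map_mul] at this
  exact Ideal.Quotient.eq_zero_iff_mem.mp this

end PolynomialAnnihilator

/-! ### Torsion of the associated graded ring in large degrees -/

section AssociatedGraded

variable {A : Type*} [CommRing A]

/-- In large degrees, the associated graded ring of an ideal of a Noetherian ring has no elements
annihilated by a power of the irrelevant ideal. -/
theorem exists_forall_mem_pow_succ [IsNoetherianRing A] (I : Ideal A) :
    ∃ c₀, ∀ c ≥ c₀, ∀ y ∈ I ^ c, (∃ s, ∀ z ∈ I ^ s, z * y ∈ I ^ (c + s + 1)) → y ∈ I ^ (c + 1) := by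
  classical
  -- Homogeneous elements whose class in the associated graded ring is killed by a power of the
  -- irrelevant ideal. Finitely many generate their span; in degrees at least every `c + s` of
  -- these, the multiplier of a generator has degree at least its s and so kills it in the graded
  -- ring.
  let H : Set (reesAlgebra I) := {f | ∃ c y, (f : A[X]) = monomial c y ∧
    ∃ s, ∀ z ∈ I ^ s, z * y ∈ I ^ (c + s + 1)}
  obtain ⟨t, htH, ht⟩ := Submodule.fg_span_iff_fg_span_finset_subset H |>.mp
    (IsNoetherian.noetherian (Submodule.span (reesAlgebra I) H))
  have hb : ∃ c₀, ∀ h ∈ t, ∃ c y s, (h : A[X]) = monomial c y ∧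
      (∀ z ∈ I ^ s, z * y ∈ I ^ (c + s + 1)) ∧ c + s ≤ c₀ := by
    have htH' : ∀ h ∈ t, ∃ c y s, (h : A[X]) = monomial c y ∧
        (∀ z ∈ I ^ s, z * y ∈ I ^ (c + s + 1)) := fun h hh => by
      obtain ⟨c, y, hcy, s, hs⟩ := htH hh
      exact ⟨c, y, s, hcy, hs⟩
    choose! c y s hcy hs using htH'
    refine ⟨t.sup fun h => c h + s h, fun h hh => ⟨c h, y h, s h, hcy h hh, hs h hh, ?_⟩⟩
    exact Finset.le_sup (f := fun h => c h + s h) hh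
  obtain ⟨c₀, hc₀⟩ := hb
  refine ⟨c₀, fun c hc y hy hs => ?_⟩
  have hmem : (⟨monomial c y, reesAlgebra.monomial_mem.mpr hy⟩ : reesAlgebra I) ∈
      Submodule.span (reesAlgebra I) (t : Set (reesAlgebra I)) := by
    rw [← ht]
    exact Submodule.subset_span ⟨c, y, rfl, hs⟩
  obtain ⟨g, -, hg⟩ := Submodule.mem_span_finset.mp hmem
  have hg' := congrArg (fun f : reesAlgebra I => (f : A[X]).coeff c) hg
  simp only [coeff_monomial_same, smul_eq_mul] at hg'
  rw [← hg', AddSubmonoidClass.coe_finsetSum, finsetSum_coeff]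
  refine Ideal.sum_mem _ fun h hh => ?_
  obtain ⟨d, v, s, hhv, hv, hds⟩ := hc₀ h hh
  change ((g h : A[X]) * (h : A[X])).coeff c ∈ _
  obtain ⟨k, rfl⟩ := Nat.exists_eq_add_of_le' (show d ≤ c by omega)
  rw [hhv, coeff_mul_monomial]
  have h1 := mem_reesAlgebra_iff I (g h : A[X]) |>.mp (g h).2 k
  obtain ⟨l, rfl⟩ := Nat.exists_eq_add_of_le' (show s ≤ k by omega)
  rw [pow_add] at h1
  refine Submodule.mul_induction_on h1 (fun a ha b hb => ?_) fun a b ha hb => ?_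
  · rw [mul_assoc, show l + s + d + 1 = l + (d + s + 1) by ring, pow_add]
    exact Ideal.mul_mem_mul ha (hv b hb)
  · rw [add_mul]
    exact add_mem ha hb

/-- In the binomial expansion of `(I ⊔ J) ^ (s + t)` every term has at least s factors from I or at
least t from J; the other factors lie in M and only raise the exponent. -/
theorem exists_pow_sup_mul_le (I J M : Ideal A) (hI : I ≤ M) (hJ : J ≤ M) (y : A) (c : ℕ)
    (h₁ : ∃ s, ∀ z ∈ I ^ s, z * y ∈ M ^ (c + s + 1))
    (h₂ : ∃ s, ∀ z ∈ J ^ s, z * y ∈ M ^ (c + s + 1)) :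
    ∃ s, ∀ z ∈ (I ⊔ J) ^ s, z * y ∈ M ^ (c + s + 1) := by
  obtain ⟨s, hs⟩ := h₁
  obtain ⟨t, ht⟩ := h₂
  refine ⟨s + t, ?_⟩
  have key : ∀ K L : Ideal A, K ≤ M → L ≤ M → ∀ s, (∀ z ∈ K ^ s, z * y ∈ M ^ (c + s + 1)) →
      ∀ a b, s ≤ a → ∀ z ∈ K ^ a * L ^ b, z * y ∈ M ^ (c + (a + b) + 1) := by
    intro K L hK hL s hs a b hsa z hz
    obtain ⟨k, rfl⟩ := Nat.exists_eq_add_of_le' hsa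
    rw [pow_add, mul_right_comm] at hz
    refine Submodule.mul_induction_on hz (fun p hp q hq => ?_) fun p q hp hq => ?_
    · rw [mul_assoc, show c + (k + s + b) + 1 = (k + b) + (c + s + 1) by ring, pow_add]
      refine Ideal.mul_mem_mul ?_ (hs q hq)
      rw [pow_add]
      exact Ideal.mul_mono (Ideal.pow_right_mono hK k) (Ideal.pow_right_mono hL b) hp
    · rw [add_mul]
      exact add_mem hp hq
  have hle : (I ⊔ J) ^ (s + t) ≤ Submodule.comap (LinearMap.mulRight A y) (M ^ (c + (s + t) + 1)) := by
    rw [← Ideal.add_eq_sup, add_pow]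
    rw [Ideal.sum_eq_sup]
    refine Finset.sup_le fun k hk => le_trans Ideal.mul_le_left ?_
    intro z hz
    rw [Finset.mem_range] at hk
    change z * y ∈ M ^ (c + (s + t) + 1)
    rcases le_or_gt s k with hsk | hsk
    · have := key I J hI hJ s hs k (s + t - k) hsk z hz
      rwa [show k + (s + t - k) = s + t by omega] at this
    · rw [mul_comm] at hz
      have := key J I hJ hI t ht (s + t - k) k (by omega) z hz
      rwa [show s + t - k + k = s + t by omega] at this
  exact hle

end AssociatedGraded

/-! ### Length counts for quotients by ideals -/

section Length

variable {A M : Type*} [CommRing A] [AddCommGroup M] [Module A M]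

theorem length_quotient_eq_add {X Y : Submodule A M} (h : X ≤ Y) :
    Module.length A (M ⧸ X) = Module.length A (M ⧸ Y) +
      Module.length A (Y ⧸ X.comap Y.subtype) := by
  have := Module.length_eq_add_of_exact ((X.comap Y.subtype).mapQ X Y.subtype le_rfl)
    (Submodule.factor h) ?_ (Submodule.factor_surjective h) ?_
  · rw [this, add_comm]
  · rw [← LinearMap.ker_eq_bot, Submodule.ker_mapQ, Submodule.mkQ_map_self]
  · rw [LinearMap.exact_iff, Submodule.factor, Submodule.ker_mapQ, Submodule.range_mapQ]
    simp

theorem eq_of_length_quotient_le {X Y : Submodule A M} (h : X ≤ Y)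
    (hl : Module.length A (M ⧸ X) ≤ Module.length A (M ⧸ Y))
    (hf : Module.length A (M ⧸ Y) ≠ ⊤) : X = Y := by
  rw [length_quotient_eq_add h] at hl
  have h0 : Module.length A (Y ⧸ X.comap Y.subtype) = 0 := by
    have h1 : Module.length A (M ⧸ Y) + Module.length A (Y ⧸ X.comap Y.subtype) ≤
        Module.length A (M ⧸ Y) + 0 := by simpa using hl
    simpa using (ENat.add_le_add_iff_left hf).mp h1
  rw [Module.length_eq_zero_iff, Submodule.Quotient.subsingleton_iff] at h0
  refine le_antisymm h fun y hy => ?_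
  have : (⟨y, hy⟩ : Y) ∈ X.comap Y.subtype := by rw [h0]; trivial
  exact this

theorem length_quotient_le_of_le {X Y : Submodule A M} (h : X ≤ Y) :
    Module.length A (M ⧸ Y) ≤ Module.length A (M ⧸ X) :=
  Module.length_le_of_surjective (Submodule.factor h) (Submodule.factor_surjective h)

/-- Multiplication by b embeds K₀/K₁ into K₁/K₂. Both have the same finite length e, so the
embedding is onto. -/
theorem le_span_singleton_mul_sup_of_length {K₀ K₁ K₂ : Ideal A} (h₁₀ : K₁ ≤ K₀) (h₂₁ : K₂ ≤ K₁)
    {b : A} (hb₀ : ∀ y ∈ K₀, b * y ∈ K₁) (hb₁ : ∀ y ∈ K₁, b * y ∈ K₂)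
    (hb : ∀ y ∈ K₀, b * y ∈ K₂ → y ∈ K₁) {e : ℕ∞}
    (hl₁ : Module.length A (A ⧸ K₁) = Module.length A (A ⧸ K₀) + e)
    (hl₂ : Module.length A (A ⧸ K₂) = Module.length A (A ⧸ K₁) + e)
    (hf : Module.length A (A ⧸ K₂) ≠ ⊤) : K₁ ≤ Ideal.span {b} * K₀ ⊔ K₂ := by
  set Y := Ideal.span {b} * K₀ ⊔ K₂ with hY
  have hYK : Y ≤ K₁ := by
    refine sup_le (fun z hz => ?_) h₂₁
    obtain ⟨y, hy, rfl⟩ := Ideal.mem_span_singleton_mul.mp hz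
    exact hb₀ y hy
  have hf₁ : Module.length A (A ⧸ K₁) ≠ ⊤ := fun h => by rw [hl₂, h, top_add] at hf; exact hf rfl
  have hf₀ : Module.length A (A ⧸ K₀) ≠ ⊤ := fun h => by rw [hl₁, h, top_add] at hf₁; exact hf₁ rfl
  have he : e ≠ ⊤ := fun h => by rw [hl₁, h, add_top] at hf₁; exact hf₁ rfl
  have hbY : ∀ y : K₀, b * (y : A) ∈ Y := fun y =>
    Submodule.mem_sup_left (Ideal.mul_mem_mul (Ideal.mem_span_singleton_self b) y.2)
  let g : K₀ →ₗ[A] Y ⧸ Submodule.comap (Submodule.subtype Y) K₂ :=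
    (Submodule.mkQ (Submodule.comap (Submodule.subtype Y) K₂)).comp (((LinearMap.mulLeft A b).comp (Submodule.subtype K₀)).codRestrict Y hbY)
  have hgk : LinearMap.ker g = Submodule.comap (Submodule.subtype K₀) K₁ := by
    ext y
    rw [LinearMap.mem_ker]
    simp only [g, LinearMap.comp_apply, Submodule.mkQ_apply, Submodule.Quotient.mk_eq_zero]
    exact ⟨fun h => hb y y.2 h, fun h => hb₁ y h⟩
  have hgs : Function.Surjective g := by
    intro q
    obtain ⟨⟨z, hz⟩, rfl⟩ := Submodule.Quotient.mk_surjective _ q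
    obtain ⟨p, hp, k, hk, rfl⟩ := Submodule.mem_sup.mp hz
    obtain ⟨y, hy, rfl⟩ := Ideal.mem_span_singleton_mul.mp hp
    refine ⟨⟨y, hy⟩, ?_⟩
    simp only [g, LinearMap.comp_apply, Submodule.mkQ_apply]
    rw [Submodule.Quotient.eq]
    change b * y - (b * y + k) ∈ K₂
    simpa using hk
  have h3 : Module.length A (Y ⧸ Submodule.comap (Submodule.subtype Y) K₂) = e := by
    rw [← (g.quotKerEquivOfSurjective hgs).length_eq,
      (Submodule.quotEquivOfEq _ _ hgk).length_eq]
    rw [length_quotient_eq_add h₁₀] at hl₁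
    exact ENat.add_right_injective_of_ne_top hf₀ hl₁
  have h4 := length_quotient_eq_add (show K₂ ≤ Y from le_sup_right)
  rw [h3, hl₂] at h4
  have h5 := ENat.add_left_injective_of_ne_top he h4
  exact (eq_of_length_quotient_le hYK h5.symm.le hf₁).ge

/-- Additivity along 0 → A/J → A/bJ → A/b → 0, the first map being multiplication by b. -/
theorem length_quotient_span_singleton_mul {b : A} (hb : b ∈ nonZeroDivisors A) (J : Ideal A) :
    Module.length A (A ⧸ Ideal.span {b} * J) =
      Module.length A (A ⧸ J) + Module.length A (A ⧸ Ideal.span {b}) := by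
  have hle : J ≤ Submodule.comap (LinearMap.mulLeft A b) (Ideal.span {b} * J) := fun y hy =>
    Ideal.mul_mem_mul (Ideal.mem_span_singleton_self b) hy
  refine Module.length_eq_add_of_exact
    (Submodule.mapQ J (Ideal.span {b} * J) (LinearMap.mulLeft A b) hle)
    (Submodule.factor (Ideal.mul_le_left)) ?_ (Submodule.factor_surjective _) ?_
  · rw [← LinearMap.ker_eq_bot, Submodule.ker_mapQ, eq_bot_iff]
    rintro _ ⟨y, hy, rfl⟩
    obtain ⟨z, hz, hzy⟩ := Ideal.mem_span_singleton_mul.mp hy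
    have : z = y := (mem_nonZeroDivisors_iff.mp hb).1 |> fun h => by
      have := h (z - y) (by rw [mul_sub]; exact sub_eq_zero.mpr hzy)
      exact sub_eq_zero.mp this
    exact (Submodule.Quotient.mk_eq_zero _).mpr (this ▸ hz)
  · rw [LinearMap.exact_iff, Submodule.factor, Submodule.ker_mapQ, Submodule.range_mapQ]
    congr 1
    rw [Submodule.comap_id]
    ext z
    rw [Ideal.mem_span_singleton, LinearMap.mem_range]
    exact ⟨fun ⟨y, hy⟩ => ⟨y, hy.symm⟩, fun ⟨y, hy⟩ => ⟨y, hy.symm⟩⟩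

end Length

/-! ### The polynomial with prescribed coefficient ideal -/

section GenericElement

variable {A : Type*} [CommRing A]

theorem span_range_coeff_X_mul_add_C (f : A[X]) (x : A) :
    Ideal.span (Set.range (X * f + C x).coeff) = Ideal.span {x} ⊔ Ideal.span (Set.range f.coeff) := by
  rw [← Ideal.span_union]
  congr 1
  ext r
  constructor
  · rintro ⟨n, rfl⟩
    rcases n with - | n
    · left; simp
    · right; exact ⟨n, by simp [coeff_X_mul, coeff_C_succ]⟩
  · rintro (rfl | ⟨n, rfl⟩)
    · exact ⟨0, by simp⟩
    · exact ⟨n + 1, by simp [coeff_X_mul, coeff_C_succ]⟩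

theorem exists_span_range_coeff_eq {I : Ideal A} (hI : I.FG) :
    ∃ f : A[X], Ideal.span (Set.range f.coeff) = I := by
  induction I, hI using Submodule.fg_sup_span_induction with
  | bot =>
    refine ⟨0, ?_⟩
    rw [eq_bot_iff, Ideal.span_le]
    rintro _ ⟨n, rfl⟩
    simp
  | sup N x hN ih =>
    obtain ⟨f, hf⟩ := ih
    exact ⟨X * f + C x, by rw [span_range_coeff_X_mul_add_C, hf, sup_comm]⟩

/-- Keeping a prescribed element among the coefficients is what later makes the generic element a
non-zerodivisor. -/
theorem exists_span_range_coeff_eq_of_mem {I : Ideal A} (hI : I.FG) {x : A} (hx : x ∈ I) :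
    ∃ f : A[X], Ideal.span (Set.range f.coeff) = I ∧ ∃ n, f.coeff n = x := by
  obtain ⟨f, hf⟩ := exists_span_range_coeff_eq hI
  refine ⟨X * f + C x, ?_, 0, by simp⟩
  rw [span_range_coeff_X_mul_add_C, hf, sup_eq_right, Ideal.span_singleton_le_iff_mem]
  exact hx

/-- Nilpotent action of each generator gives nilpotent action of the ideal they generate, adding one
generator at a time with `exists_pow_sup_mul_le`. -/
theorem exists_forall_mem_pow_succ_of_coeff [IsNoetherianRing A] (I : Ideal A) {f : A[X]}
    (hf : Ideal.span (Set.range f.coeff) = I) : ∃ c₀, ∀ c ≥ c₀, ∀ y ∈ I ^ c,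
      (∀ i, ∃ s, f.coeff i ^ s * y ∈ I ^ (c + s + 1)) → y ∈ I ^ (c + 1) := by
  obtain ⟨c₀, hc₀⟩ := exists_forall_mem_pow_succ I
  refine ⟨c₀, fun c hc y hy h => hc₀ c hc y hy ?_⟩
  have hle : ∀ i, Ideal.span {f.coeff i} ≤ I := fun i => by
    rw [← hf]; exact Ideal.span_mono (Set.singleton_subset_iff.mpr ⟨i, rfl⟩)
  have key : ∀ S : Finset ℕ, (S.sup fun i => Ideal.span {f.coeff i}) ≤ I ∧
      ∃ s, ∀ z ∈ (S.sup fun i => Ideal.span {f.coeff i}) ^ s, z * y ∈ I ^ (c + s + 1) := by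
    classical
    intro S
    induction S using Finset.induction with
    | empty =>
      refine ⟨by simp, 1, fun z hz => ?_⟩
      have : z = 0 := by simpa using hz
      rw [this, zero_mul]
      exact zero_mem _
    | insert i S hi ih =>
      rw [Finset.sup_insert]
      refine ⟨sup_le (hle i) ih.1, exists_pow_sup_mul_le _ _ I (hle i) ih.1 y c ?_ ih.2⟩
      obtain ⟨s, hs⟩ := h i
      refine ⟨s, fun z hz => ?_⟩
      rw [Ideal.span_singleton_pow, Ideal.mem_span_singleton] at hz
      obtain ⟨r, rfl⟩ := hz
      rw [mul_right_comm]
      exact Ideal.mul_mem_right _ _ hs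
  obtain ⟨-, s, hs⟩ := key (Finset.range (f.natDegree + 1))
  refine ⟨s, fun z hz => hs z (Ideal.pow_right_mono ?_ s hz)⟩
  rw [← hf, Ideal.span_le]
  rintro _ ⟨n, rfl⟩
  rcases le_or_gt n f.natDegree with hn | hn
  · exact Finset.le_sup (f := fun i => Ideal.span {f.coeff i})
      (Finset.mem_range.mpr (Nat.lt_succ_of_le hn)) (Ideal.mem_span_singleton_self _)
  · rw [coeff_eq_zero_of_natDegree_lt hn]
    exact zero_mem _

/-- A polynomial with coefficients in `I ^ c`, with every coefficient placed in degree `c` of the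
Rees algebra. -/
theorem exists_lift_reesAlgebra (I : Ideal A) (c : ℕ) (w : A[X]) (hw : ∀ j, w.coeff j ∈ I ^ c) :
    ∃ W : (reesAlgebra I)[X], ∀ j, ((W.coeff j : reesAlgebra I) : A[X]) = monomial c (w.coeff j) := by
  let g : ℕ → reesAlgebra I := fun j =>
    ⟨monomial c (w.coeff j), reesAlgebra.monomial_mem.mpr (hw j)⟩
  refine ⟨∑ j ∈ Finset.range (w.natDegree + 1), monomial j (g j), fun j => ?_⟩
  rw [finsetSum_coeff]
  simp only [coeff_monomial, Finset.sum_ite_eq', Finset.mem_range]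
  split_ifs with h
  · rfl
  · rw [coeff_eq_zero_of_natDegree_lt (by omega)]
    simp

/-- The ideal `I 𝓡` of the Rees algebra `𝓡` of `I`. -/
def reesIrrelevantShift (I : Ideal A) : Ideal (reesAlgebra I) where
  carrier := {f | ∀ n, (f : A[X]).coeff n ∈ I ^ (n + 1)}
  zero_mem' n := by simp
  add_mem' hf hg n := by
    simp only [Subalgebra.coe_add, coeff_add]
    exact add_mem (hf n) (hg n)
  smul_mem' r f hf n := by
    simp only [smul_eq_mul, Subalgebra.coe_mul, coeff_mul]
    refine Ideal.sum_mem _ fun p hp => ?_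
    rw [Finset.HasAntidiagonal.mem_antidiagonal] at hp
    rw [← hp, add_assoc, pow_add]
    exact Ideal.mul_mem_mul (mem_reesAlgebra_iff I _ |>.mp r.2 _) (hf _)

/-- Placing f in degree 1 and w in degree c of the Rees algebra turns the hypothesis into F W ≡ 0
over the associated graded ring; there each coefficient of F acts nilpotently on W. -/
theorem exists_forall_coeff_mem_pow_succ [IsNoetherianRing A] (I : Ideal A) {f : A[X]}
    (hf : Ideal.span (Set.range f.coeff) = I) : ∃ c₀, ∀ c ≥ c₀, ∀ w : A[X],
      (∀ j, w.coeff j ∈ I ^ c) → (∀ j, (f * w).coeff j ∈ I ^ (c + 2)) →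
        ∀ j, w.coeff j ∈ I ^ (c + 1) := by
  obtain ⟨c₀, hc₀⟩ := exists_forall_mem_pow_succ_of_coeff I hf
  refine ⟨c₀, fun c hc w hw hfw j => hc₀ c hc _ (hw j) fun i => ?_⟩
  have hfI : ∀ i, f.coeff i ∈ I ^ 1 := fun i => by
    rw [pow_one, ← hf]; exact Ideal.subset_span ⟨i, rfl⟩
  obtain ⟨F, hF⟩ := exists_lift_reesAlgebra I 1 f hfI
  obtain ⟨W, hW⟩ := exists_lift_reesAlgebra I c w hw
  have hFW : ∀ k, (F * W).coeff k ∈ reesIrrelevantShift I := fun k n => by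
    rw [coeff_mul, AddSubmonoidClass.coe_finsetSum]
    simp only [Subalgebra.coe_mul, hF, hW, monomial_mul_monomial]
    rw [← map_sum, ← coeff_mul, coeff_monomial]
    split_ifs with h
    · rw [← h, show 1 + c + 1 = c + 2 by ring]; exact hfw k
    · exact zero_mem _
  obtain ⟨s, hs⟩ := exists_pow_coeff_mul_mem (reesIrrelevantShift I) F W hFW i
  refine ⟨s, ?_⟩
  have := hs j (s + c)
  simp only [Subalgebra.coe_mul, Subalgebra.coe_pow, hF, hW, monomial_pow, monomial_mul_monomial,
    one_mul, coeff_monomial_same] at this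
  rwa [add_comm c s]

end GenericElement

/-! ### Length under base change to a localization at the extended maximal ideal -/

section BaseChange

variable (A P : Type*) [CommRing A] [IsLocalRing A] [CommRing P] [Algebra A P]
  (p : Ideal P) [p.IsPrime]

theorem map_maximalIdeal_atPrime (hp : p = (maximalIdeal A).map (algebraMap A P)) :
    (maximalIdeal A).map (algebraMap A (Localization.AtPrime p)) =
      maximalIdeal (Localization.AtPrime p) := by
  rw [IsScalarTower.algebraMap_eq A P (Localization.AtPrime p), ← Ideal.map_map, ← hp,
    Localization.AtPrime.map_eq_maximalIdeal]

theorem isLocalHom_algebraMap_atPrime (hp : p = (maximalIdeal A).map (algebraMap A P)) :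
    IsLocalHom (algebraMap A (Localization.AtPrime p)) :=
  ((IsLocalRing.local_hom_TFAE _).out 0 2).mpr (map_maximalIdeal_atPrime A P p hp).le

open TensorProduct

variable [Module.Flat A P] (M : Type*) [AddCommGroup M] [Module A M]

/-- The base change is flat and local and its closed fibre is a field, so lengths are multiplied by
one. -/
theorem length_tensor_atPrime (hp : p = (maximalIdeal A).map (algebraMap A P)) :
    Module.length (Localization.AtPrime p) (Localization.AtPrime p ⊗[A] M) = Module.length A M := by
  have := isLocalHom_algebraMap_atPrime A P p hp
  rw [IsLocalRing.length_baseChange, map_maximalIdeal_atPrime A P p hp,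
    show Module.length (Localization.AtPrime p)
      (Localization.AtPrime p ⧸ maximalIdeal (Localization.AtPrime p)) = 1 from
      Module.length_eq_one_iff.mpr (isSimpleModule_iff_isCoatom.mpr
        (Ideal.isMaximal_def.mp inferInstance)), mul_one]

theorem length_quotient_map_atPrime (hp : p = (maximalIdeal A).map (algebraMap A P))
    (J : Ideal A) : Module.length (Localization.AtPrime p)
      (Localization.AtPrime p ⧸ J.map (algebraMap A (Localization.AtPrime p))) =
        Module.length A (A ⧸ J) := by
  rw [← length_tensor_atPrime A P p (A ⧸ J) hp]
  exact (Algebra.TensorProduct.quotIdealMapEquivTensorQuot (Localization.AtPrime p)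
    J).toLinearEquiv.length_eq

end BaseChange

/-! ### A generic reduction of the maximal ideal -/

section GenericReduction

variable {A : Type*} [CommRing A] [IsLocalRing A]

/-- The localization of `A[X]` at the extension of the maximal ideal. -/
local notation "T" => Localization.AtPrime (Ideal.map (C : A →+* A[X]) (maximalIdeal A))

/-- This is injectivity of the generic element on the graded pieces of large degree over the
localization; clearing denominators reduces it to `exists_forall_coeff_mem_pow_succ`. -/
theorem exists_forall_mem_map_pow_succ [IsNoetherianRing A] {f : A[X]}
    (hf : Ideal.span (Set.range f.coeff) = maximalIdeal A) : ∃ c₀, ∀ c ≥ c₀,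
      ∀ y ∈ (maximalIdeal A ^ c).map (algebraMap A T),
        algebraMap A[X] T f * y ∈ (maximalIdeal A ^ (c + 2)).map (algebraMap A T) →
          y ∈ (maximalIdeal A ^ (c + 1)).map (algebraMap A T) := by
  obtain ⟨c₀, hc₀⟩ := exists_forall_coeff_mem_pow_succ _ hf
  set p := Ideal.map (C : A →+* A[X]) (maximalIdeal A)
  refine ⟨c₀, fun c hc y hy hfy => ?_⟩
  have hm : ∀ J : Ideal A, J.map (algebraMap A T) = (J.map C).map (algebraMap A[X] T) := fun J => by
    rw [Ideal.map_map, IsScalarTower.algebraMap_eq A A[X] T, Polynomial.algebraMap_eq]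
  rw [hm, IsLocalization.mem_map_algebraMap_iff p.primeCompl] at hy hfy ⊢
  obtain ⟨⟨⟨w, hw⟩, s⟩, hws⟩ := hy
  obtain ⟨⟨⟨v, hv⟩, r⟩, hvr⟩ := hfy
  simp only at hws hvr
  have h1 : algebraMap A[X] T (f * w * r) = algebraMap A[X] T (v * s) := by
    simp only [map_mul, ← hws, ← hvr]
    ring
  obtain ⟨u, hu⟩ := (IsLocalization.eq_iff_exists p.primeCompl T).mp h1
  have h2 := hc₀ c hc (u * r * w) (Ideal.mem_map_C_iff.mp (Ideal.mul_mem_left _ _ hw)) ?_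
  · refine ⟨⟨⟨u * r * w, Ideal.mem_map_C_iff.mpr h2⟩, u * r * s⟩, ?_⟩
    simp only [Submonoid.coe_mul, map_mul, ← hws]
    ring
  · refine Ideal.mem_map_C_iff.mp ?_
    rw [show f * (u * r * w) = u * (f * w * r) by ring, hu]
    exact Ideal.mul_mem_left _ _ (Ideal.mul_mem_right _ _ hv)

/-- If f kills w, then so does a power of the regular coefficient, which forces w = 0. -/
theorem algebraMap_mem_nonZeroDivisors_of_coeff {f : A[X]} {i : ℕ}
    (hi : f.coeff i ∈ nonZeroDivisors A) : algebraMap A[X] T f ∈ nonZeroDivisors T := by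
  set p := Ideal.map (C : A →+* A[X]) (maximalIdeal A)
  rw [mem_nonZeroDivisors_iff_right]
  intro z hz
  obtain ⟨w, s, rfl⟩ := IsLocalization.exists_mk'_eq p.primeCompl z
  have h1 : algebraMap A[X] T (f * w) = algebraMap A[X] T 0 := by
    rw [map_mul, ← IsLocalization.mk'_spec T w s, ← mul_assoc,
      mul_comm (algebraMap A[X] T f), hz, zero_mul, map_zero]
  obtain ⟨u, hu⟩ := (IsLocalization.eq_iff_exists p.primeCompl T).mp h1
  rw [mul_zero] at hu
  obtain ⟨n, hn⟩ := exists_pow_coeff_mul_eq_zero f i (u * w) (by linear_combination hu)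
  rw [IsLocalization.mk'_eq_zero_iff]
  refine ⟨u, ?_⟩
  ext j
  have h2 := congrArg (fun q => coeff q j) hn
  simp only [coeff_C_mul, coeff_zero] at h2
  exact (mem_nonZeroDivisors_iff.mp (pow_mem hi n)).1 _ h2

/-- Over the localization the generic element b satisfies b𝔪^c = 𝔪^(c+1) for large c, so the
quotient by b has length e. As bJ ⊆ 𝔪J, the quotient by 𝔪J is no longer than that by bJ, whose
length is ℓ(A/J) + e. -/
theorem length_quotient_maximalIdeal_mul_le [IsNoetherianRing A] {x : A}
    (hx : x ∈ maximalIdeal A) (hx0 : x ∈ nonZeroDivisors A) {e i₀ : ℕ}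
    (hfin : ∀ i, Module.length A (A ⧸ maximalIdeal A ^ i) ≠ ⊤)
    (he : ∀ i ≥ i₀, Module.length A (A ⧸ maximalIdeal A ^ (i + 1)) =
      Module.length A (A ⧸ maximalIdeal A ^ i) + e) (J : Ideal A) :
    Module.length A (A ⧸ maximalIdeal A * J) ≤ Module.length A (A ⧸ J) + e := by
  obtain ⟨f, hf, i, hfi⟩ := exists_span_range_coeff_eq_of_mem
    (IsNoetherian.noetherian (maximalIdeal A)) hx
  obtain ⟨c₀, hc₀⟩ := exists_forall_mem_map_pow_succ hf
  have hl := length_quotient_map_atPrime A A[X] (Ideal.map (C : A →+* A[X]) (maximalIdeal A)) rfl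
  have hmax := map_maximalIdeal_atPrime A A[X] (Ideal.map (C : A →+* A[X]) (maximalIdeal A)) rfl
  set b := algebraMap A[X] T f with hb
  have hb0 : b ∈ nonZeroDivisors T :=
    algebraMap_mem_nonZeroDivisors_of_coeff (i := i) (by rwa [hfi])
  have hbm : b ∈ (maximalIdeal A).map (algebraMap A T) := by
    rw [hmax, ← Localization.AtPrime.map_eq_maximalIdeal]
    refine Ideal.mem_map_of_mem _ (Ideal.mem_map_C_iff.mpr fun n => ?_)
    rw [← hf]
    exact Ideal.subset_span ⟨n, rfl⟩
  have hsucc : ∀ c, ∀ y ∈ (maximalIdeal A ^ c).map (algebraMap A T),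
      b * y ∈ (maximalIdeal A ^ (c + 1)).map (algebraMap A T) := fun c y hy => by
    rw [pow_succ', Ideal.map_mul]
    exact Ideal.mul_mem_mul hbm hy
  set c := max c₀ i₀
  have h1 := le_span_singleton_mul_sup_of_length
    (K₀ := (maximalIdeal A ^ c).map (algebraMap A T))
    (K₁ := (maximalIdeal A ^ (c + 1)).map (algebraMap A T))
    (K₂ := (maximalIdeal A ^ (c + 2)).map (algebraMap A T))
    (Ideal.map_mono (Ideal.pow_le_pow_right (by omega)))
    (Ideal.map_mono (Ideal.pow_le_pow_right (by omega)))
    (hsucc c) (hsucc (c + 1)) (hc₀ c (le_max_left _ _)) (e := e)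
    (by rw [hl, hl]; exact he c (le_max_right _ _))
    (by rw [hl, hl]; exact he (c + 1) (le_trans (le_max_right _ _) (Nat.le_succ _)))
    (by rw [hl]; exact hfin _)
  -- The length count gives equality only modulo 𝔪^(c+2); Nakayama removes this error term.
  have h2 : Ideal.span {b} * (maximalIdeal A ^ c).map (algebraMap A T) =
      (maximalIdeal A ^ (c + 1)).map (algebraMap A T) := by
    refine le_antisymm (fun z hz => ?_) ?_
    · obtain ⟨y, hy, rfl⟩ := Ideal.mem_span_singleton_mul.mp hz
      exact hsucc c y hy
    · refine Submodule.le_of_le_smul_of_le_jacobson_bot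
        (I := maximalIdeal T) (IsNoetherian.noetherian _)
        (by rw [IsLocalRing.jacobson_eq_maximalIdeal _ bot_ne_top]) (h1.trans (sup_le_sup_left ?_ _))
      rw [smul_eq_mul, ← hmax, ← Ideal.map_mul, ← pow_succ']
  have h3 := length_quotient_span_singleton_mul hb0 ((maximalIdeal A ^ c).map (algebraMap A T))
  rw [h2, hl, hl, he c (le_max_right _ _)] at h3
  have h4 := ENat.add_right_injective_of_ne_top (hfin c) h3
  have h5 := length_quotient_span_singleton_mul hb0 (J.map (algebraMap A T))
  rw [hl, ← h4] at h5
  rw [← h5, ← hl, Ideal.map_mul]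
  exact length_quotient_le_of_le (Ideal.mul_mono_left ((Ideal.span_singleton_le_iff_mem _).mpr hbm))

end GenericReduction

/-! ### Embedding dimension equal to multiplicity -/

section Multiplicity

variable {A : Type u} [CommRing A] [IsLocalRing A]

theorem length_quotient_maximalIdeal : Module.length A (A ⧸ maximalIdeal A) = 1 :=
  Module.length_eq_one_iff.mpr (isSimpleModule_iff_isCoatom.mpr
    (Ideal.isMaximal_def.mp inferInstance))

variable [IsNoetherianRing A]

theorem length_quotient_maximalIdeal_sq :
    Module.length A (A ⧸ maximalIdeal A ^ 2) = 1 + embDim A := by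
  rw [length_quotient_eq_add (Ideal.pow_le_self two_ne_zero : maximalIdeal A ^ 2 ≤ maximalIdeal A),
    length_quotient_maximalIdeal]
  congr 1
  have h1 : Module.length A (CotangentSpace A) = embDim A := by
    rw [Module.length_eq_of_surjective (M := CotangentSpace A) (residue_surjective (R := A)),
      Module.length_eq_finrank]
    rfl
  rw [← h1]
  refine LinearEquiv.length_eq (Submodule.quotEquivOfEq _ _ ?_)
  ext y
  rw [Submodule.mem_comap, pow_two, Submodule.mem_smul_top_iff]
  rfl

variable [Ring.KrullDimLE 1 A] {x : A} (hx : x ∈ maximalIdeal A) (hx0 : x ∈ nonZeroDivisors A)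
include hx hx0

variable {Q : Type u} [CommRing Q] [Algebra A Q] [IsFractionRing A Q]

/-- Put W = 𝔪² : 𝔪, so that 𝔪 ⊆ W and 𝔪W = 𝔪², and clear denominators: J = dW ⊆ A. With v = e, the
bound on ℓ(A/𝔪J) = ℓ(A/d𝔪²) gives ℓ(A/d𝔪) ≤ ℓ(A/J), which forces d𝔪 = J. -/
theorem sq_div_maximalIdeal_eq_of_isMultiplicity (h : IsMultiplicity A (embDim A)) :
    IsLocalization.coeSubmodule Q (maximalIdeal A) * IsLocalization.coeSubmodule Q (maximalIdeal A) /
      IsLocalization.coeSubmodule Q (maximalIdeal A) =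
        IsLocalization.coeSubmodule Q (maximalIdeal A) := by
  set M := IsLocalization.coeSubmodule Q (maximalIdeal A) with hM
  have hMr : IsRegularFractional M := IsRegularFractional.coeSubmodule hx hx0
  have hfin : ∀ i, Module.length A (A ⧸ maximalIdeal A ^ i) ≠ ⊤ := fun i =>
    Module.length_ne_top_iff.mpr (isFiniteLength_quotient_of_mem (Ideal.pow_mem_pow hx i)
      (pow_mem hx0 i))
  obtain ⟨e₁, N, hN⟩ := h
  -- `IsMultiplicity` measures the quotient by 𝔪^(n+1), so the exponents i and i + 1 correspond to n
  -- = i - 1 and n = i; hence the bound N + 1.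
  have he : ∀ i ≥ N + 1, Module.length A (A ⧸ maximalIdeal A ^ (i + 1)) =
      Module.length A (A ⧸ maximalIdeal A ^ i) + embDim A := by
    intro i hi
    obtain ⟨j, rfl⟩ := Nat.exists_eq_add_of_le' (show 1 ≤ i by omega)
    obtain ⟨l, hl, hl'⟩ := hN j (by omega)
    obtain ⟨k, hk, hk'⟩ := hN (j + 1) (by omega)
    rw [hl, hk, ← Nat.cast_add]
    congr 1
    zify
    rw [hl', hk']
    push_cast
    ring
  have hW : IsRegularFractional (M * M / M) := (hMr.mul hMr).div hMr
  have hMW : M ≤ M * M / M := Submodule.le_div_iff_mul_le.mpr le_rfl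
  have hWM : M * (M * M / M) = M * M :=
    le_antisymm (by rw [mul_comm]; exact Submodule.le_div_iff_mul_le.mp le_rfl)
      (mul_le_mul_right hMW M)
  obtain ⟨d, hd, hdW⟩ := IsRegularFractional.exists_denominator hW.1
  set D := algebraMap A Q d
  obtain ⟨D', hD⟩ := (IsRegularFractional.isUnit_algebraMap Q hd).exists_right_inv
  set J : Ideal A := (Submodule.span A {D} * (M * M / M)).comap (Algebra.linearMap A Q)
  have hJ : IsLocalization.coeSubmodule Q J = Submodule.span A {D} * (M * M / M) := by
    refine Submodule.map_comap_eq_self fun z hz => ?_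
    obtain ⟨y, hy, rfl⟩ := Submodule.mem_span_singleton_mul.mp hz
    exact hdW y hy
  have hdJ : Ideal.span {d} * maximalIdeal A ≤ J := by
    rw [← IsFractionRing.coeSubmodule_le_coeSubmodule (K := Q), hJ, IsLocalization.coeSubmodule_mul,
      IsLocalization.coeSubmodule_span_singleton]
    exact mul_le_mul_right hMW _
  have hmJ : maximalIdeal A * J = Ideal.span {d} * maximalIdeal A ^ 2 := by
    apply IsFractionRing.coeSubmodule_injective A Q
    rw [IsLocalization.coeSubmodule_mul, hJ, pow_two, IsLocalization.coeSubmodule_mul,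
      IsLocalization.coeSubmodule_mul, IsLocalization.coeSubmodule_span_singleton, ← hM, mul_left_comm, hWM]
  have h1 := length_quotient_maximalIdeal_mul_le hx hx0 hfin he J
  rw [hmJ, length_quotient_span_singleton_mul hd, length_quotient_maximalIdeal_sq, add_right_comm]
    at h1
  have h2 := (ENat.add_le_add_iff_right (ENat.natCast_ne_top _)).mp h1
  have h3 : Ideal.span {d} * maximalIdeal A = J := by
    refine eq_of_length_quotient_le hdJ ?_ ?_
    · rwa [length_quotient_span_singleton_mul hd, length_quotient_maximalIdeal]
    · refine Module.length_ne_top_iff.mpr (isFiniteLength_quotient_of_mem (hdJ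
        (Ideal.mul_mem_mul (Ideal.mem_span_singleton_self d) hx)) (mul_mem hd hx0))
  rw [← h3, IsLocalization.coeSubmodule_mul, IsLocalization.coeSubmodule_span_singleton] at hJ
  rw [← span_singleton_mul_cancel ((mul_comm _ _).trans hD) (M * M / M), ← hJ,
    span_singleton_mul_cancel ((mul_comm _ _).trans hD)]

end Multiplicity

/-! ### The Rees algebra of a regular principal ideal as a polynomial ring -/

section Rees

variable {A : Type u} [CommRing A]

theorem mem_idealMulRees_iff {Q I J : Ideal A} (hQJ : Q ≤ J) {f : A[X]} :
    f ∈ idealMulRees Q I J ↔ ∀ n, f.coeff n ∈ I * J ^ n := by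
  constructor
  · intro hf n
    induction hf using Submodule.span_induction generalizing n with
    | mem f hf =>
      obtain ⟨x, hx, g, hg, rfl⟩ := hf
      rw [coeff_C_mul]
      exact Ideal.mul_mem_mul hx (mem_reesAlgebra_iff J g |>.mp hg n)
    | zero => simp
    | add f g _ _ hf hg => rw [coeff_add]; exact add_mem (hf n) (hg n)
    | smul r f _ hf =>
      change ((r : A[X]) * f).coeff n ∈ _
      rw [coeff_mul]
      refine Ideal.sum_mem _ fun q hq => ?_
      rw [Finset.HasAntidiagonal.mem_antidiagonal] at hq
      rw [← hq, pow_add, mul_left_comm]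
      exact Ideal.mul_mem_mul (Ideal.pow_right_mono hQJ _ (mem_reesAlgebra_iff Q _ |>.mp r.2 _))
        (hf _)
  · intro hf
    rw [f.as_sum_range]
    refine Submodule.sum_mem _ fun n _ => ?_
    refine Submodule.mul_induction_on (hf n) (fun x hx y hy => ?_) fun x y hx hy => ?_
    · rw [← C_mul_monomial]
      exact Submodule.subset_span ⟨x, hx, _, reesAlgebra.monomial_mem.mpr hy, rfl⟩
    · rw [map_add]
      exact add_mem hx hy

variable {a : A}

/-- The generator `a t` of the Rees algebra of the ideal generated by `a`. -/
noncomputable def reesGenerator (a : A) : reesAlgebra (Ideal.span {a}) :=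
  ⟨monomial 1 a, reesAlgebra.monomial_mem.mpr (by simp)⟩

theorem coe_aeval_reesGenerator (a : A) (f : A[X]) :
    ((aeval (reesGenerator a) f : reesAlgebra (Ideal.span {a})) : A[X]) =
      f.sum fun n r => monomial n (r * a ^ n) := by
  rw [aeval_def, eval₂_eq_sum, Polynomial.sum, AddSubmonoidClass.coe_finsetSum, Polynomial.sum]
  refine Finset.sum_congr rfl fun n _ => ?_
  change C (f.coeff n) * (monomial 1 a) ^ n = _
  rw [monomial_pow, C_mul_monomial, one_mul]

theorem coeff_aeval_reesGenerator (a : A) (f : A[X]) (n : ℕ) :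
    ((aeval (reesGenerator a) f : reesAlgebra (Ideal.span {a})) : A[X]).coeff n =
      f.coeff n * a ^ n := by
  rw [coe_aeval_reesGenerator, Polynomial.sum, finsetSum_coeff]
  simp only [coeff_monomial, Finset.sum_ite_eq', mem_support_iff]
  split_ifs with h
  · rfl
  · rw [notMem_support_iff.mp h, zero_mul]

/-- The Rees algebra of a principal ideal generated by a non-zerodivisor is a polynomial ring. -/
noncomputable def reesAlgebraEquiv (ha : a ∈ nonZeroDivisors A) :
    A[X] ≃ₐ[A] reesAlgebra (Ideal.span {a}) := by
  refine AlgEquiv.ofBijective (aeval (reesGenerator a)) ⟨?_, fun g => ?_⟩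
  · rw [injective_iff_map_eq_zero]
    intro f hf
    ext n
    have := coeff_aeval_reesGenerator a f n
    rw [hf] at this
    exact (mem_nonZeroDivisors_iff.mp (pow_mem ha n)).2 _ (by simpa using this.symm)
  · have h1 : ∀ n, ∃ r, r * a ^ n = (g : A[X]).coeff n := fun n => by
      have := mem_reesAlgebra_iff _ _ |>.mp g.2 n
      rwa [Ideal.span_singleton_pow, Ideal.mem_span_singleton'] at this
    choose r hr using h1
    refine ⟨∑ n ∈ Finset.range ((g : A[X]).natDegree + 1), monomial n (r n), Subtype.ext ?_⟩
    ext n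
    rw [coeff_aeval_reesGenerator, finsetSum_coeff]
    simp only [coeff_monomial, Finset.sum_ite_eq', Finset.mem_range]
    split_ifs with h
    · exact hr n
    · rw [zero_mul, coeff_eq_zero_of_natDegree_lt (by omega)]

@[simp]
theorem reesAlgebraEquiv_X (ha : a ∈ nonZeroDivisors A) :
    reesAlgebraEquiv ha X = reesGenerator a := aeval_X _

theorem maximalIdealRees_eq_map [IsLocalRing A] (ha : a ∈ nonZeroDivisors A) :
    maximalIdealRees (Ideal.span {a}) =
      ((maximalIdeal A).map (C : A →+* A[X])).map (reesAlgebraEquiv ha : A[X] →+* _) := by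
  rw [maximalIdealRees, Ideal.map_map]
  congr 1
  exact RingHom.ext fun r => ((reesAlgebraEquiv ha).commutes r).symm

theorem isPrime_maximalIdealRees [IsLocalRing A] (ha : a ∈ nonZeroDivisors A) :
    (maximalIdealRees (Ideal.span {a})).IsPrime := by
  rw [maximalIdealRees_eq_map ha]
  exact Ideal.map_isPrime_of_equiv (reesAlgebraEquiv ha)

theorem reesGenerator_notMem [IsLocalRing A] (ha : a ∈ nonZeroDivisors A) :
    reesGenerator a ∉ maximalIdealRees (Ideal.span {a}) := by
  rw [maximalIdealRees_eq_map ha, ← reesAlgebraEquiv_X ha]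
  intro h
  have h1 := (Ideal.mem_map_of_equiv (reesAlgebraEquiv ha) _).mp h
  obtain ⟨f, hf, hfX⟩ := h1
  rw [(reesAlgebraEquiv ha).injective hfX, Ideal.mem_map_C_iff] at hf
  have := hf 1
  rw [coeff_X_one] at this
  exact (Ideal.ne_top_iff_one _).mp (Ideal.IsPrime.ne_top inferInstance) this

theorem flat_reesAlgebra (ha : a ∈ nonZeroDivisors A) :
    Module.Flat A (reesAlgebra (Ideal.span {a})) :=
  Module.Flat.of_linearEquiv (reesAlgebraEquiv ha).symm.toLinearEquiv

end Rees

/-! ### Lengths of localized modules with a base-changed submodule -/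

section Localization

open TensorProduct

theorem length_localizedModule_eq {P : Type*} [CommRing P] (S : Submonoid P) {M N : Type*}
    [AddCommGroup M] [Module P M] [AddCommGroup N] [Module P N] (f : M →ₗ[P] N)
    (hf : Function.Injective f) (s : P) (hs : s ∈ S) (hfs : ∀ y : N, s • y ∈ LinearMap.range f) :
    Module.length (Localization S) (LocalizedModule S M) =
      Module.length (Localization S) (LocalizedModule S N) := by
  refine (LinearEquiv.ofBijective (LocalizedModule.map S f)
    ⟨LocalizedModule.map_injective S f hf, fun y => ?_⟩).length_eq
  induction y using LocalizedModule.induction_on with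
  | _ y t =>
    obtain ⟨z, hz⟩ := hfs y
    refine ⟨LocalizedModule.mk z (⟨s, hs⟩ * t), ?_⟩
    rw [LocalizedModule.map_mk, hz, LocalizedModule.mk_eq]
    refine ⟨1, ?_⟩
    simp only [one_smul, Submonoid.smul_def, Submonoid.coe_mul, smul_smul]
    rw [mul_comm]

theorem length_localizedModule_tensor (A : Type*) {P : Type*} [CommRing A] [IsLocalRing A]
    [CommRing P] [Algebra A P] [Module.Flat A P] (p : Ideal P) [p.IsPrime]
    (hp : p = (maximalIdeal A).map (algebraMap A P)) (M : Type*) [AddCommGroup M] [Module A M] :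
    Module.length (Localization.AtPrime p) (LocalizedModule p.primeCompl (P ⊗[A] M)) =
      Module.length A M := by
  rw [← length_tensor_atPrime A P p M hp]
  have e1 := (IsLocalizedModule.isBaseChange p.primeCompl (Localization.AtPrime p)
    (LocalizedModule.mkLinearMap p.primeCompl (P ⊗[A] M))).equiv
  exact (e1.symm.trans (TensorProduct.AlgebraTensorModule.cancelBaseChange A P
    (Localization.AtPrime p) (Localization.AtPrime p) M)).length_eq

theorem injective_liftBaseChange {A P C N ι : Type*} [CommRing A] [CommRing P] [Algebra A P]
    [AddCommGroup C] [Module A C] [AddCommGroup N] [Module A N] [Module P N] [IsScalarTower A P N]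
    (b : Module.Basis ι A P) (g : C →ₗ[A] N)
    (h : ∀ c : ι →₀ C, (c.sum fun i x => b i • g x) = 0 → c = 0) :
    Function.Injective (g.liftBaseChange P) := by
  classical
  rw [injective_iff_map_eq_zero]
  intro z hz
  obtain ⟨c, rfl⟩ := (TensorProduct.equivFinsuppOfBasisLeft (N := C) b).symm.surjective z
  rw [TensorProduct.equivFinsuppOfBasisLeft_symm_apply, Finsupp.sum, map_sum] at hz
  simp only [LinearMap.liftBaseChange_tmul] at hz
  rw [h c hz, map_zero]

/-- P ⊗ C → N is injective by the basis condition and its cokernel is killed by s ∉ p, so it becomes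
an isomorphism at p, where base change preserves length. -/
theorem length_localizedModule_of_basis {A P C N ι : Type*} [CommRing A] [IsLocalRing A]
    [CommRing P] [Algebra A P] [Module.Flat A P] (p : Ideal P) [p.IsPrime]
    (hp : p = (maximalIdeal A).map (algebraMap A P))
    [AddCommGroup C] [Module A C] [AddCommGroup N] [Module A N] [Module P N] [IsScalarTower A P N]
    (b : Module.Basis ι A P) (g : C →ₗ[A] N)
    (h : ∀ c : ι →₀ C, (c.sum fun i x => b i • g x) = 0 → c = 0) {s : P} (hs : s ∉ p)
    (hspan : ∀ y, s • y ∈ Submodule.span P (Set.range g)) :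
    Module.length (Localization.AtPrime p) (LocalizedModule p.primeCompl N) =
      Module.length A C := by
  rw [← length_localizedModule_tensor A p hp C]
  refine (length_localizedModule_eq p.primeCompl (g.liftBaseChange P)
    (injective_liftBaseChange b g h) s hs fun y => ?_).symm
  refine Submodule.span_le.mpr ?_ (hspan y)
  rintro _ ⟨x, rfl⟩
  exact ⟨1 ⊗ₜ x, by rw [LinearMap.liftBaseChange_tmul, one_smul]⟩

end Localization

/-! ### The rank of the Sally module -/

section Sally

open TensorProduct

variable {A : Type u} [CommRing A] {a : A} {I : Ideal A} {N : ℕ}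

theorem monomial_mem_idealMulRees (haI : a ∈ I) {n : ℕ} {x : A} (hx : x ∈ I ^ (n + 1)) :
    monomial n x ∈ idealMulRees (Ideal.span {a}) I I := by
  rw [mem_idealMulRees_iff ((Ideal.span_singleton_le_iff_mem I).mpr haI)]
  intro k
  rw [coeff_monomial]
  split_ifs with h
  · rwa [← h, ← pow_succ']
  · exact zero_mem _

theorem mem_idealMulRees_span_iff {f : A[X]} :
    f ∈ idealMulRees (Ideal.span {a}) I (Ideal.span {a}) ↔
      ∀ n, ∃ y ∈ I, f.coeff n = a ^ n * y := by
  rw [mem_idealMulRees_iff le_rfl]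
  refine forall_congr' fun n => ?_
  rw [Ideal.span_singleton_pow, mul_comm, Ideal.mem_span_singleton_mul]
  exact exists_congr fun y => and_congr_right fun _ => eq_comm

/-- The map `x ↦ x tᴺ` from `Iᴺ⁺¹` to the Sally module. -/
noncomputable def sallyMonomial (haI : a ∈ I) (N : ℕ) :
    (I ^ (N + 1) : Ideal A) →ₗ[A] SallyModule I (Ideal.span {a}) where
  toFun x := ⟨(idealMulRees (Ideal.span {a}) I (Ideal.span {a})).mkQ (monomial N (x : A)),
    Submodule.mem_map_of_mem (monomial_mem_idealMulRees haI x.2)⟩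
  map_add' x y := Subtype.ext (by simp)
  map_smul' r x := Subtype.ext (by
    simp only [SetLike.val_smul, RingHom.id_apply]
    rw [← smul_monomial]
    rfl)

theorem sallyMonomial_eq_zero_iff (haI : a ∈ I) (x : (I ^ (N + 1) : Ideal A)) :
    sallyMonomial haI N x = 0 ↔ ∃ y ∈ I, (x : A) = a ^ N * y := by
  rw [← Subtype.val_inj]
  change (idealMulRees (Ideal.span {a}) I (Ideal.span {a})).mkQ (monomial N (x : A)) = 0 ↔ _
  rw [Submodule.mkQ_apply, Submodule.Quotient.mk_eq_zero, mem_idealMulRees_span_iff]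
  constructor
  · intro h
    simpa using h N
  · intro h n
    rw [coeff_monomial]
    split_ifs with hn
    · exact hn ▸ h
    · exact ⟨0, zero_mem _, by simp⟩

theorem coe_reesGenerator_pow (n : ℕ) :
    ((reesGenerator a ^ n : reesAlgebra (Ideal.span {a})) : A[X]) = monomial n (a ^ n) := by
  rw [Subalgebra.coe_pow]
  change (monomial 1 a) ^ n = _
  rw [monomial_pow, one_mul]

theorem coe_reesGenerator_pow_smul_sallyMonomial (haI : a ∈ I) (n : ℕ)
    (x : (I ^ (N + 1) : Ideal A)) :
    ((reesGenerator a ^ n • sallyMonomial haI N x : SallyModule I (Ideal.span {a})) :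
      A[X] ⧸ idealMulRees (Ideal.span {a}) I (Ideal.span {a})) =
        Submodule.Quotient.mk (monomial (n + N) (a ^ n * x)) := by
  change Submodule.Quotient.mk (((reesGenerator a ^ n : reesAlgebra (Ideal.span {a})) : A[X]) *
    monomial N (x : A)) = _
  rw [coe_reesGenerator_pow, monomial_mul_monomial]

/-- The terms sit in distinct degrees n + N, and a^n can be cancelled in each of them. -/
theorem sallyMonomial_eq_zero_of_sum_eq_zero (ha : a ∈ nonZeroDivisors A) (haI : a ∈ I)
    (S : Finset ℕ) (c : ℕ → (I ^ (N + 1) : Ideal A))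
    (h : ∑ n ∈ S, reesGenerator a ^ n • sallyMonomial haI N (c n) = 0) {n : ℕ} (hn : n ∈ S) :
    sallyMonomial haI N (c n) = 0 := by
  have h1 := congrArg Subtype.val h
  rw [AddSubmonoidClass.coe_finsetSum] at h1
  simp only [coe_reesGenerator_pow_smul_sallyMonomial] at h1
  have h2 : (idealMulRees (Ideal.span {a}) I (Ideal.span {a})).mkQ
      (∑ n ∈ S, monomial (n + N) (a ^ n * (c n : A))) = 0 := by
    rw [map_sum]
    exact h1
  rw [Submodule.mkQ_apply, Submodule.Quotient.mk_eq_zero, mem_idealMulRees_span_iff] at h2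
  obtain ⟨y, hy, h3⟩ := h2 (n + N)
  rw [finsetSum_coeff] at h3
  simp only [coeff_monomial, add_left_inj, Finset.sum_ite_eq', hn, if_true] at h3
  refine (sallyMonomial_eq_zero_iff haI (c n)).mpr ⟨y, hy, ?_⟩
  refine sub_eq_zero.mp ((mem_nonZeroDivisors_iff.mp (pow_mem ha n)).1 _ ?_)
  rw [mul_sub, h3, pow_add, mul_assoc, sub_self]

theorem pow_succ_add_eq (hN : I ^ (N + 1) = Ideal.span {a} * I ^ N) (n : ℕ) :
    I ^ (N + 1 + n) = Ideal.span {a} ^ n * I ^ (N + 1) := by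
  induction n with
  | zero => simp
  | succ n ih =>
    rw [← add_assoc, pow_succ, ih, mul_assoc, ← pow_succ, pow_succ I (N + 1)]
    nth_rewrite 1 [hN]
    rw [mul_assoc, ← pow_succ, ← mul_assoc, ← pow_succ]

/-- In degree n: a^N I^(n+1) ⊆ I^(N+1+n) = a^n I^(N+1). -/
theorem reesGenerator_pow_smul_mem_span (haI : a ∈ I)
    (hN : I ^ (N + 1) = Ideal.span {a} * I ^ N) (y : SallyModule I (Ideal.span {a})) :
    reesGenerator a ^ N • y ∈ Submodule.span (reesAlgebra (Ideal.span {a}))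
      (Set.range (sallyMonomial haI N)) := by
  obtain ⟨_, f, hf, rfl⟩ := y
  have hQ := (Ideal.span_singleton_le_iff_mem I).mpr haI
  have hf' := (mem_idealMulRees_iff hQ).mp hf
  have h1 : ∀ n, ∃ z : (I ^ (N + 1) : Ideal A), a ^ n * (z : A) = a ^ N * f.coeff n := fun n => by
    have h2 : a ^ N * f.coeff n ∈ I ^ (N + 1 + n) := by
      rw [show N + 1 + n = N + (n + 1) by ring, pow_add, pow_succ' I n]
      exact Ideal.mul_mem_mul (Ideal.pow_mem_pow haI N) (hf' n)
    rw [pow_succ_add_eq hN, Ideal.span_singleton_pow, Ideal.mem_span_singleton_mul] at h2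
    obtain ⟨z, hz, h⟩ := h2
    exact ⟨⟨z, hz⟩, h⟩
  choose z hz using h1
  have h3 : reesGenerator a ^ N • (⟨_, f, hf, rfl⟩ : SallyModule I (Ideal.span {a})) =
      ∑ n ∈ Finset.range (f.natDegree + 1), reesGenerator a ^ n • sallyMonomial haI N (z n) := by
    apply Subtype.ext
    rw [AddSubmonoidClass.coe_finsetSum]
    simp only [coe_reesGenerator_pow_smul_sallyMonomial, hz]
    change Submodule.Quotient.mk (((reesGenerator a ^ N : reesAlgebra (Ideal.span {a})) : A[X]) *
      f) = _
    rw [coe_reesGenerator_pow]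
    nth_rewrite 1 [f.as_sum_range]
    rw [Finset.mul_sum]
    simp only [monomial_mul_monomial]
    exact (map_sum (idealMulRees (Ideal.span {a}) I (Ideal.span {a})).mkQ _ _).trans
      (Finset.sum_congr rfl fun n _ => by rw [add_comm]; rfl)
  rw [h3]
  exact Submodule.sum_mem _ fun n _ => Submodule.smul_mem _ _ (Submodule.subset_span ⟨_, rfl⟩)

/-- The degree N part is I^(N+1)/a^N I. It spans a copy of its own base change to 𝒯, and (a t)^N,
which lies outside 𝔪𝒯, moves the whole Sally module into that span. -/
theorem sallyRank_eq_length [IsLocalRing A] (ha : a ∈ nonZeroDivisors A) (haI : a ∈ I)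
    (hN : I ^ (N + 1) = Ideal.span {a} * I ^ N)
    [(maximalIdealRees (Ideal.span {a})).IsPrime] :
    sallyRank I (Ideal.span {a}) = Module.length A ((I ^ (N + 1) : Ideal A) ⧸
      Submodule.comap (Submodule.subtype (I ^ (N + 1) : Ideal A)) (Ideal.span {a} ^ N * I)) := by
  have := flat_reesAlgebra ha
  set J := Submodule.comap (Submodule.subtype (I ^ (N + 1) : Ideal A)) (Ideal.span {a} ^ N * I)
    with hJ
  have hker : LinearMap.ker (sallyMonomial haI N) = J := by
    ext x
    rw [LinearMap.mem_ker, sallyMonomial_eq_zero_iff, hJ, Submodule.mem_comap,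
      Ideal.span_singleton_pow, Ideal.mem_span_singleton_mul]
    exact exists_congr fun y => and_congr_right fun _ => eq_comm
  let b : Module.Basis ℕ A (reesAlgebra (Ideal.span {a})) :=
    (Polynomial.basisMonomials A).map (reesAlgebraEquiv ha).toLinearEquiv
  have hb : ∀ n, b n = reesGenerator a ^ n := fun n => by
    simp only [b, Module.Basis.map_apply, coe_basisMonomials, monomial_one_right_eq_X_pow]
    change reesAlgebraEquiv ha (X ^ n) = _
    rw [map_pow, reesAlgebraEquiv_X]
  refine length_localizedModule_of_basis (maximalIdealRees (Ideal.span {a})) rfl b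
    (J.liftQ (sallyMonomial haI N) hker.ge) (fun c hc => ?_)
    (s := reesGenerator a ^ N)
    (fun h => reesGenerator_notMem ha (Ideal.IsPrime.mem_of_pow_mem inferInstance N h)) fun y => ?_
  · choose d hd using fun n => Submodule.Quotient.mk_surjective J (c n)
    ext1 n
    by_cases hn : n ∈ c.support
    · have h1 := sallyMonomial_eq_zero_of_sum_eq_zero ha haI c.support d (by
        rw [← hc, Finsupp.sum]
        refine Finset.sum_congr rfl fun n _ => ?_
        rw [hb, ← hd]
        rfl) hn
      rw [← hd, Finsupp.zero_apply, Submodule.Quotient.mk_eq_zero, ← hker]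
      exact h1
    · exact Finsupp.notMem_support_iff.mp hn
  · refine Submodule.span_mono ?_ (reesGenerator_pow_smul_mem_span haI hN y)
    rintro _ ⟨x, rfl⟩
    exact ⟨Submodule.Quotient.mk x, rfl⟩

end Sally

/-! ### Transport of finite injective dimension -/

section FiniteInjectiveDimension

theorem HasFiniteInjectiveDimension.of_linearEquiv {A M N : Type u} [CommRing A] [AddCommGroup M]
    [Module A M] [AddCommGroup N] [Module A N] (h : HasFiniteInjectiveDimension A M)
    (e : M ≃ₗ[A] N) : HasFiniteInjectiveDimension A N := by
  obtain ⟨n, hn⟩ := h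
  exact ⟨n, (ModuleCat.hasInjectiveDimensionLE_iff_of_linearEquiv e n).mp hn⟩

/-- A fractional ideal generated by a unit is free of rank one. -/
noncomputable def equivSpanUnit {A Q : Type*} [CommRing A] [CommRing Q] [Algebra A Q]
    (hinj : Function.Injective (algebraMap A Q)) {u v : Q} (huv : u * v = 1) :
    A ≃ₗ[A] Submodule.span A {u} :=
  (LinearEquiv.ofInjective (LinearMap.toSpanSingleton A Q u) fun r s h => hinj (by
    have h1 := congrArg (· * v) h
    simpa [Algebra.smul_def, mul_assoc, huv] using h1)).trans
    (LinearEquiv.ofEq _ _ (LinearMap.range_toSpanSingleton ..))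

end FiniteInjectiveDimension

/-! ### Almost Gorenstein rings through the cover L ⋖ S -/

section Tower

variable {A : Type u} [CommRing A] {Q : Type u} [CommRing Q] [Algebra A Q]

/-- A fractional ideal generated by a unit is invertible, so X^n can be cancelled. -/
theorem eq_one_of_pow_succ_eq {u v : Q} (huv : u * v = 1) {X : Submodule A Q}
    (hX : X = Submodule.span A {u}) {n : ℕ} (h : X ^ (n + 1) = X ^ n) : X = 1 := by
  have h1 : (Submodule.span A {v} : Submodule A Q) ^ n * X ^ n = 1 := by
    rw [hX, ← mul_pow, Submodule.span_mul_span, Set.singleton_mul_singleton, mul_comm, huv,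
      ← Submodule.one_eq_span, one_pow]
  calc X = (Submodule.span A {v} : Submodule A Q) ^ n * X ^ n * X := by rw [h1, one_mul]
    _ = 1 := by rw [mul_assoc, ← pow_succ, h, h1]

variable [IsFractionRing A Q]

theorem HasFiniteInjectiveDimension.one (h : HasFiniteInjectiveDimension A A) :
    HasFiniteInjectiveDimension A (1 : Submodule A Q) := by
  rw [Submodule.one_eq_span]
  exact h.of_linearEquiv (equivSpanUnit (IsFractionRing.injective A Q) (mul_one 1))

variable [IsLocalRing A] [IsNoetherianRing A]

theorem isGorensteinLocal_of_span_singleton {u v : Q} (huv : u * v = 1)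
    (h : HasFiniteInjectiveDimension A (Submodule.span A {u})) : IsGorensteinLocal A :=
  ⟨inferInstance, h.of_linearEquiv (equivSpanUnit (IsFractionRing.injective A Q) huv).symm⟩

theorem isGorensteinLocal_of_one (h : HasFiniteInjectiveDimension A (1 : Submodule A Q)) :
    IsGorensteinLocal A := by
  rw [Submodule.one_eq_span] at h
  exact isGorensteinLocal_of_span_singleton (mul_one 1) h

variable [Ring.KrullDimLE 1 A] {x : A} (hx : x ∈ maximalIdeal A) (hx0 : x ∈ nonZeroDivisors A)

include hx hx0

theorem IsRegularFractional.isReflexiveDualizing {N : Submodule A Q} (hN : IsRegularFractional N)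
    (h : HasFiniteInjectiveDimension A N) : IsReflexiveDualizing N := by
  obtain ⟨n, hn⟩ := h
  exact isReflexiveDualizing_of_hasInjectiveDimensionLE hx hx0 hN n

omit [IsNoetherianRing A] [Ring.KrullDimLE 1 A] in
/-- An almost Gorenstein local ring has a canonical fractional ideal `M ⊇ A` with `𝔪 M ⊆ A`. -/
theorem IsAGL.exists_submodule (h : IsAGL A) (hdim : ringKrullDim A = 1) :
    ∃ M : Submodule A Q, M.FG ∧ 1 ≤ M ∧ IsLocalization.coeSubmodule Q (maximalIdeal A) * M ≤ 1 ∧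
      HasFiniteInjectiveDimension A M := by
  obtain ⟨-, M, _, _, hM, f, hf, hfm⟩ := h
  have hmem : ∀ r ∈ maximalIdeal A, ∀ z : M, ∃ b, f b = r • z := fun r hr z => by
    have := hfm r hr (Submodule.Quotient.mk z)
    rw [← Submodule.Quotient.mk_smul, Submodule.Quotient.mk_eq_zero] at this
    exact this
  -- If x z = 0 and r z = f b, then x b = 0 and so b = 0. Hence 𝔪z = 0, and a canonical module has
  -- no socle in dimension one.
  have hreg : ∀ z : M, x • z = 0 → z = 0 := fun z hz =>
    hM.eq_zero_of_forall_smul_eq_zero hdim fun r hr => by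
      obtain ⟨b, hb⟩ := hmem r hr z
      have h1 : f (x * b) = 0 := by
        rw [← smul_eq_mul, map_smul, hb, smul_comm, hz, smul_zero]
      have h2 : x * b = 0 := hf (h1.trans (map_zero f).symm)
      have h3 : b = 0 := (mem_nonZeroDivisors_iff.mp hx0).1 b h2
      rw [← hb, h3, map_zero]
  -- Multiplication by x sends M into f(A); reading it in A and dividing by x embeds M in Q with f 1
  -- ↦ 1.
  choose g hg using hmem x hx
  let G : M →ₗ[A] A :=
    { toFun := g
      map_add' := fun y z => hf (by rw [map_add, hg, hg, hg, smul_add])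
      map_smul' := fun r z => hf (by
        rw [RingHom.id_apply, map_smul, hg, hg, smul_comm]) }
  obtain ⟨v, hv⟩ := (IsRegularFractional.isUnit_algebraMap Q hx0).exists_right_inv
  let φ : M →ₗ[A] Q := (LinearMap.mulLeft A v).comp ((Algebra.linearMap A Q).comp G)
  have hφ : ∀ z, φ z = v * algebraMap A Q (g z) := fun z => rfl
  have hinj : Function.Injective φ := by
    rw [injective_iff_map_eq_zero]
    intro z hz
    refine hreg z ?_
    rw [← hg z]
    have h1 : algebraMap A Q (g z) = 0 := by
      rw [← one_mul (algebraMap A Q (g z)), ← hv, mul_assoc, ← hφ, hz, mul_zero]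
    rw [(injective_iff_map_eq_zero _).mp (IsFractionRing.injective A Q) _ h1, map_zero]
  have hf1 : φ (f 1) = 1 := by
    have h1 : g (f 1) = x := hf (by rw [hg, ← map_smul, smul_eq_mul, mul_one])
    rw [hφ, h1, mul_comm, hv]
  refine ⟨LinearMap.range φ, ?_, ?_, ?_, hM.2.1.of_linearEquiv (LinearEquiv.ofInjective φ hinj)⟩
  · have := hM.1
    exact LinearMap.range_eq_map φ ▸ (Module.Finite.fg_top).map φ
  · rw [Submodule.one_le]
    exact ⟨f 1, hf1⟩
  · rw [Submodule.mul_le]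
    rintro _ ⟨r, hr, rfl⟩ _ ⟨z, rfl⟩
    obtain ⟨b, hb⟩ := hmem r hr z
    refine Submodule.mem_one.mpr ⟨b, ?_⟩
    have h1 : f b = b • f 1 := by rw [← map_smul, smul_eq_mul, mul_one]
    rw [Algebra.linearMap_apply, ← Algebra.smul_def, ← map_smul, ← hb, h1, map_smul, hf1,
      Algebra.smul_def, mul_one]

variable {L S : Submodule A Q} (hL : IsRegularFractional L)
  (hid : HasFiniteInjectiveDimension A L) (h1L : 1 ≤ L) (hLS : L ≤ S) (hSS : S * S ≤ S) {j₀ : ℕ} (hpow : ∀ j ≥ j₀, L ^ j = S)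

include hL hid

/-- L : 𝔪 lies strictly above L and below every regular fractional ideal strictly containing L. -/
theorem div_maximalIdeal_eq_of_covBy (hS : IsRegularFractional S) (h : L ⋖ S) :
    L / IsLocalization.coeSubmodule Q (maximalIdeal A) = S := by
  have hLr := hL.isReflexiveDualizing hx hx0 hid
  have h1 := hLr.div_maximalIdeal_le hS h.lt
  have h2 := hLr.covBy_div_maximalIdeal hx hx0
  exact (h.eq_or_eq h2.le h1).resolve_left h2.lt.ne'

/-- As S = L : 𝔪, one has S : 𝔪 = L : 𝔪², so L : 𝔪(S : 𝔪) = 𝔪² : 𝔪 = 𝔪; dualizing gives L : 𝔪 = S.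
-/
theorem maximalIdeal_mul_div_eq_of_covBy (hS : IsRegularFractional S) (h : L ⋖ S)
    (hm2 : IsLocalization.coeSubmodule Q (maximalIdeal A) *
      IsLocalization.coeSubmodule Q (maximalIdeal A) /
        IsLocalization.coeSubmodule Q (maximalIdeal A) =
      IsLocalization.coeSubmodule Q (maximalIdeal A)) :
    IsLocalization.coeSubmodule Q (maximalIdeal A) *
      (S / IsLocalization.coeSubmodule Q (maximalIdeal A)) = S := by
  set m := IsLocalization.coeSubmodule Q (maximalIdeal A)
  have hm : IsRegularFractional m := IsRegularFractional.coeSubmodule (Q := Q) hx hx0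
  have hLr := hL.isReflexiveDualizing hx hx0 hid
  have h1 : L / m = S := div_maximalIdeal_eq_of_covBy hx hx0 hL hid hS h
  have h2 : L / (m * (S / m)) = m := by
    rw [mul_comm, ← Submodule.div_div_eq, ← h1, Submodule.div_div_eq L m m, hLr.2 _ (hm.mul hm),
      hm2]
  rw [← hLr.2 _ (hm.mul (hS.div hm)), h2, h1]

include h1L hLS hSS hpow

/-- Here L : S = 𝔪 is stable under S, so 𝔪L ⊆ 𝔪S ⊆ 𝔪. If A were Gorenstein, L would be principal
with stable powers, so L = 1 = S. -/
theorem isAGL_of_covBy (hCM : IsCohenMacaulayLocal A) (hdim : ringKrullDim A = 1)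
    (hS : IsRegularFractional S) (h : L ⋖ S) :
    IsAGL A ∧ ¬ IsGorensteinLocal A := by
  have hLr := hL.isReflexiveDualizing hx hx0 hid
  have hm := IsRegularFractional.coeSubmodule (Q := Q) hx hx0
  have h1 := div_maximalIdeal_eq_of_covBy hx hx0 hL hid hS h
  have h2 : L / S = IsLocalization.coeSubmodule Q (maximalIdeal A) := by
    rw [← h1]
    exact hLr.2 _ hm
  have h3 : IsLocalization.coeSubmodule Q (maximalIdeal A) * L ≤
      IsLocalization.coeSubmodule Q (maximalIdeal A) := by
    refine (mul_le_mul_right hLS _).trans ?_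
    rw [← h2, Submodule.le_div_iff_mul_le, mul_assoc]
    exact (mul_le_mul_right hSS _).trans (Submodule.le_div_iff_mul_le.mp le_rfl)
  refine ⟨⟨hCM, L, inferInstance, inferInstance,
    isCanonicalModule_of_hasFiniteInjectiveDimension hx hx0 hdim hL hid,
    LinearMap.toSpanSingleton A L ⟨1, Submodule.one_le.mp h1L⟩, fun r s hrs => ?_,
    fun r hr c => ?_⟩, fun hG => ?_⟩
  · have h4 := congrArg Subtype.val hrs
    simp only [LinearMap.toSpanSingleton_apply, SetLike.val_smul, Algebra.smul_def, mul_one] at h4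
    exact IsFractionRing.injective A Q h4
  · obtain ⟨z, rfl⟩ := Submodule.Quotient.mk_surjective _ c
    rw [← Submodule.Quotient.mk_smul, Submodule.Quotient.mk_eq_zero]
    obtain ⟨b, -, hb⟩ := h3 (Submodule.mul_mem_mul ⟨r, hr, rfl⟩ z.2)
    refine ⟨b, Subtype.ext ?_⟩
    simp only [LinearMap.toSpanSingleton_apply, SetLike.val_smul, Algebra.smul_def, mul_one]
    exact hb
  · have h4 := IsRegularFractional.one.isReflexiveDualizing hx hx0 (HasFiniteInjectiveDimension.one
      (Q := Q) hG.2)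
    obtain ⟨u, v, huv, hLu⟩ := h4.exists_eq_span_singleton_mul hx hx0 hLr
    rw [mul_one] at hLu
    have h5 := eq_one_of_pow_succ_eq huv hLu
      ((hpow (j₀ + 1) (Nat.le_succ _)).trans (hpow j₀ le_rfl).symm)
    have h6 := hpow j₀ le_rfl
    rw [h5, one_pow] at h6
    exact h.lt.ne (h5.trans h6)

/-- The canonical ideal M = uL ⊇ A even satisfies 𝔪M ⊆ 𝔪, since otherwise it is principal; hence
𝔪M^j ⊆ 𝔪 for all j. With S ⊆ M^j₀ this gives L ⊆ S ⊆ L : 𝔪. Equality S = L would make L a ring, so L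
= L : L = 1 and A is Gorenstein. -/
theorem covBy_of_isAGL (hdim : ringKrullDim A = 1) (hA : IsAGL A) (hG : ¬ IsGorensteinLocal A) :
    L ⋖ S := by
  set m := IsLocalization.coeSubmodule Q (maximalIdeal A)
  have hLr := hL.isReflexiveDualizing hx hx0 hid
  obtain ⟨M, hMfg, h1M, hmM, hMid⟩ := IsAGL.exists_submodule (Q := Q) hx hx0 hA hdim
  have hM : IsRegularFractional M := ⟨hMfg, 1, Submodule.one_le.mp h1M, isUnit_one⟩
  have hMr := hM.isReflexiveDualizing hx hx0 hMid
  obtain ⟨u, v, huv, hMu⟩ := hLr.exists_eq_span_singleton_mul hx hx0 hMr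
  have h1 : m * M ≤ m := by
    rw [Submodule.mul_le]
    rintro _ ⟨r, hr, rfl⟩ z hz
    obtain ⟨b, hb⟩ := Submodule.mem_one.mp (hmM (Submodule.mul_mem_mul ⟨r, hr, rfl⟩ hz))
    rw [Algebra.linearMap_apply] at hb ⊢
    by_contra hnot
    have hbu : IsUnit b := by
      by_contra hbn
      exact hnot ⟨b, hbn, hb⟩
    obtain ⟨c, hc⟩ := hbu.exists_right_inv
    have hc' : algebraMap A Q b * algebraMap A Q c = 1 := by rw [← map_mul, hc, map_one]
    have hzu : z * (algebraMap A Q r * algebraMap A Q c) = 1 := by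
      rw [← hc', hb]; ring
    refine hG (isGorensteinLocal_of_span_singleton hzu ?_)
    -- Since r z = b is a unit of A, every y in M equals (r y) b⁻¹ z, where r y ∈ A.
    have hMz : M = Submodule.span A {z} := by
      refine le_antisymm (fun y hy => ?_) ((Submodule.span_singleton_le_iff_mem _ _).mpr hz)
      obtain ⟨d, hd⟩ := Submodule.mem_one.mp (hmM (Submodule.mul_mem_mul ⟨r, hr, rfl⟩ hy))
      rw [Algebra.linearMap_apply] at hd
      refine Submodule.mem_span_singleton.mpr ⟨d * c, ?_⟩
      rw [Algebra.smul_def, map_mul, hd]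
      linear_combination y * hzu
    rwa [← hMz]
  have h2 : ∀ j, m * M ^ j ≤ m := fun j => by
    induction j with
    | zero => rw [pow_zero, mul_one]
    | succ j ih => rw [pow_succ, ← mul_assoc]; exact (mul_le_mul_left ih _).trans h1
  have hvL : v ∈ L := by
    have h3 : (1 : Q) ∈ M := Submodule.one_le.mp h1M
    rw [hMu, Submodule.mem_span_singleton_mul_of_mul_eq_one huv, mul_one] at h3
    exact h3
  have hMS : M ^ j₀ = Submodule.span A {u} ^ j₀ * S := by rw [hMu, mul_pow, hpow j₀ le_rfl]
  have hvS : Submodule.span A {v} ^ j₀ ≤ S := by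
    rw [← hpow j₀ le_rfl]
    exact pow_le_pow_left' ((Submodule.span_singleton_le_iff_mem _ _).mpr hvL) j₀
  -- From 1 ∈ M = uL one gets u⁻¹ ∈ L, so u^(-j₀) ∈ S and S = u^j₀ u^(-j₀) S ⊆ u^j₀ S = M^j₀.
  have hSM : S ≤ M ^ j₀ := by
    have h4 : (Submodule.span A {u} : Submodule A Q) ^ j₀ * Submodule.span A {v} ^ j₀ = 1 := by
      rw [← mul_pow, Submodule.span_mul_span, Set.singleton_mul_singleton, huv,
        ← Submodule.one_eq_span, one_pow]
    calc S = Submodule.span A {u} ^ j₀ * Submodule.span A {v} ^ j₀ * S := by rw [h4, one_mul]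
      _ ≤ Submodule.span A {u} ^ j₀ * (S * S) := by
        rw [mul_assoc]; exact mul_le_mul_right (mul_le_mul_left hvS _) _
      _ ≤ M ^ j₀ := by rw [hMS]; exact mul_le_mul_right hSS _
  have hmS : S ≤ L / m := by
    rw [Submodule.le_div_iff_mul_le, mul_comm]
    refine (mul_le_mul_right hSM _).trans ((h2 j₀).trans (le_trans ?_ h1L))
    exact covBy_one_coeSubmodule_maximalIdeal.le
  have hne : L ≠ S := fun he => hG (isGorensteinLocal_of_one (Q := Q) (by
    have h5 : L = 1 := le_antisymm (by
      rw [← hLr.div_self, Submodule.le_div_iff_mul_le]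
      nth_rewrite 3 [he]
      rw [he]; exact hSS) h1L
    rwa [← h5]))
  have h6 := hLr.covBy_div_maximalIdeal hx hx0
  have h7 : S = L / m := (h6.eq_or_eq hLS hmS).resolve_left hne.symm
  rwa [h7]

end Tower

/-! ### Regular elements in dimension one -/

section CohenMacaulay

variable {A : Type u} [CommRing A] [IsLocalRing A]

theorem IsCohenMacaulayLocal.exists_regular (h : IsCohenMacaulayLocal A)
    (hdim : ringKrullDim A = 1) : ∃ x ∈ maximalIdeal A, x ∈ nonZeroDivisors A := by
  obtain ⟨-, rs, hrs, hlen⟩ := h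
  rw [hdim] at hlen
  obtain ⟨x, rfl⟩ := List.length_eq_one_iff.mp (show rs.length = 1 by exact_mod_cast hlen.symm)
  refine ⟨x, ?_, ?_⟩
  · by_contra hx
    have hu : IsUnit x := by simpa using hx
    apply hrs.top_ne_smul
    rw [Ideal.ofList_singleton, Ideal.span_singleton_eq_top.mpr hu, Submodule.top_smul]
  · have h1 := (RingTheory.Sequence.isWeaklyRegular_singleton_iff A x).mp hrs.toIsWeaklyRegular
    rw [mem_nonZeroDivisors_iff_right]
    intro z hz
    exact h1 (by simpa [mul_comm] using hz)

theorem isCohenMacaulayLocal_of_regular [IsNoetherianRing A] (hdim : ringKrullDim A = 1) {x : A}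
    (hx : x ∈ maximalIdeal A) (hx0 : x ∈ nonZeroDivisors A) : IsCohenMacaulayLocal A := by
  refine ⟨inferInstance, [x], ⟨?_, ?_⟩, by rw [hdim]; rfl⟩
  · rw [RingTheory.Sequence.isWeaklyRegular_singleton_iff]
    intro y z hyz
    refine sub_eq_zero.mp ((mem_nonZeroDivisors_iff.mp hx0).1 _ ?_)
    rw [mul_sub, sub_eq_zero]
    exact hyz
  · rw [Ideal.ofList_singleton, smul_eq_mul, Ideal.mul_top]
    intro h
    exact hx (Ideal.span_singleton_eq_top.mp h.symm)

theorem IsParameter.mem_nonZeroDivisors {a x : A} (ha : IsParameter a)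
    (hx : x ∈ maximalIdeal A) (hx0 : x ∈ nonZeroDivisors A) : a ∈ nonZeroDivisors A := by
  rw [← ha] at hx
  obtain ⟨n, hn⟩ := hx
  obtain ⟨c, hc⟩ := Ideal.mem_span_singleton'.mp hn
  have h1 := pow_mem hx0 n
  rw [← hc] at h1
  exact (mul_mem_nonZeroDivisors.mp h1).2

theorem mem_nonZeroDivisors_of_sq_eq {α x : A}
    (h : maximalIdeal A ^ 2 = Ideal.span {α} * maximalIdeal A)
    (hx : x ∈ maximalIdeal A) (hx0 : x ∈ nonZeroDivisors A) : α ∈ nonZeroDivisors A := by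
  have h1 := Ideal.pow_mem_pow hx 2
  rw [h, Ideal.mem_span_singleton_mul] at h1
  obtain ⟨y, -, hy⟩ := h1
  have h2 := pow_mem hx0 2
  rw [← hy] at h2
  exact (mul_mem_nonZeroDivisors.mp h2).1

end CohenMacaulay

/-! ### Finite subalgebras of the total ring of fractions -/

section FiniteSubalgebra

variable {A : Type u} [CommRing A] {Q : Type u} [CommRing Q] [Algebra A Q] [IsFractionRing A Q]
  (B : Subalgebra A Q)

variable {B} in
theorem algebraMap_mem_nonZeroDivisors_subalgebra {x : A} (hx : x ∈ nonZeroDivisors A) :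
    algebraMap A B x ∈ nonZeroDivisors B := by
  rw [mem_nonZeroDivisors_iff_right]
  intro b hb
  have h1 := congrArg (algebraMap B Q) hb
  rw [map_mul, map_zero, ← IsScalarTower.algebraMap_apply] at h1
  exact Subtype.ext ((IsRegularFractional.isUnit_algebraMap Q hx).mul_left_eq_zero.mp h1)

theorem isFractionRing_subalgebra : IsFractionRing B Q := by
  have hinjQ := IsFractionRing.injective A Q
  have hsurj : ∀ q : Q, ∃ r s : A, s ∈ nonZeroDivisors A ∧
      q * algebraMap A Q s = algebraMap A Q r := fun q => by
    obtain ⟨⟨r, s⟩, h⟩ := IsLocalization.surj (nonZeroDivisors A) q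
    exact ⟨r, s, s.2, h⟩
  refine ⟨?_, ?_, ?_⟩
  · rintro ⟨b, hb⟩
    obtain ⟨r, s, hs0, hrs⟩ := hsurj b
    have hr : r ∈ nonZeroDivisors A := by
      rw [mem_nonZeroDivisors_iff_right]
      intro t ht
      have h1 : algebraMap A B (t * s) * b = 0 := by
        apply Subtype.ext
        change algebraMap A Q (t * s) * (b : Q) = 0
        rw [map_mul, mul_assoc, mul_comm (algebraMap A Q s), hrs, ← map_mul, ht, map_zero]
      have h2 := (mem_nonZeroDivisors_iff.mp hb).2 _ h1
      have h3 : algebraMap A Q (t * s) = 0 := congrArg Subtype.val h2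
      exact (mem_nonZeroDivisors_iff.mp hs0).2 _ (hinjQ (h3.trans (map_zero _).symm))
    have h4 := IsRegularFractional.isUnit_algebraMap Q hr
    rw [← hrs] at h4
    exact isUnit_of_mul_isUnit_left h4
  · intro q
    obtain ⟨r, s, hs0, hrs⟩ := hsurj q
    refine ⟨⟨algebraMap A B r, ⟨algebraMap A B s, algebraMap_mem_nonZeroDivisors_subalgebra hs0⟩⟩, ?_⟩
    exact hrs
  · intro b c hbc
    exact ⟨1, by rw [Subtype.ext hbc]⟩

variable {B} (hB : (Subalgebra.toSubmodule B).FG)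

include hB

omit [IsFractionRing A Q] in
theorem finite_subalgebra : Module.Finite A B := Module.Finite.iff_fg.mpr hB

omit [IsFractionRing A Q] in
theorem isNoetherianRing_subalgebra [IsNoetherianRing A] : IsNoetherianRing B := by
  have := finite_subalgebra hB
  exact IsNoetherianRing.of_finite A B

theorem isLocalHom_subalgebra : IsLocalHom (algebraMap A B) := by
  have := finite_subalgebra hB
  have : FaithfulSMul A B := (faithfulSMul_iff_algebraMap_injective A B).mpr fun r s h =>
    IsFractionRing.injective A Q (congrArg Subtype.val h)
  infer_instance

variable [IsLocalRing A] [IsLocalRing B]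

theorem algebraMap_mem_maximalIdeal_subalgebra {x : A} (hx : x ∈ maximalIdeal A) :
    algebraMap A B x ∈ maximalIdeal B := by
  have := isLocalHom_subalgebra hB
  exact fun h => hx (isUnit_of_map_unit _ _ h)

/-- 𝔪 is nilpotent modulo x, so by integrality the maximal ideal of B is minimal over x. Krull's
theorem bounds the dimension by one, and regularity of x gives the other inequality. -/
theorem ringKrullDim_subalgebra [IsNoetherianRing A] [Ring.KrullDimLE 1 A] {x : A}
    (hx : x ∈ maximalIdeal A) (hx0 : x ∈ nonZeroDivisors A) : ringKrullDim B = 1 := by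
  have := finite_subalgebra hB
  have := isNoetherianRing_subalgebra hB
  have hxB := algebraMap_mem_maximalIdeal_subalgebra hB hx
  apply le_antisymm
  · rw [← IsLocalRing.maximalIdeal_height_eq_ringKrullDim]
    have h1 : maximalIdeal B ∈ (Ideal.span {algebraMap A B x}).minimalPrimes := by
      refine ⟨⟨inferInstance, (Ideal.span_singleton_le_iff_mem _).mpr hxB⟩, ?_⟩
      rintro P ⟨hP, hxP⟩ -
      have h2 : P.comap (algebraMap A B) = maximalIdeal A := by
        obtain ⟨k, hk⟩ := exists_maximalIdeal_pow_le_span hx0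
        refine ((IsLocalRing.maximalIdeal.isMaximal A).eq_of_le
          (Ideal.IsPrime.ne_top inferInstance) fun r hr => ?_).symm
        have h3 := hk (Ideal.pow_mem_pow hr k)
        obtain ⟨c, hc⟩ := Ideal.mem_span_singleton'.mp h3
        refine hP.mem_of_pow_mem k ?_
        rw [← map_pow, ← hc, map_mul]
        exact P.mul_mem_left _ ((Ideal.span_singleton_le_iff_mem _).mp hxP)
      have h4 : P.IsMaximal := Ideal.isMaximal_of_isIntegral_of_isMaximal_comap (R := A) P
        (h2 ▸ IsLocalRing.maximalIdeal.isMaximal A)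
      exact (IsLocalRing.eq_maximalIdeal h4).ge
    exact_mod_cast Ideal.height_le_one_of_isPrincipal_of_mem_minimalPrimes _ _ h1
  · refine le_trans ?_ (ringKrullDim_quotient_succ_le_of_nonZeroDivisor
      (algebraMap_mem_nonZeroDivisors_subalgebra hx0))
    have : Nontrivial (B ⧸ Ideal.span {algebraMap A B x}) :=
      Ideal.Quotient.nontrivial_iff.mpr fun h => hxB (Ideal.span_singleton_eq_top.mp h)
    calc (1 : WithBot ℕ∞) = 0 + 1 := (zero_add 1).symm
      _ ≤ _ := add_le_add_left ringKrullDim_nonneg_of_nontrivial 1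

end FiniteSubalgebra

/-! ### Relative lengths and change of the base ring -/

section RelativeLength

variable {A M : Type*} [CommRing A] [AddCommGroup M] [Module A M]

theorem length_quotient_comap_subtype_eq_one {X Y : Submodule A M} (h : X ≤ Y) :
    Module.length A (Y ⧸ X.comap Y.subtype) = 1 ↔ X ⋖ Y := by
  rw [Module.length_eq_one_iff, covBy_iff_quot_is_simple h]

theorem length_quotient_comap_subtype_eq_add {X Y Z : Submodule A M} (hXY : X ≤ Y) (hYZ : Y ≤ Z) :
    Module.length A (Z ⧸ X.comap Z.subtype) =
      Module.length A (Z ⧸ Y.comap Z.subtype) + Module.length A (Y ⧸ X.comap Y.subtype) := by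
  rw [length_quotient_eq_add (Submodule.comap_mono (f := Z.subtype) hXY)]
  congr 1
  let e : Y.comap Z.subtype ≃ₗ[A] Y := Submodule.comapSubtypeEquivOfLe hYZ
  refine (Submodule.Quotient.equiv _ _ e ?_).length_eq
  ext y
  constructor
  · rintro ⟨z, hz, rfl⟩
    exact hz
  · intro hy
    exact ⟨e.symm y, hy, e.apply_symm_apply y⟩

end RelativeLength

section SubalgebraModule

variable {A : Type u} [CommRing A] {Q : Type u} [CommRing Q] [Algebra A Q]

/-- A submodule stable under a subalgebra, as a module over that subalgebra. -/
def Submodule.extendToSubalgebra (B : Subalgebra A Q) (X : Submodule A Q)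
    (h : Subalgebra.toSubmodule B * X ≤ X) : Submodule B Q where
  carrier := X
  add_mem' := X.add_mem
  zero_mem' := X.zero_mem
  smul_mem' b _ hq := h (Submodule.mul_mem_mul b.2 hq)

variable {B : Subalgebra A Q} {X Y : Submodule A Q} (hX : Subalgebra.toSubmodule B * X ≤ X)
  (hY : Subalgebra.toSubmodule B * Y ≤ Y)

@[simp]
theorem Submodule.mem_extendToSubalgebra {q : Q} : q ∈ X.extendToSubalgebra B hX ↔ q ∈ X := Iff.rfl

@[simp]
theorem Submodule.restrictScalars_extendToSubalgebra :
    (X.extendToSubalgebra B hX).restrictScalars A = X := rfl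

theorem Submodule.extendToSubalgebra_pow_eq {n : ℕ} (hn : n ≠ 0) (h : X ^ n = Y) :
    X.extendToSubalgebra B hX ^ n = Y.extendToSubalgebra B hY := by
  apply Submodule.restrictScalars_injective A
  rw [Submodule.restrictScalars_pow hn, restrictScalars_extendToSubalgebra, h,
    restrictScalars_extendToSubalgebra]

theorem IsRegularFractional.extendToSubalgebra (h : IsRegularFractional X) :
    IsRegularFractional (X.extendToSubalgebra B hX) := by
  obtain ⟨hfg, u, hu, hu'⟩ := h
  exact ⟨Submodule.FG.of_restrictScalars A hfg, u, hu, hu'⟩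

/-- Each simple factor over B contributes the residue degree to the length over A. -/
theorem length_quotient_comap_extendToSubalgebra [IsLocalRing A] [IsLocalRing B]
    [IsLocalHom (algebraMap A B)] :
    Module.length A (Y ⧸ X.comap Y.subtype) =
      Module.length B (Y.extendToSubalgebra B hY ⧸
        (X.extendToSubalgebra B hX).comap (Y.extendToSubalgebra B hY).subtype) *
          Module.length (ResidueField A) (ResidueField B) := by
  rw [← IsLocalRing.length_restrictScalars A B]
  exact (Submodule.Quotient.restrictScalarsEquiv A
    ((X.extendToSubalgebra B hX).comap (Y.extendToSubalgebra B hY).subtype)).length_eq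

end SubalgebraModule

section ResidueField

variable {A B : Type*} [CommRing A] [IsLocalRing A] [CommRing B] [IsLocalRing B] [Algebra A B]
  [IsLocalHom (algebraMap A B)]

theorem length_residueField_eq_one_iff :
    Module.length (ResidueField A) (ResidueField B) = 1 ↔
      Nonempty (ResidueField A ≃ₐ[A] ResidueField B) := by
  constructor
  · intro h
    have h1 : Module.finrank (ResidueField A) (ResidueField B) = 1 := by
      have : IsSimpleModule (ResidueField A) (ResidueField B) := Module.length_eq_one_iff.mp h
      rw [Module.length_eq_finrank] at h
      exact_mod_cast h
    have h2 : Function.Bijective (algebraMap (ResidueField A) (ResidueField B)) := by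
      refine ⟨(algebraMap (ResidueField A) (ResidueField B)).injective, fun w => ?_⟩
      obtain ⟨c, hc⟩ := (finrank_eq_one_iff_of_nonzero' (1 : ResidueField B) one_ne_zero).mp h1 w
      exact ⟨c, by rw [← hc, Algebra.smul_def, mul_one]⟩
    exact ⟨(AlgEquiv.ofBijective (Algebra.ofId (ResidueField A) (ResidueField B))
      h2).restrictScalars A⟩
  · rintro ⟨e⟩
    rw [← Module.length_eq_of_surjective (M := ResidueField B) (residue_surjective (R := A)),
      ← e.toLinearEquiv.length_eq]
    exact length_quotient_maximalIdeal

end ResidueField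

/-! ### The colon K : 𝔪 as a canonical ideal of 𝔪 : 𝔪 -/

section Core

variable {A : Type u} [CommRing A] {Q : Type u} [CommRing Q] [Algebra A Q]

theorem pow_eq_pow_of_pow_succ_eq {K : Submodule A Q} {N : ℕ} (h : K ^ (N + 1) = K ^ N) :
    ∀ j ≥ N, K ^ j = K ^ N := by
  intro j hj
  induction j, hj using Nat.le_induction with
  | base => rfl
  | succ j _ ih => rw [pow_succ, ih, ← pow_succ, h]

theorem pow_mul_pow_of_pow_succ_eq {K : Submodule A Q} {N : ℕ} (h : K ^ (N + 1) = K ^ N) :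
    K ^ N * K ^ N = K ^ N := by
  rw [← pow_add]
  exact pow_eq_pow_of_pow_succ_eq h _ (Nat.le_add_left N N)

theorem le_pow_of_one_le {K : Submodule A Q} (h1 : 1 ≤ K) {N : ℕ} (h : K ^ (N + 1) = K ^ N) :
    K ≤ K ^ N := by
  rw [← h]
  exact le_self_pow h1 N.succ_ne_zero

theorem div_self_mul_div_le {K Y : Submodule A Q} : Y / Y * (K / Y) ≤ K / Y := by
  rw [Submodule.le_div_iff_mul_le, mul_right_comm, mul_comm]
  exact (mul_le_mul_right (Submodule.le_div_iff_mul_le.mp le_rfl) _).trans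
    (Submodule.le_div_iff_mul_le.mp le_rfl)

variable [IsLocalRing A]

local notation "𝔪" => IsLocalization.coeSubmodule Q (maximalIdeal A)

variable [IsNoetherianRing A] [Ring.KrullDimLE 1 A] [IsFractionRing A Q]
  {α : A} (hα : α ∈ maximalIdeal A) (hα0 : α ∈ nonZeroDivisors A)
  (hsq : maximalIdeal A ^ 2 = Ideal.span {α} * maximalIdeal A)

include hα hα0 hsq

omit [IsNoetherianRing A] [Ring.KrullDimLE 1 A] [IsFractionRing A Q] hα0 in
-- 𝔪² = α𝔪 says that α⁻¹𝔪 multiplies 𝔪 into itself; the other inclusion is α ∈ 𝔪.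
theorem span_mul_colon_eq {β : Q} (hβ : algebraMap A Q α * β = 1) :
    Submodule.span A {algebraMap A Q α} * (𝔪 / 𝔪) = 𝔪 := by
  have hsq' : 𝔪 * 𝔪 = Submodule.span A {algebraMap A Q α} * 𝔪 := by
    rw [← IsLocalization.coeSubmodule_mul, ← pow_two, hsq, IsLocalization.coeSubmodule_mul,
      IsLocalization.coeSubmodule_span_singleton]
  apply le_antisymm
  · rw [Submodule.mul_le]
    intro y hy q hq
    rw [mul_comm]
    exact hq _ ((Submodule.span_singleton_le_iff_mem _ _).mpr (show _ ∈ 𝔪 from ⟨α, hα, rfl⟩) hy)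
  · intro q hq
    rw [Submodule.mem_span_singleton_mul_of_mul_eq_one hβ]
    intro y hy
    rw [mul_assoc, ← Submodule.mem_span_singleton_mul_of_mul_eq_one hβ, ← hsq']
    exact Submodule.mul_mem_mul hq hy

variable {B : Subalgebra A Q} (hB : Subalgebra.toSubmodule B =
    IsLocalization.coeSubmodule Q (maximalIdeal A) / IsLocalization.coeSubmodule Q (maximalIdeal A))
  {K : Submodule A Q} (hK : IsRegularFractional K) (hid : HasFiniteInjectiveDimension A K)
  (h1K : 1 ≤ K) {N : ℕ} (hN : K ^ (N + 1) = K ^ N)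

omit [Ring.KrullDimLE 1 A] hsq in
theorem isRegularFractional_colon : IsRegularFractional (𝔪 / 𝔪 : Submodule A Q) :=
  have hm := IsRegularFractional.coeSubmodule (Q := Q) hα hα0
  hm.div hm

include hB

omit [Ring.KrullDimLE 1 A] hsq in
theorem isRegularFractional_toSubmodule : IsRegularFractional (Subalgebra.toSubmodule B) := by
  rw [hB]
  exact isRegularFractional_colon (Q := Q) hα hα0

omit [IsNoetherianRing A] [Ring.KrullDimLE 1 A] [IsFractionRing A Q] hα hα0 hsq in
theorem toSubmodule_mul_div_le (K : Submodule A Q) :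
    Subalgebra.toSubmodule B * (K / 𝔪) ≤ K / 𝔪 := by
  rw [hB]
  exact div_self_mul_div_le

include hid in
-- From 𝔪 = αB one gets K : 𝔪 = α⁻¹K : B, and α⁻¹K ≅ K.
theorem hasFiniteInjectiveDimension_extend_div :
    HasFiniteInjectiveDimension B
      ((K / 𝔪).extendToSubalgebra B (toSubmodule_mul_div_le hB K)) := by
  obtain ⟨β, hβ⟩ := (IsRegularFractional.isUnit_algebraMap Q hα0).exists_right_inv
  have hβ' := (mul_comm _ _).trans hβ
  refine hasFiniteInjectiveDimension_div_subalgebra hα hα0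
    (hid.of_linearEquiv (Submodule.equivSpanSingletonMul hβ' K)) B
    (isRegularFractional_toSubmodule hα hα0 hB) _ fun q => ?_
  rw [Submodule.mem_extendToSubalgebra, hB, ← span_mul_colon_eq hα hsq hβ,
    Submodule.div_span_singleton_mul hβ]
  rw [Submodule.mem_span_singleton_mul_of_mul_eq_one hβ', span_mul_colon_eq hα hsq hβ]
  refine forall₂_congr fun y _ => ?_
  rw [Submodule.mem_span_singleton_mul_of_mul_eq_one hβ', mul_assoc]

include hK hid h1K hN

/-- The dichotomy behind the classification: either everything is Gorenstein, or the canonical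
fractional ideal `K : 𝔪` of `𝔪 : 𝔪` lies strictly between `K` and the algebra `R[K]`. -/
theorem gorenstein_or_div_le_pow [IsLocalRing B] :
    (IsGorensteinLocal B ∧ K ^ N = K) ∨
      (Subalgebra.toSubmodule B ≤ K / 𝔪 ∧ K / 𝔪 ≤ K ^ N) := by
  obtain ⟨β, hβ⟩ := (IsRegularFractional.isUnit_algebraMap Q hα0).exists_right_inv
  have hβ' := (mul_comm _ _).trans hβ
  have hKr := hK.isReflexiveDualizing hα hα0 hid
  have hcov := hKr.covBy_div_maximalIdeal hα hα0
  have hLid := hasFiniteInjectiveDimension_extend_div hα hα0 hsq hB hid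
  have hBn := isNoetherianRing_subalgebra (isRegularFractional_toSubmodule hα hα0 hB).1
  have hBf := isFractionRing_subalgebra B
  have h1B : (1 : Submodule A Q) ≤ Subalgebra.toSubmodule B := Submodule.one_le.mpr B.one_mem
  by_cases hle : Subalgebra.toSubmodule B ≤ 1
  -- If B = A, then 𝔪 = (α) and 𝔪(K : 𝔪) = K ⋖ K : 𝔪, so K : 𝔪 is principal. Then so is K, and
  -- stable powers force K = 1.
  · left
    have hB1 := le_antisymm hle h1B
    have hm : Submodule.span A {algebraMap A Q α} = 𝔪 := by
      rw [← span_mul_colon_eq hα hsq hβ, ← hB, hB1, mul_one]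
    have hL : K / 𝔪 = Submodule.span A {β} * K := by
      rw [← hm, ← mul_one (Submodule.span A {algebraMap A Q α}),
        Submodule.div_span_singleton_mul hβ, Submodule.div_one']
    have hmL : 𝔪 * (K / 𝔪) = K := by
      rw [hL, ← hm, span_singleton_mul_cancel hβ]
    obtain ⟨u, v, huv, hLu⟩ := (hK.div
      (IsRegularFractional.coeSubmodule (Q := Q) hα hα0)).exists_eq_span_singleton
      (by rw [hmL]; exact hcov)
    have hKu : K = Submodule.span A {algebraMap A Q α * u} := by
      rw [← hmL, hLu, ← hm, Submodule.span_mul_span, Set.singleton_mul_singleton]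
    have hK1 : K = 1 := eq_one_of_pow_succ_eq (u := algebraMap A Q α * u) (v := β * v)
      (by linear_combination u * v * hβ + huv) hKu hN
    refine ⟨isGorensteinLocal_of_span_singleton (Q := Q) hβ' ?_, by rw [hK1, one_pow]⟩
    refine hLid.of_linearEquiv (LinearEquiv.ofEq _ _ ?_)
    ext q
    rw [Submodule.mem_extendToSubalgebra, hL, hK1, ← hB1,
      Submodule.mem_span_singleton_mul_of_mul_eq_one hβ', Submodule.mem_span_singleton]
    constructor
    · intro hq
      refine ⟨⟨_, hq⟩, ?_⟩
      change algebraMap A Q α * q * β = q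
      linear_combination q * hβ
    · rintro ⟨b, rfl⟩
      have : algebraMap A Q α * (b • β) = b := by
        change algebraMap A Q α * ((b : Q) * β) = b
        linear_combination (b : Q) * hβ
      rw [this]
      exact b.2
  -- BK lies between K and its cover K : 𝔪; BK = K would put B inside K : K = A.
  · have hBL : Subalgebra.toSubmodule B * K = K / 𝔪 := by
      have h2 : Subalgebra.toSubmodule B * K ≤ K / 𝔪 := by
        refine le_trans (mul_le_mul_right hcov.le _) (toSubmodule_mul_div_le hB K)
      have h3 : K ≤ Subalgebra.toSubmodule B * K := by
        nth_rewrite 1 [← one_mul K]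
        exact mul_le_mul_left h1B K
      refine (hcov.eq_or_eq h3 h2).resolve_left fun he => hle ?_
      rw [← hKr.div_self, Submodule.le_div_iff_mul_le, he]
    have hBleL : Subalgebra.toSubmodule B ≤ K / 𝔪 := by
      rw [← hBL]
      nth_rewrite 1 [← mul_one (Subalgebra.toSubmodule B)]
      exact mul_le_mul_right h1K _
    by_cases hK1 : K = 1
    · left
      refine ⟨isGorensteinLocal_of_one (Q := Q) ?_, by rw [hK1, one_pow]⟩
      refine hLid.of_linearEquiv (LinearEquiv.ofEq _ _ ?_)
      ext q
      rw [Submodule.mem_extendToSubalgebra, ← hBL, hK1, mul_one, Submodule.mem_one]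
      constructor
      · intro hq
        exact ⟨⟨q, hq⟩, rfl⟩
      · rintro ⟨b, rfl⟩
        exact b.2
    · right
      refine ⟨hBleL, hKr.div_maximalIdeal_le ?_ (lt_of_le_of_ne (le_pow_of_one_le h1K hN) ?_)⟩
      · exact ⟨hK.1.pow N, 1, Submodule.one_le.mp (one_le_pow_of_one_le' h1K N), isUnit_one⟩
      -- If K = K^N then K is closed under multiplication, so K ⊆ K : K = 1.
      · intro he
        have h4 := pow_mul_pow_of_pow_succ_eq hN
        rw [← he] at h4
        exact hK1 (le_antisymm (by
          rw [← hKr.div_self, Submodule.le_div_iff_mul_le, h4]) h1K)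

end Core

/-! ### Invertible canonical ideals and the Gorenstein property -/

section LocallyFree

/-- f and g are mutually inverse up to s ∈ T, so M becomes free of rank one once T is inverted. -/
theorem isLocalizedModule_algebraMap_comp {S M : Type*} [CommRing S] [AddCommGroup M] [Module S M]
    (T : Submonoid S) (S' : Type*) [CommRing S'] [Algebra S S'] [IsLocalization T S']
    (f : M →ₗ[S] S) (g : S →ₗ[S] M) {s : S} (hs : s ∈ T) (hfg : ∀ r, f (g r) = s * r)
    (hgf : ∀ m, g (f m) = s • m) : IsLocalizedModule T ((Algebra.linearMap S S').comp f) where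
  map_units t := IsLocalizedModule.map_units (Algebra.linearMap S S') t
  surj y := by
    obtain ⟨⟨r, t⟩, h⟩ := IsLocalizedModule.surj T (Algebra.linearMap S S') y
    refine ⟨⟨g r, ⟨s, hs⟩ * t⟩, ?_⟩
    rw [mul_smul, h, LinearMap.comp_apply, hfg, ← smul_eq_mul, map_smul]
    rfl
  exists_of_eq {m m'} h := by
    obtain ⟨c, hc⟩ := IsLocalizedModule.exists_of_eq (S := T) (f := Algebra.linearMap S S') h
    refine ⟨c * ⟨s, hs⟩, ?_⟩
    have h1 := congrArg g hc
    rw [Submonoid.smul_def, Submonoid.smul_def, map_smul, map_smul, hgf, hgf, smul_smul,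
      smul_smul] at h1
    exact h1

theorem hasFiniteInjectiveDimension_localization {S M : Type u} [CommRing S] [IsNoetherianRing S]
    [AddCommGroup M] [Module S M] (h : HasFiniteInjectiveDimension S M) (T : Submonoid S)
    (f : M →ₗ[S] S) (g : S →ₗ[S] M) {s : S} (hs : s ∈ T) (hfg : ∀ r, f (g r) = s * r)
    (hgf : ∀ m, g (f m) = s • m) :
    HasFiniteInjectiveDimension (Localization T) (Localization T) := by
  obtain ⟨n, hn⟩ := h
  refine ⟨n, ?_⟩
  have h1 := ModuleCat.localizedModule_hasInjectiveDimensionLE n T (ModuleCat.of S M)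
  have h2 := isLocalizedModule_algebraMap_comp T (Localization T) f g hs hfg hgf
  have h3 := ModuleCat.localizedModule_isLocalizedModule (ModuleCat.of S M) T
  let e := IsLocalizedModule.linearEquiv T ((ModuleCat.of S M).localizedModuleMkLinearMap T)
    ((Algebra.linearMap S (Localization T)).comp f)
  exact (ModuleCat.hasInjectiveDimensionLE_iff_of_linearEquiv
    (N := ModuleCat.of (Localization T) (Localization T))
    (e.extendScalarsOfIsLocalization T (Localization T)) n).mp h1

/-- A ring with an invertible fractional ideal of finite injective dimension is Gorenstein. -/
theorem isGorenstein_of_invertible {S Q : Type u} [CommRing S] [IsNoetherianRing S] [CommRing Q]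
    [Algebra S Q] (hinj : Function.Injective (algebraMap S Q)) {Y Z : Submodule S Q}
    (hY : HasFiniteInjectiveDimension S Y) (hYZ : Y * Z = 1) : IsGorenstein S := by
  refine ⟨inferInstance, fun P hP => ⟨inferInstance, ?_⟩⟩
  -- Since YZ = 1 is not inside P, some product y z = s avoids P. Multiplication by z and by y then
  -- identifies Y with S up to s.
  have h1 : ∃ y ∈ Y, ∃ z ∈ Z, ∃ s ∉ P, algebraMap S Q s = y * z := by
    by_contra! hcon
    have h2 : Y * Z ≤ IsLocalization.coeSubmodule Q P := by
      rw [Submodule.mul_le]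
      intro y hy z hz
      obtain ⟨s, hs⟩ := Submodule.mem_one.mp (hYZ.le (Submodule.mul_mem_mul hy hz))
      by_contra hnot
      exact hcon y hy z hz s (fun hsP => hnot ⟨s, hsP, hs⟩) hs
    rw [hYZ, Submodule.one_le] at h2
    obtain ⟨p, hp, hp1⟩ := h2
    have h3 : p = 1 := hinj (by rw [map_one]; exact hp1)
    exact hP.ne_top ((Ideal.eq_top_iff_one P).mpr (h3 ▸ hp))
  obtain ⟨y, hy, z, hz, s, hs, hsyz⟩ := h1
  let e : S ≃ₗ[S] (1 : Submodule S Q) :=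
    (LinearEquiv.ofInjective (Algebra.linearMap S Q) hinj).trans
      (LinearEquiv.ofEq _ _ (Submodule.one_eq_range).symm)
  have he : ∀ r, (e r : Q) = algebraMap S Q r := fun r => rfl
  let f : Y →ₗ[S] S := e.symm.toLinearMap.comp ((LinearMap.mulRight S z).restrict fun w hw =>
    hYZ.le (Submodule.mul_mem_mul hw hz))
  have hf : ∀ w, algebraMap S Q (f w) = (w : Q) * z := fun w => by
    rw [← he]
    exact congrArg Subtype.val (e.apply_symm_apply _)
  refine hasFiniteInjectiveDimension_localization hY P.primeCompl f
    (LinearMap.toSpanSingleton S Y ⟨y, hy⟩) hs (fun r => hinj ?_) fun w => Subtype.ext ?_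
  · rw [hf, map_mul, hsyz]
    simp [Algebra.smul_def]
    ring
  · simp only [LinearMap.toSpanSingleton_apply, SetLike.val_smul, Algebra.smul_def, hf, hsyz]
    ring

end LocallyFree

/-! ### The length criterion and the Gorenstein property of R[K] -/

section Tower

variable {A : Type u} [CommRing A] {Q : Type u} [CommRing Q] [Algebra A Q] {B : Subalgebra A Q}
  {K : Submodule A Q} {N : ℕ} (hN : K ^ (N + 1) = K ^ N)

include hN

theorem toSubmodule_mul_pow_le (hBS : Subalgebra.toSubmodule B ≤ K ^ N) : Subalgebra.toSubmodule B * K ^ N ≤ K ^ N := by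
  refine (mul_le_mul_left hBS _).trans ?_
  rw [pow_mul_pow_of_pow_succ_eq hN]

theorem extendToSubalgebra_mul_self_le (hBS : Subalgebra.toSubmodule B ≤ K ^ N) :
    (K ^ N).extendToSubalgebra B (toSubmodule_mul_pow_le hN hBS) *
      (K ^ N).extendToSubalgebra B (toSubmodule_mul_pow_le hN hBS) ≤
        (K ^ N).extendToSubalgebra B (toSubmodule_mul_pow_le hN hBS) := by
  rw [Submodule.mul_le]
  intro y hy z hz
  have := Submodule.mul_mem_mul hy hz
  exact (pow_mul_pow_of_pow_succ_eq hN).le (Submodule.mul_mem_mul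
    (show y ∈ K ^ N from hy) (show z ∈ K ^ N from hz))

omit hN in
theorem ENat.add_one_eq_two_iff {n : ℕ∞} : n + 1 = 2 ↔ n = 1 := by
  rw [← one_add_one_eq_two]
  exact (ENat.add_left_injective_of_ne_top ENat.one_ne_top).eq_iff

variable [IsLocalRing A] (hB : Subalgebra.toSubmodule B =
    IsLocalization.coeSubmodule Q (maximalIdeal A) / IsLocalization.coeSubmodule Q (maximalIdeal A))

local notation "𝔪" => IsLocalization.coeSubmodule Q (maximalIdeal A)

include hB

/-- K ⊆ K : 𝔪 ⊆ K^N squeezes the j-th power between K^j and K^(Nj), both equal to K^N. The bound N +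
1 keeps j nonzero: zeroth powers over A and over B differ. -/
theorem extendToSubalgebra_pow_eq_of_ge (hBL : Subalgebra.toSubmodule B ≤ K / 𝔪)
    (hKL : K ≤ K / 𝔪) (hLS : K / 𝔪 ≤ K ^ N) : ∀ j ≥ N + 1,
      (K / 𝔪).extendToSubalgebra B (toSubmodule_mul_div_le hB K) ^ j =
        (K ^ N).extendToSubalgebra B (toSubmodule_mul_pow_le hN (hBL.trans hLS)) := by
  intro j hj
  refine Submodule.extendToSubalgebra_pow_eq _ _ (by omega) (le_antisymm ?_ ?_)
  · refine (pow_le_pow_left' hLS j).trans ?_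
    rw [← pow_mul, pow_eq_pow_of_pow_succ_eq hN]
    exact Nat.le_mul_of_pos_right N (by omega)
  · rw [← pow_eq_pow_of_pow_succ_eq hN j (by omega)]
    exact pow_le_pow_left' hKL j

variable [IsNoetherianRing A] [Ring.KrullDimLE 1 A] [IsFractionRing A Q] [IsLocalRing B]
  {α : A} (hα : α ∈ maximalIdeal A) (hα0 : α ∈ nonZeroDivisors A)
  (hK : IsRegularFractional K) (hid : HasFiniteInjectiveDimension A K)

include hα hα0 hK hid

/-- The data carried by the non-Gorenstein branch: the relative length of `K` in `R[K]`, and the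
chain `K : 𝔪 ⊆ R[K]` of fractional ideals of `𝔪 : 𝔪`. -/
theorem length_eq_two_iff (hBL : Subalgebra.toSubmodule B ≤ K / 𝔪) (hLS : K / 𝔪 ≤ K ^ N) :
    Module.length A ((K ^ N : Submodule A Q) ⧸ K.comap (K ^ N).subtype) = 2 ↔
      (K / 𝔪).extendToSubalgebra B (toSubmodule_mul_div_le hB K) ⋖
        (K ^ N).extendToSubalgebra B (toSubmodule_mul_pow_le hN (hBL.trans hLS)) ∧
      Nonempty (ResidueField A ≃ₐ[A] ResidueField B) := by
  have hKr := hK.isReflexiveDualizing hα hα0 hid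
  have hcov := hKr.covBy_div_maximalIdeal hα hα0
  have hloc := isLocalHom_subalgebra (isRegularFractional_toSubmodule hα hα0 hB).1
  rw [length_quotient_comap_subtype_eq_add hcov.le hLS,
    (length_quotient_comap_subtype_eq_one hcov.le).mpr hcov, ENat.add_one_eq_two_iff,
    length_quotient_comap_extendToSubalgebra (toSubmodule_mul_div_le hB K)
      (toSubmodule_mul_pow_le hN (hBL.trans hLS)), mul_eq_one,
    length_quotient_comap_subtype_eq_one, length_residueField_eq_one_iff]
  exact hLS

variable (h1K : 1 ≤ K) (hsq : maximalIdeal A ^ 2 = Ideal.span {α} * maximalIdeal A)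

include h1K hsq

theorem length_eq_two_iff_isAGL :
    Module.length A ((K ^ N : Submodule A Q) ⧸ K.comap (K ^ N).subtype) = 2 ↔
      (¬ IsGorensteinLocal B ∧ IsAGL B) ∧ Nonempty (ResidueField A ≃ₐ[A] ResidueField B) := by
  have hBr := isRegularFractional_toSubmodule hα hα0 hB
  have hKr := hK.isReflexiveDualizing hα hα0 hid
  have hcov := hKr.covBy_div_maximalIdeal hα hα0
  rcases gorenstein_or_div_le_pow hα hα0 hsq hB hK hid h1K hN with ⟨hG, hS⟩ | ⟨hBL, hLS⟩
  -- In this branch S = K, so the length is 0 and both sides fail.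
  · refine iff_of_false (fun h => ?_) fun h => h.1.1 hG
    rw [hS, Module.length_eq_zero_iff.mpr] at h
    · exact two_ne_zero h.symm
    · rw [Submodule.Quotient.subsingleton_iff, Submodule.comap_subtype_self]
  · have := isNoetherianRing_subalgebra hBr.1
    have := isFractionRing_subalgebra B
    have hdim := ringKrullDim_subalgebra hBr.1 hα hα0
    have : Ring.KrullDimLE 1 B := Ring.krullDimLE_iff.mpr (by rw [hdim]; rfl)
    have hxB := algebraMap_mem_maximalIdeal_subalgebra hBr.1 hα
    have hxB0 : algebraMap A B α ∈ nonZeroDivisors B := algebraMap_mem_nonZeroDivisors_subalgebra hα0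
    have hCM : IsCohenMacaulayLocal B := isCohenMacaulayLocal_of_regular hdim hxB hxB0
    have hm := IsRegularFractional.coeSubmodule (Q := Q) hα hα0
    have hSr : IsRegularFractional (K ^ N) :=
      ⟨hK.1.pow N, 1, Submodule.one_le.mp (one_le_pow_of_one_le' h1K N), isUnit_one⟩
    have hL := (hK.div hm).extendToSubalgebra (toSubmodule_mul_div_le hB K)
    have hLid := hasFiniteInjectiveDimension_extend_div hα hα0 hsq hB hid
    have h1L : 1 ≤ (K / 𝔪).extendToSubalgebra B (toSubmodule_mul_div_le hB K) :=
      Submodule.one_le.mpr (hBL B.one_mem)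
    have hpow := extendToSubalgebra_pow_eq_of_ge hN hB hBL hcov.le hLS
    have hSS := extendToSubalgebra_mul_self_le hN (hBL.trans hLS)
    rw [length_eq_two_iff hN hB hα hα0 hK hid hBL hLS]
    refine and_congr_left fun _ => ⟨fun h => ?_, fun h => ?_⟩
    · exact (isAGL_of_covBy hxB hxB0 hL hLid h1L hLS hSS hpow hCM hdim
        (hSr.extendToSubalgebra _) h).symm
    · exact covBy_of_isAGL hxB hxB0 hL hLid h1L hLS hSS hpow hdim h.2 h.1

/-- With L = K : 𝔪, the maximal ideal 𝔫 = L : S = K : 𝔪S = α⁻¹K : S is a canonical ideal of S, and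
𝔫(S : 𝔫) = S makes it invertible over S. -/
theorem isGorenstein_of_length_eq_two
    (h : Module.length A ((K ^ N : Submodule A Q) ⧸ K.comap (K ^ N).subtype) = 2)
    (hmult : IsMultiplicity B (embDim B)) {S : Subalgebra A Q}
    (hS : Subalgebra.toSubmodule S = K ^ N) : IsGorenstein S := by
  have hBr := isRegularFractional_toSubmodule hα hα0 hB
  have hKr := hK.isReflexiveDualizing hα hα0 hid
  have hcov := hKr.covBy_div_maximalIdeal hα hα0
  have hnG := ((length_eq_two_iff_isAGL hN hB hα hα0 hK hid h1K hsq).mp h).1.1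
  obtain ⟨hBL, hLS⟩ := (gorenstein_or_div_le_pow hα hα0 hsq hB hK hid h1K hN).resolve_left
    fun h => hnG h.1
  have h2 := ((length_eq_two_iff hN hB hα hα0 hK hid hBL hLS).mp h).1
  have := isNoetherianRing_subalgebra hBr.1
  have := isFractionRing_subalgebra B
  have hdim := ringKrullDim_subalgebra hBr.1 hα hα0
  have : Ring.KrullDimLE 1 B := Ring.krullDimLE_iff.mpr (by rw [hdim]; rfl)
  have hxB := algebraMap_mem_maximalIdeal_subalgebra hBr.1 hα
  have hxB0 : algebraMap A B α ∈ nonZeroDivisors B := algebraMap_mem_nonZeroDivisors_subalgebra hα0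
  have hm := IsRegularFractional.coeSubmodule (Q := Q) hα hα0
  have hSr : IsRegularFractional (K ^ N) :=
    ⟨hK.1.pow N, 1, Submodule.one_le.mp (one_le_pow_of_one_le' h1K N), isUnit_one⟩
  have hL := (hK.div hm).extendToSubalgebra (toSubmodule_mul_div_le hB K)
  have hLid := hasFiniteInjectiveDimension_extend_div hα hα0 hsq hB hid
  have hBS := toSubmodule_mul_pow_le hN (hBL.trans hLS)
  have hSB := hSr.extendToSubalgebra hBS
  have hSn := isNoetherianRing_subalgebra (B := S) (by rw [hS]; exact hSr.1)
  set n := IsLocalization.coeSubmodule Q (maximalIdeal B)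
  have hnS : n * ((K ^ N).extendToSubalgebra B hBS / n) = (K ^ N).extendToSubalgebra B hBS :=
    maximalIdeal_mul_div_eq_of_covBy hxB hxB0 hL hLid hSB h2
      (sq_div_maximalIdeal_eq_of_isMultiplicity hxB hxB0 hmult)
  have hn : (K / 𝔪).extendToSubalgebra B (toSubmodule_mul_div_le hB K) /
      (K ^ N).extendToSubalgebra B hBS = n := by
    rw [← div_maximalIdeal_eq_of_covBy hxB hxB0 hL hLid hSB h2]
    exact (hL.isReflexiveDualizing hxB hxB0 hLid).2 _ (IsRegularFractional.coeSubmodule hxB hxB0)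
  have hmul : ∀ s ∈ S, ∀ y ∈ K ^ N, s * y ∈ K ^ N := fun s hs y hy =>
    (pow_mul_pow_of_pow_succ_eq hN).le (Submodule.mul_mem_mul (hS.le hs) hy)
  have hY : Subalgebra.toSubmodule S * n.restrictScalars A ≤ n.restrictScalars A := by
    rw [Submodule.mul_le]
    intro s hs y hy
    rw [Submodule.restrictScalars_mem, ← hn] at hy ⊢
    intro z hz
    rw [mul_comm s, mul_assoc]
    exact hy _ (hmul s hs z hz)
  have hZ : Subalgebra.toSubmodule S *
      ((K ^ N).extendToSubalgebra B hBS / n).restrictScalars A ≤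
        ((K ^ N).extendToSubalgebra B hBS / n).restrictScalars A := by
    rw [Submodule.mul_le]
    intro s hs y hy z hz
    rw [mul_assoc]
    exact hmul s hs _ (hy z hz)
  obtain ⟨β, hβ⟩ := (IsRegularFractional.isUnit_algebraMap Q hα0).exists_right_inv
  have hβ' := (mul_comm _ _).trans hβ
  have h1B : (1 : Submodule A Q) ≤ Subalgebra.toSubmodule B := Submodule.one_le.mpr B.one_mem
  have hmS : 𝔪 * K ^ N = Submodule.span A {algebraMap A Q α} * K ^ N := by
    have h3 : Subalgebra.toSubmodule B * K ^ N = K ^ N := by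
      refine le_antisymm hBS ?_
      nth_rewrite 1 [← one_mul (K ^ N)]
      exact mul_le_mul_left h1B _
    nth_rewrite 1 [← span_mul_colon_eq hα hsq hβ]
    rw [← hB, mul_assoc, h3]
  have hYid : HasFiniteInjectiveDimension S ((n.restrictScalars A).extendToSubalgebra S hY) := by
    refine hasFiniteInjectiveDimension_div_subalgebra hα hα0
      (hid.of_linearEquiv (Submodule.equivSpanSingletonMul hβ' K)) S (hS ▸ hSr) _ fun q => ?_
    rw [Submodule.mem_extendToSubalgebra, Submodule.restrictScalars_mem, ← hn, hS]
    change q ∈ K / 𝔪 / K ^ N ↔ _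
    rw [Submodule.div_div_eq, hmS, Submodule.div_span_singleton_mul hβ,
      Submodule.mem_span_singleton_mul_of_mul_eq_one hβ']
    refine forall₂_congr fun y _ => ?_
    rw [Submodule.mem_span_singleton_mul_of_mul_eq_one hβ', mul_assoc]
  refine isGorenstein_of_invertible Subtype.val_injective hYid
    (Z := (((K ^ N).extendToSubalgebra B hBS / n).restrictScalars A).extendToSubalgebra S hZ) ?_
  apply Submodule.restrictScalars_injective A
  rw [Submodule.restrictScalars_mul, Submodule.restrictScalars_extendToSubalgebra,
    Submodule.restrictScalars_extendToSubalgebra, ← Submodule.restrictScalars_mul, hnS,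
    Submodule.restrictScalars_extendToSubalgebra, ← hS]
  ext q
  rw [Submodule.restrictScalars_mem, Submodule.mem_one]
  exact ⟨fun hq => ⟨⟨q, hq⟩, rfl⟩, fun ⟨s, hs⟩ => hs ▸ s.2⟩

end Tower

/-! ### The fractional ideal I/a and the main theorem -/

section IdealDiv

variable {A : Type u} [CommRing A] {I : Ideal A} {a : A}

/-- An ideal is isomorphic to its image in the total ring of fractions. -/
noncomputable def coeSubmoduleEquiv (Q : Type u) [CommRing Q] [Algebra A Q] [IsFractionRing A Q]
    (J : Ideal A) : J ≃ₗ[A] IsLocalization.coeSubmodule Q J :=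
  Submodule.equivMapOfInjective (Algebra.linearMap A Q) (IsFractionRing.injective A Q) J

theorem coeSubmodule_pow {Q : Type*} [CommRing Q] [Algebra A Q] (J : Ideal A)
    (n : ℕ) :
    IsLocalization.coeSubmodule Q (J ^ n) = IsLocalization.coeSubmodule Q J ^ n := by
  induction n with
  | zero => rw [pow_zero, pow_zero, Ideal.one_eq_top, IsLocalization.coeSubmodule_top]
  | succ n ih => rw [pow_succ, pow_succ, IsLocalization.coeSubmodule_mul, ih]

theorem one_le_idealDiv (haI : a ∈ I) : 1 ≤ idealDiv I a := by
  rw [Submodule.one_le]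
  exact ⟨a, haI, by simp⟩

variable {b : FractionRing A} (hab : algebraMap A (FractionRing A) a * b = 1)

include hab

theorem idealDiv_eq_span_mul :
    idealDiv I a = Submodule.span A {b} * IsLocalization.coeSubmodule (FractionRing A) I := by
  ext q
  rw [Submodule.mem_span_singleton_mul_of_mul_eq_one ((mul_comm _ _).trans hab)]
  rfl

theorem idealDiv_pow (n : ℕ) : idealDiv I a ^ n =
    Submodule.span A {b ^ n} * IsLocalization.coeSubmodule (FractionRing A) (I ^ n) := by
  rw [idealDiv_eq_span_mul hab, mul_pow, Submodule.span_pow, Set.singleton_pow,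
    coeSubmodule_pow]

theorem idealDiv_pow_succ_eq {N : ℕ} (hN : I ^ (N + 1) = Ideal.span {a} * I ^ N) :
    idealDiv I a ^ (N + 1) = idealDiv I a ^ N := by
  rw [idealDiv_pow hab, idealDiv_pow hab, hN, IsLocalization.coeSubmodule_mul, ← mul_assoc,
    IsLocalization.coeSubmodule_span_singleton, Submodule.span_mul_span,
    Set.singleton_mul_singleton, pow_succ, mul_assoc, mul_comm b, hab, mul_one]

/-- Stability of powers makes K^N multiplicatively closed, and 1 ∈ K puts K inside it. -/
theorem toSubmodule_adjoinIdealDiv (haI : a ∈ I) {N : ℕ}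
    (hN : I ^ (N + 1) = Ideal.span {a} * I ^ N) :
    Subalgebra.toSubmodule (adjoinIdealDiv I a) = idealDiv I a ^ N := by
  have h1 := one_le_idealDiv haI
  have hK := idealDiv_pow_succ_eq hab hN
  apply le_antisymm
  · have h2 : (1 : FractionRing A) ∈ idealDiv I a ^ N :=
      Submodule.one_le.mp (one_le_pow_of_one_le' h1 N)
    have h3 : adjoinIdealDiv I a ≤ (idealDiv I a ^ N).toSubalgebra h2 fun x y hx hy =>
        (pow_mul_pow_of_pow_succ_eq hK).le (Submodule.mul_mem_mul hx hy) :=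
      Algebra.adjoin_le (le_pow_of_one_le h1 hK)
    exact h3
  · refine (pow_le_pow_left' (show idealDiv I a ≤ Subalgebra.toSubmodule (adjoinIdealDiv I a) from
      Algebra.subset_adjoin) N).trans ?_
    cases N with
    | zero =>
      rw [pow_zero, Submodule.one_le]
      exact (adjoinIdealDiv I a).one_mem
    | succ n => rw [(adjoinIdealDiv I a).isIdempotentElem_toSubmodule.pow_succ_eq]

theorem isRegularFractional_idealDiv (hI : I.FG) (haI : a ∈ I) :
    IsRegularFractional (idealDiv I a) := by
  refine ⟨?_, 1, Submodule.one_le.mp (one_le_idealDiv haI), isUnit_one⟩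
  rw [idealDiv_eq_span_mul hab]
  exact (Submodule.fg_span_singleton b).mul (Submodule.FG.map _ hI)

/-- Division by a^(N+1) carries I^(N+1) onto K^(N+1) = K^N and a^N I onto K. -/
theorem length_quotient_idealDiv {N : ℕ} (hN : I ^ (N + 1) = Ideal.span {a} * I ^ N) :
    Module.length A ((idealDiv I a ^ N : Submodule A (FractionRing A)) ⧸
      (idealDiv I a).comap (idealDiv I a ^ N).subtype) =
    Module.length A ((I ^ (N + 1) : Ideal A) ⧸
      Submodule.comap (Submodule.subtype (I ^ (N + 1) : Ideal A)) (Ideal.span {a} ^ N * I)) := by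
  have hb : b ^ (N + 1) * algebraMap A (FractionRing A) a ^ (N + 1) = 1 := by
    rw [← mul_pow, mul_comm b, hab, one_pow]
  let e : (I ^ (N + 1) : Ideal A) ≃ₗ[A] (idealDiv I a ^ N : Submodule A (FractionRing A)) :=
    (coeSubmoduleEquiv (FractionRing A) (I ^ (N + 1))).trans
      ((Submodule.equivSpanSingletonMul hb _).trans (LinearEquiv.ofEq _ _
        ((idealDiv_pow hab _).symm.trans (idealDiv_pow_succ_eq hab hN))))
  refine (Submodule.Quotient.equiv _ _ e ?_).length_eq.symm
  have he : ∀ y, (e y : FractionRing A) = b ^ (N + 1) * algebraMap A (FractionRing A) y :=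
    fun y => rfl
  have key : ∀ y : (I ^ (N + 1) : Ideal A), (e y : FractionRing A) ∈ idealDiv I a ↔
      (y : A) ∈ Ideal.span {a} ^ N * I := by
    intro y
    rw [he, Ideal.span_singleton_pow, Ideal.mem_span_singleton_mul]
    have h1 : algebraMap A (FractionRing A) a * (b ^ (N + 1) * algebraMap A (FractionRing A) y) =
        b ^ N * algebraMap A (FractionRing A) y := by
      rw [pow_succ]
      linear_combination b ^ N * algebraMap A (FractionRing A) y * hab
    have h2 : b ^ N * algebraMap A (FractionRing A) a ^ N = 1 := by
      rw [← mul_pow, mul_comm b, hab, one_pow]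
    change (∃ z, z ∈ I ∧ algebraMap A (FractionRing A) z = _ * _) ↔ _
    rw [h1]
    refine exists_congr fun z => and_congr_right fun _ => ?_
    constructor
    · intro h
      apply IsFractionRing.injective A (FractionRing A)
      rw [map_mul, map_pow, h]
      linear_combination algebraMap A (FractionRing A) y * h2
    · intro h
      rw [← h, map_mul, map_pow]
      linear_combination -algebraMap A (FractionRing A) z * h2
  ext q
  constructor
  · rintro ⟨y, hy, rfl⟩
    exact (key y).mpr hy
  · intro hq
    obtain ⟨y, rfl⟩ := e.surjective q
    exact ⟨y, (key y).mp hq, rfl⟩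

end IdealDiv

theorem is2AGL_iff_length_eq_two {A : Type u} [CommRing A] [IsLocalRing A] {I : Ideal A} {a : A}
    (ha : a ∈ nonZeroDivisors A) (haI : a ∈ I) {N : ℕ}
    (hN : I ^ (N + 1) = Ideal.span {a} * I ^ N) :
    Is2AGL I (Ideal.span {a}) ↔ Module.length A
      ((idealDiv I a ^ N : Submodule A (FractionRing A)) ⧸
        (idealDiv I a).comap (idealDiv I a ^ N).subtype) = 2 := by
  obtain ⟨b, hab⟩ := (IsRegularFractional.isUnit_algebraMap (FractionRing A) ha).exists_right_inv
  rw [length_quotient_idealDiv hab hN]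
  constructor
  · rintro ⟨_, h⟩
    rwa [sallyRank_eq_length ha haI hN] at h
  · intro h
    have := isPrime_maximalIdealRees ha
    exact ⟨this, by rwa [sallyRank_eq_length ha haI hN]⟩

theorem corollary6p3 {R : Type u} [CommRing R] [IsLocalRing R]
    (hCM : IsCohenMacaulayLocal R) (hdim : ringKrullDim R = 1)
    (I : Ideal R) (hI : I ≠ ⊤) (hIcan : IsCanonicalModule R I)
    (a : R) (ha : IsParameter a) (hred : IsReductionOf (Ideal.span {a}) I)
    (α : R) (hα : α ∈ maximalIdeal R)
    (hmα : maximalIdeal R ^ 2 = Ideal.span {α} * maximalIdeal R)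
    [IsLocalRing (colonSelf (maximalIdeal R))] :
    (Is2AGL I (Ideal.span {a}) ↔
      (¬ IsGorensteinLocal (colonSelf (maximalIdeal R)) ∧ IsAGL (colonSelf (maximalIdeal R))) ∧
        Nonempty (ResidueField R ≃ₐ[R] ResidueField (colonSelf (maximalIdeal R)))) ∧
    (Is2AGL I (Ideal.span {a}) →
      IsMultiplicity (colonSelf (maximalIdeal R)) (embDim (colonSelf (maximalIdeal R))) →
        IsGorenstein (adjoinIdealDiv I a)) := by
  have := hCM.1
  have : Ring.KrullDimLE 1 R := Ring.krullDimLE_iff.mpr (by rw [hdim]; rfl)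
  obtain ⟨x, hx, hx0⟩ := hCM.exists_regular hdim
  have ha0 := ha.mem_nonZeroDivisors hx hx0
  have hα0 := mem_nonZeroDivisors_of_sq_eq hmα hx hx0
  obtain ⟨haI, N, hN⟩ := hred
  replace haI := (Ideal.span_singleton_le_iff_mem _).mp haI
  obtain ⟨b, hab⟩ := (IsRegularFractional.isUnit_algebraMap (FractionRing R) ha0).exists_right_inv
  have hKN := idealDiv_pow_succ_eq hab hN
  have hK := isRegularFractional_idealDiv hab (IsNoetherian.noetherian I) haI
  have h1K := one_le_idealDiv haI
  have hB : Subalgebra.toSubmodule (colonSelf (maximalIdeal R)) =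
      IsLocalization.coeSubmodule (FractionRing R) (maximalIdeal R) /
        IsLocalization.coeSubmodule (FractionRing R) (maximalIdeal R) := rfl
  have hid : HasFiniteInjectiveDimension R (idealDiv I a) :=
    hIcan.2.1.of_linearEquiv ((coeSubmoduleEquiv (FractionRing R) I).trans
      ((Submodule.equivSpanSingletonMul ((mul_comm _ _).trans hab) _).trans
        (LinearEquiv.ofEq _ _ (idealDiv_eq_span_mul hab).symm)))
  rw [is2AGL_iff_length_eq_two ha0 haI hN]
  exact ⟨length_eq_two_iff_isAGL hKN hB hα hα0 hK hid h1K hmα, fun h hmult =>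
    isGorenstein_of_length_eq_two hKN hB hα hα0 hK hid h1K hmα h hmult
      (toSubmodule_adjoinIdealDiv hab haI hN)⟩
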